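/- Let $k$ be a commutative ring with unit. All categories below are small, and $[n]=\{0<\dots<n\}$, $[-1]=\emptyset$. **Dg-categories.** A dg-category $\mathcal C$ over $k$ has chain complexes of $k$-modules $\mathcal C_\bullet(x,y)$ ($\mathbb Z$-graded, $\partial$ of degree $-1$), associative unital composition with $\partial(g\circ f)=\partial g\circ f+(-1)^{|g|}g\circ\partial f$, and identities in degree $0$ with $\partial(\mathrm{id})=0$. With dg-functors these form the category $dg\mathrm{Cat}(k)$. **The dg-nerve.** $N^{dg}(\mathcal C)_n$ is the set of pairs $((x_i)_{i=0}^n,(a_I)_I)$ with $x_i\in\mathrm{Ob}(\mathcal C)$ and, for every $I=\{i_0<\dots<i_m\}\subseteq[n]$ with $m\ge1$, an element $a_I\in\mathcal C_{m-1}(x_{i_0},x_{i_m})$ such that $$\partial(a_I)=\sum_{j=1}^{m-1}\Big((-1)^j a_{I\setminus\{i_j\}}+(-1)^{m(j+1)}a_{\{i_j<\dots<i_m\}}\circ a_{\{i_0<\dots<i_j\}}\Big).$$ A monotone map $f:[n']\to[n]$ acts by $(x_i)_i\mapsto(x_{f(i)})_i$ and $(a_I)_I\mapsto(b_J)_J$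 with $b_J=a_{f(J)}$ if $f|_J$ is injective, $b_J=\mathrm{id}$ if $J=\{j<j'\}$ and $f(j)=f(j')$, and $b_J=0$ otherwise. Dg-functors act entrywise. This gives a functor $N^{dg}:dg\mathrm{Cat}(k)\to\mathrm{SSet}$. **Templicial modules.** A $k$-quiver on a set $S$ is a family $Q(a,b)$, $a,b\in S$, of $k$-modules. Quivers on $S$ are monoidal with $(Q\otimes P)(a,b)=\bigoplus_{c\in S}Q(a,c)\otimes_k P(c,b)$, the unit being $k$ for $a=b$ and $0$ otherwise. Let $\nabla_f$ be the category of the posets $[n]$, $n\ge0$, and endpoint-preserving monotone maps, monoidal via $[p]+[q]=[p+q]$. A templicial $k$-module $(X,S)$ is a set $S$ with a strongly unital colax monoidal functor $X$ from $\nabla_f^{op}$ to $k$-quivers on $S$; that is, it has comultiplications $\mu_{p,q}:X_{p+q}\to X_p\otimes X_q$ and an isomorphism $\epsilon$ from $X_0$ to the unit. A morphism $(X,S)\to(Y,S')$ is a map $f:S\to S'$ with linear maps $X_n(a,b)\to Y_n(f(a),f(b))$ compatible with this structure (equivalently, a monoidal natural transformation $f_!X\to Y$). For a simplicial set $K$,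 let $\tilde F(K)$ be the templicial module with base set $K_0$ for which $\tilde F(K)_n(a,b)$ is free on the $n$-simplices with first vertex $a$ and last vertex $b$, with $\mu_{p,q}(\sigma)=\sigma|_{\{0,\dots,p\}}\otimes\sigma|_{\{p,\dots,p+q\}}$. Its right adjoint $\tilde U$ is $\tilde U(X)_n=\mathrm{Hom}(\tilde F(\Delta^n),X)$, the underlying simplicial set of $X$. **The functor $\tilde\Gamma$.** For a chain complex $C$ and $n\ge-1$, let $\tilde\Gamma(C)_n$ be the module of families $(a_I)_{I\subseteq[n]}$, $a_I\in C_{|I|}$, with $\partial(a_I)=\sum_{j=0}^{p}(-1)^ja_{I\setminus\{i_j\}}$ for $I=\{i_0<\dots<i_p\}$ and $\partial(a_\emptyset)=0$. A monotone map $f:[n']\to[n]$ acts by $(f^*a)_J=a_{f(J)}$ if $f|_J$ is injective and $0$ otherwise. For a dg-category $\mathcal C$, let $\mathcal A=\tilde\Gamma(\mathcal C)$ have the objects of $\mathcal C$, the augmented simplicial modules $\mathcal A(x,y)=\tilde\Gamma(\mathcal C_\bullet(x,y))$, identities in $\mathcal A(x,x)_{-1}$, and composition $$\mathcal A(x,y)_{r-1}\otimes\mathcal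 A(y,z)_{s-1}\to\mathcal A(x,z)_{r+s-1},\qquad (a\otimes b)_J=(-1)^{|J_1||J_2|}\,b_{J_2}\circ a_{J_1},$$ where $J_1=J\cap\{0,\dots,r-1\}$ and $J_2=\{j-r\mid j\in J,\ j\ge r\}$. It is compatible with the join of ordinals. **The linear dg-nerve.** $N^{dg}_k(\mathcal C)$ is the templicial module with base set $\mathrm{Ob}(\mathcal C)$ and $$N^{dg}_k(\mathcal C)_n(a,b)=\bigoplus\ \mathcal A(y_0,y_1)_{i_1-i_0-2}\otimes\dots\otimes\mathcal A(y_{m-1},y_m)_{i_m-i_{m-1}-2},$$ the sum being over all $I=\{0=i_0<\dots<i_m=n\}$ and all objects $a=y_0,y_1,\dots,y_m=b$ (for $n=0$ the summand with $I=\{0\}$ is $k$, and it occurs only for $a=b$). The factor $\mathcal A(y_{r-1},y_r)_{i_r-i_{r-1}-2}$ is attached to the ordinal of the integers strictly between $i_{r-1}$ and $i_r$. An endpoint-preserving monotone map $f:[n']\to[n]$ maps the summand of $(I,y)$ to that of $(f^{-1}(I),y\circ f)$: for consecutive $s<t$ in $f^{-1}(I)$, the new factor is the identity of $y_{f(s)}$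 if $f(s)=f(t)$, and otherwise it is the composite of the factors between $f(s)$ and $f(t)$, restricted along the map induced by $f$ from $\{u\mid s<u<t\}$ to $\{v\notin I\mid f(s)<v<f(t)\}$. The comultiplication $\mu_{p,q}$ cuts a tensor of the summand of $(I,y)$ at $p$ if $p\in I$, and is $0$ on this summand if $p\notin I$. Dg-functors act factorwise. This gives a functor $N^{dg}_k$ from $dg\mathrm{Cat}(k)$ to templicial $k$-modules. **Theorem.** There is a natural isomorphism $$\tilde U\circ N^{dg}_k\;\simeq\;N^{dg}$$ of functors $dg\mathrm{Cat}(k)\to\mathrm{SSet}$: the underlying simplicial set of the linear dg-nerve of a dg-category is, naturally in the dg-category, its classical dg-nerve. -/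

import Mathlib

open CategoryTheory Opposite
open scoped TensorProduct DirectSum Simplicial

universe u

namespace LinDG

/-! ## Small dg-categories -/

/-- A small dg-category over `k` (homological grading by `ℤ`, differential of degree `-1`):
`comp h g f` is the composite `g ∘ f` of `f : x ⟶ y` of degree `q` and `g : y ⟶ z` of degree `p`. -/
structure DGCat (k : Type u) [CommRing k] where
  Obj : Type u
  hom : Obj → Obj → ChainComplex (ModuleCat.{u} k) ℤ
  one : ∀ x, (hom x x).X 0
  comp : ∀ {x y z : Obj} {p q n : ℤ}, p + q = n →
    ((hom y z).X p →ₗ[k] (hom x y).X q →ₗ[k] (hom x z).X n)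
  one_comp : ∀ {x y : Obj} {p n : ℤ} (h : 0 + p = n) (h' : p = n) (f : (hom x y).X p),
    comp h (one y) f = h' ▸ f
  comp_one : ∀ {x y : Obj} {p n : ℤ} (h : p + 0 = n) (h' : p = n) (f : (hom x y).X p),
    comp h f (one x) = h' ▸ f
  assoc : ∀ {w x y z : Obj} {p q r pq qr n : ℤ} (h₁ : p + q = pq) (h₂ : q + r = qr)
    (h₃ : pq + r = n) (h₄ : p + qr = n)
    (c : (hom y z).X p) (b : (hom x y).X q) (a : (hom w x).X r),
    comp h₃ (comp h₁ c b) a = comp h₄ c (comp h₂ b a)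
  d_one : ∀ x, ((hom x x).d 0 (-1)).hom (one x) = 0
  leibniz : ∀ {x y z : Obj} {p q n p' q' n' : ℤ} (h : p + q = n) (h₁ : p' + q = n')
    (h₂ : p + q' = n') (_ : p' + 1 = p) (g : (hom y z).X p) (f : (hom x y).X q),
    ((hom x z).d n n').hom (comp h g f) =
      comp h₁ (((hom y z).d p p').hom g) f +
        p.negOnePow • comp h₂ g (((hom x y).d q q').hom f)

namespace DGCat

variable {k : Type u} [CommRing k]

/-- A dg-functor. -/
@[ext]
structure Functor (C D : DGCat.{u} k) where
  obj : C.Obj → D.Obj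
  hom : ∀ x y, C.hom x y ⟶ D.hom (obj x) (obj y)
  map_one : ∀ x, ((hom x x).f 0).hom (C.one x) = D.one (obj x)
  map_comp : ∀ {x y z : C.Obj} {p q n : ℤ} (h : p + q = n)
    (g : (C.hom y z).X p) (f : (C.hom x y).X q),
    ((hom x z).f n).hom (C.comp h g f) =
      D.comp h (((hom y z).f p).hom g) (((hom x y).f q).hom f)

instance : Category (DGCat.{u} k) where
  Hom := Functor
  id C :=
    { obj := fun x => x
      hom := fun _ _ => 𝟙 _
      map_one := fun _ => rfl
      map_comp := fun _ _ _ => rfl }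
  comp F G :=
    { obj := fun x => G.obj (F.obj x)
      hom := fun x y => F.hom x y ≫ G.hom _ _
      map_one := fun x => by
        simp [F.map_one, G.map_one]
      map_comp := fun h g f => by
        simp [F.map_comp, G.map_comp] }
  id_comp _ := rfl
  comp_id _ := rfl
  assoc _ _ _ := rfl

end DGCat

/-! ## Monotone maps between finite ordinals, and the join -/

/-- The join `φ ⋆ ψ` of monotone maps of finite ordinals (where `Fin r` is the poset `[r-1]`). -/
def join {p q n p' q' n' : ℕ} (h : p + q = n) (h' : p' + q' = n')
    (φ : Fin p →o Fin p') (ψ : Fin q →o Fin q') : Fin n →o Fin n' where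
  toFun i := if hi : i.1 < p then ⟨(φ ⟨i.1, hi⟩).1, by omega⟩
    else ⟨p' + (ψ ⟨i.1 - p, by omega⟩).1, by omega⟩
  monotone' i j hij := by
    have hij' : i.1 ≤ j.1 := hij
    by_cases hi : i.1 < p <;> by_cases hj : j.1 < p
    · simpa [hi, hj] using φ.monotone (show (⟨i.1, hi⟩ : Fin p) ≤ ⟨j.1, hj⟩ from hij')
    · simp only [hi, hj, dite_true, dite_false, Fin.mk_le_mk]
      omega
    · omega
    · simp only [hi, hj, dite_false, Fin.mk_le_mk]
      have := ψ.monotone (show (⟨i.1 - p, by omega⟩ : Fin q) ≤ ⟨j.1 - p, by omega⟩ by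
        simp only [Fin.mk_le_mk]; omega)
      have h2 := Fin.le_def.1 this
      omega

lemma join_left {p q n p' q' n' : ℕ} (h : p + q = n) (h' : p' + q' = n')
    (φ : Fin p →o Fin p') (ψ : Fin q →o Fin q') (i : Fin p) :
    (join h h' φ ψ ⟨i.1, by omega⟩).1 = (φ i).1 :=
  congrArg Fin.val (dif_pos i.2)

lemma join_right {p q n p' q' n' : ℕ} (h : p + q = n) (h' : p' + q' = n')
    (φ : Fin p →o Fin p') (ψ : Fin q →o Fin q') (i : Fin q) :
    (join h h' φ ψ ⟨p + i.1, by omega⟩).1 = p' + (ψ i).1 := by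
  refine (congrArg Fin.val (dif_neg (show ¬ (p + i.1 < p) by omega))).trans ?_
  simp

lemma eq_join {p q n p' q' n' : ℕ} (h : p + q = n) (h' : p' + q' = n')
    (φ : Fin p →o Fin p') (ψ : Fin q →o Fin q') (χ : Fin n →o Fin n')
    (hl : ∀ i : Fin p, (χ ⟨i.1, by omega⟩).1 = (φ i).1)
    (hr : ∀ i : Fin q, (χ ⟨p + i.1, by omega⟩).1 = p' + (ψ i).1) : χ = join h h' φ ψ := by
  ext i
  by_cases hi : i.1 < p
  · exact (hl ⟨i.1, hi⟩).trans (join_left h h' φ ψ ⟨i.1, hi⟩).symm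
  · have h1 := hr ⟨i.1 - p, by omega⟩
    have h2 := join_right h h' φ ψ ⟨i.1 - p, by omega⟩
    have h3 : (⟨p + (i.1 - p), by omega⟩ : Fin n) = i := Fin.ext (by simp only; omega)
    simp only [h3] at h1 h2
    exact h1.trans h2.symm

/-! ## Categories enriched in augmented simplicial modules -/

/-- A small category enriched in augmented simplicial `k`-modules with the join monoidal
structure.  The hom-object from `x` to `y` is the presheaf `hom x y` on the augmented simplex
category whose value on `[n-1]` (an ordinal with `n` elements) is `hom x y n`; the composition is
`hom x y p ⊗ hom y z q → hom x z (p + q)`, natural with respect to `⋆`; the identities have degree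
`[-1]`. -/
structure AugCat (k : Type u) [CommRing k] where
  Obj : Type u
  hom : Obj → Obj → ℕ → ModuleCat.{u} k
  map : ∀ {x y : Obj} {m n : ℕ}, (Fin m →o Fin n) → (hom x y n →ₗ[k] hom x y m)
  map_id : ∀ {x y : Obj} {n : ℕ} (a : hom x y n), map OrderHom.id a = a
  map_comp : ∀ {x y : Obj} {l m n : ℕ} (φ : Fin l →o Fin m) (ψ : Fin m →o Fin n)
    (a : hom x y n), map (ψ.comp φ) a = map φ (map ψ a)
  one : ∀ x, hom x x 0
  comp : ∀ {x y z : Obj} {p q n : ℕ}, p + q = n →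
    (hom x y p →ₗ[k] hom y z q →ₗ[k] hom x z n)
  map_join : ∀ {x y z : Obj} {p q n p' q' n' : ℕ} (h : p + q = n) (h' : p' + q' = n')
    (φ : Fin p →o Fin p') (ψ : Fin q →o Fin q') (a : hom x y p') (b : hom y z q'),
    map (join h h' φ ψ) (comp h' a b) = comp h (map φ a) (map ψ b)
  one_comp : ∀ {x y : Obj} {p n : ℕ} (h : 0 + p = n) (h' : p = n) (a : hom x y p),
    comp h (one x) a = h' ▸ a
  comp_one : ∀ {x y : Obj} {p n : ℕ} (h : p + 0 = n) (h' : p = n) (a : hom x y p),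
    comp h a (one y) = h' ▸ a
  assoc : ∀ {w x y z : Obj} {p q r pq qr n : ℕ} (h₁ : p + q = pq) (h₂ : q + r = qr)
    (h₃ : pq + r = n) (h₄ : p + qr = n)
    (a : hom w x p) (b : hom x y q) (c : hom y z r),
    comp h₃ (comp h₁ a b) c = comp h₄ a (comp h₂ b c)

namespace AugCat

variable {k : Type u} [CommRing k]

/-- A functor of categories enriched in augmented simplicial modules. -/
@[ext]
structure Functor (A B : AugCat.{u} k) where
  obj : A.Obj → B.Obj
  hom : ∀ x y n, A.hom x y n →ₗ[k] B.hom (obj x) (obj y) n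
  naturality : ∀ {x y : A.Obj} {m n : ℕ} (φ : Fin m →o Fin n) (a : A.hom x y n),
    hom x y m (A.map φ a) = B.map φ (hom x y n a)
  map_one : ∀ x, hom x x 0 (A.one x) = B.one (obj x)
  map_comp : ∀ {x y z : A.Obj} {p q n : ℕ} (h : p + q = n)
    (a : A.hom x y p) (b : A.hom y z q),
    hom x z n (A.comp h a b) = B.comp h (hom x y p a) (hom y z q b)

instance : Category (AugCat.{u} k) where
  Hom := Functor
  id A :=
    { obj := fun x => x
      hom := fun _ _ _ => LinearMap.id
      naturality := fun _ _ => rfl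
      map_one := fun _ => rfl
      map_comp := fun _ _ _ => rfl }
  comp F G :=
    { obj := fun x => G.obj (F.obj x)
      hom := fun x y n => G.hom _ _ n ∘ₗ F.hom x y n
      naturality := fun φ a => by simp [F.naturality, G.naturality]
      map_one := fun x => by simp [F.map_one, G.map_one]
      map_comp := fun h a b => by simp [F.map_comp, G.map_comp] }
  id_comp _ := rfl
  comp_id _ := rfl
  assoc _ _ _ := rfl

/-- The identity of `x`, in a degree that is propositionally zero. -/
def one' (A : AugCat.{u} k) (x : A.Obj) {n : ℕ} (h : n = 0) : A.hom x x n := h.symm ▸ A.one x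

lemma map_one' (A : AugCat.{u} k) (x : A.Obj) {m n : ℕ} (hm : m = 0) (hn : n = 0)
    (φ : Fin m →o Fin n) : A.map φ (A.one' x hn) = A.one' x hm := by
  subst hm hn
  have : φ = OrderHom.id := by ext i; exact i.elim0
  rw [this, A.map_id]

end AugCat

/-! ## The functor from dg-categories to categories enriched in augmented simplicial modules -/

section Gamma

variable {k : Type u} [CommRing k]

/-- The `i`-th coface of finite ordinals. -/
abbrev coface {n : ℕ} (i : Fin (n + 1)) : Fin n →o Fin (n + 1) := (Fin.succAboveOrderEmb i).toOrderHom

/-- The module of `(r-1)`-simplices of the augmented simplicial module associated to a chain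
complex `K`.  A monotone injection `τ : Fin p →o Fin r` is the same as a subset of `[r-1]` with `p`
elements, so that an element is a family `(a_I)` indexed by the subsets `I` of `[r-1]`, with
`a_I ∈ K_{|I|}` and `∂ a_I = ∑ j, (-1)^j a_{I ∖ {i_j}}`.  Families are extended by zero to the
non-injective monotone maps. -/
def gammaObj (K : ChainComplex (ModuleCat.{u} k) ℤ) (r : ℕ) :
    Submodule k (∀ p : ℕ, (Fin p →o Fin r) → K.X (p : ℤ)) where
  carrier := { a |
    (∀ p (τ : Fin p →o Fin r), ¬ Function.Injective τ → a p τ = 0) ∧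
    (∀ τ : Fin 0 →o Fin r, (K.d ((0 : ℕ) : ℤ) (-1)).hom (a 0 τ) = 0) ∧
    (∀ p (τ : Fin (p + 1) →o Fin r), Function.Injective τ →
      (K.d ((p + 1 : ℕ) : ℤ) (p : ℤ)).hom (a (p + 1) τ) =
        ∑ j : Fin (p + 1), (-1 : ℤ) ^ (j : ℕ) • a p (τ.comp (coface j))) }
  zero_mem' := by
    refine ⟨fun _ _ _ => rfl, fun _ => ?_, fun p τ _ => ?_⟩
    · simp
    · simp
  add_mem' := by
    rintro a b ⟨ha1, ha2, ha3⟩ ⟨hb1, hb2, hb3⟩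
    refine ⟨fun p τ h => ?_, fun τ => ?_, fun p τ h => ?_⟩
    · rw [Pi.add_apply, Pi.add_apply, ha1 p τ h, hb1 p τ h, add_zero]
    · rw [Pi.add_apply, Pi.add_apply, map_add, ha2, hb2, add_zero]
    · simp only [Pi.add_apply, map_add, ha3 p τ h, hb3 p τ h, smul_add, Finset.sum_add_distrib]
  smul_mem' := by
    rintro c a ⟨ha1, ha2, ha3⟩
    refine ⟨fun p τ h => ?_, fun τ => ?_, fun p τ h => ?_⟩
    · rw [Pi.smul_apply, Pi.smul_apply, ha1 p τ h, smul_zero]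
    · rw [Pi.smul_apply, Pi.smul_apply, map_smul, ha2, smul_zero]
    · simp only [Pi.smul_apply, map_smul, ha3 p τ h, Finset.smul_sum]
      exact Finset.sum_congr rfl fun j _ => smul_comm _ _ _

lemma exists_eq_of_not_injective {p r : ℕ} (τ : Fin (p + 1) →o Fin r)
    (h : ¬ Function.Injective τ) : ∃ i : Fin p, τ i.castSucc = τ i.succ := by
  by_contra hc
  push Not at hc
  exact h (Fin.strictMono_iff_lt_succ.2 fun i =>
    lt_of_le_of_ne (τ.monotone i.castSucc_le_succ) (hc i)).injective

/-- For a family vanishing on the non-injective monotone maps, the alternating sum of the faces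
of a non-injective monotone map vanishes. -/
lemma alternating_sum_eq_zero {M : Type*} [AddCommGroup M] {p r : ℕ} (a : (Fin p →o Fin r) → M)
    (ha : ∀ τ : Fin p →o Fin r, ¬ Function.Injective τ → a τ = 0)
    (τ : Fin (p + 1) →o Fin r) (h : ¬ Function.Injective τ) :
    ∑ j : Fin (p + 1), (-1 : ℤ) ^ (j : ℕ) • a (τ.comp (coface j)) = 0 := by
  obtain ⟨i, hi⟩ := exists_eq_of_not_injective τ h
  have hne : i.castSucc ≠ i.succ := (Fin.castSucc_lt_succ).ne
  rw [← Finset.sum_subset (Finset.subset_univ {i.castSucc, i.succ}), Finset.sum_pair hne]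
  · have : τ.comp (coface i.castSucc) = τ.comp (coface i.succ) := by
      ext l
      simp only [OrderHom.comp_coe, Function.comp_apply]
      congr 1
      rcases lt_trichotomy l i with hl | hl | hl
      · congr 1
        exact (Fin.succAbove_of_castSucc_lt i.castSucc l (by simpa using hl)).trans
          (Fin.succAbove_of_castSucc_lt i.succ l
            (Fin.castSucc_lt_succ_iff.2 hl.le)).symm
      · subst hl
        simpa [coface] using hi.symm
      · congr 1
        exact (Fin.succAbove_of_le_castSucc i.castSucc l (by simpa using hl.le)).trans
          (Fin.succAbove_of_le_castSucc i.succ l (Fin.succ_le_castSucc_iff.2 hl)).symm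
    rw [this]
    simp [pow_succ]
  · intro j _ hj
    simp only [Finset.mem_insert, Finset.mem_singleton, not_or] at hj
    rw [ha, smul_zero]
    intro hinj
    obtain ⟨x, hx⟩ := Fin.exists_succAbove_eq (Ne.symm hj.1)
    obtain ⟨y, hy⟩ := Fin.exists_succAbove_eq (Ne.symm hj.2)
    have : x = y := hinj (by simp [coface, hx, hy, hi])
    exact hne (by rw [← hx, ← hy, this])

/-- The action of a monotone map, by precomposition. -/
def gammaMap (K : ChainComplex (ModuleCat.{u} k) ℤ) {m n : ℕ} (φ : Fin m →o Fin n) :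
    gammaObj K n →ₗ[k] gammaObj K m where
  toFun a := ⟨fun p τ => a.1 p (φ.comp τ), by
    obtain ⟨a, h1, h2, h3⟩ := a
    refine ⟨fun p τ h => h1 p _ fun hi => h (Function.Injective.of_comp hi),
      fun τ => h2 _, fun p τ _ => ?_⟩
    by_cases hi : Function.Injective (φ.comp τ)
    · exact h3 p _ hi
    · refine (congrArg _ (h1 _ _ hi)).trans ((map_zero _).trans ?_)
      exact (alternating_sum_eq_zero (a p) (h1 p) _ hi).symm⟩
  map_add' _ _ := rfl
  map_smul' _ _ := rfl

/-- The number of `i` with `τ i < r`. -/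
def cut {p n : ℕ} (r : ℕ) (τ : Fin p →o Fin n) : ℕ :=
  (Finset.univ.filter fun i => (τ i).1 < r).card

lemma cut_join {p q n r s m : ℕ} (h : p + q = n) (h' : r + s = m)
    (φ : Fin p →o Fin r) (ψ : Fin q →o Fin s) : cut r (join h h' φ ψ) = p := by
  have : (Finset.univ.filter fun i => (join h h' φ ψ i).1 < r) =
      (Finset.univ : Finset (Fin p)).map (Fin.castLEEmb (by omega : p ≤ n)) := by
    ext i
    simp only [Finset.mem_filter, Finset.mem_univ, true_and, Finset.mem_map]
    constructor
    · intro hi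
      by_cases hp : i.1 < p
      · exact ⟨⟨i.1, hp⟩, rfl⟩
      · have := join_right h h' φ ψ ⟨i.1 - p, by omega⟩
        have h3 : (⟨p + (i.1 - p), by omega⟩ : Fin n) = i := Fin.ext (by simp only; omega)
        simp only [h3] at this
        omega
    · rintro ⟨l, rfl⟩
      have := join_left h h' φ ψ l
      have h2 := (φ l).2
      change (join h h' φ ψ ⟨l.1, _⟩).1 < r
      omega
  rw [cut, this]
  simp

lemma lt_cut_iff {p n : ℕ} (r : ℕ) (τ : Fin p →o Fin n) (i : Fin p) :
    i.1 < cut r τ ↔ (τ i).1 < r := by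
  have key : ∀ c : ℕ, c ≤ p → (∀ i : Fin p, i.1 < c ↔ (τ i).1 < r) → cut r τ = c := by
    intro c hc hi
    have : (Finset.univ.filter fun i => (τ i).1 < r) =
        (Finset.univ : Finset (Fin c)).map (Fin.castLEEmb hc) := by
      ext i
      simp only [Finset.mem_filter, Finset.mem_univ, true_and, Finset.mem_map, ← hi]
      exact ⟨fun h => ⟨⟨i.1, h⟩, rfl⟩, fun ⟨l, hl⟩ => hl ▸ l.2⟩
    rw [cut, this]
    simp
  by_cases hall : ∀ i : Fin p, (τ i).1 < r
  · rw [key p le_rfl fun i => ⟨fun _ => hall i, fun _ => i.2⟩]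
    exact ⟨fun _ => hall i, fun _ => i.2⟩
  · push Not at hall
    have hex : ∃ c : ℕ, ∃ hc : c < p, r ≤ (τ ⟨c, hc⟩).1 := by
      obtain ⟨i, hi⟩ := hall
      exact ⟨i.1, i.2, hi⟩
    classical
    obtain ⟨hc, hr⟩ := Nat.find_spec hex
    have hall' : ∀ i : Fin p, i.1 < Nat.find hex ↔ (τ i).1 < r := by
      intro i
      constructor
      · intro hi
        by_contra hn
        exact Nat.find_min hex hi ⟨i.2, not_lt.1 hn⟩
      · intro hi
        by_contra hn
        have := τ.monotone (show (⟨Nat.find hex, hc⟩ : Fin p) ≤ i from by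
          simp only [Fin.le_def]; omega)
        have := Fin.le_def.1 this
        omega
    rw [key _ hc.le hall', hall']

lemma cut_le {p n : ℕ} (r : ℕ) (τ : Fin p →o Fin n) : cut r τ ≤ p := by
  simpa [cut] using Finset.card_le_univ (Finset.univ.filter fun i => (τ i).1 < r)

/-- The part of `τ` with values `< r`. -/
def lowPart {p n : ℕ} (r : ℕ) (τ : Fin p →o Fin n) : Fin (cut r τ) →o Fin r where
  toFun i := ⟨(τ ⟨i.1, i.2.trans_le (cut_le r τ)⟩).1,
    (lt_cut_iff r τ ⟨i.1, i.2.trans_le (cut_le r τ)⟩).1 i.2⟩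
  monotone' _ _ h := τ.monotone h

/-- The part of `τ` with values `≥ r`, shifted by `r`. -/
def highPart {p n : ℕ} (r s : ℕ) (h : r + s = n) (τ : Fin p →o Fin n) :
    Fin (p - cut r τ) →o Fin s where
  toFun i := ⟨(τ ⟨cut r τ + i.1, by omega⟩).1 - r, by
    have := (lt_cut_iff r τ ⟨cut r τ + i.1, by omega⟩)
    have h2 := (τ ⟨cut r τ + i.1, by omega⟩).2
    simp only at this
    omega⟩
  monotone' i j hij := by
    have hij' : i.1 ≤ j.1 := hij
    have hle : (⟨cut r τ + i.1, by omega⟩ : Fin p) ≤ ⟨cut r τ + j.1, by omega⟩ :=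
      Fin.mk_le_mk.2 (by omega)
    exact Fin.mk_le_mk.2 (Nat.sub_le_sub_right (Fin.le_def.1 (τ.monotone hle)) r)

lemma join_parts {p n : ℕ} (r s : ℕ) (h : r + s = n) (τ : Fin p →o Fin n)
    (h' : cut r τ + (p - cut r τ) = p) :
    join h' h (lowPart r τ) (highPart r s h τ) = τ := by
  symm
  apply eq_join
  · intro i; rfl
  · intro i
    have := (lt_cut_iff r τ ⟨cut r τ + i.1, by omega⟩)
    simp only at this
    change _ = r + ((τ _).1 - r)
    omega

/-- Every monotone map into `Fin (r + s)` is a join. -/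
lemma exists_join {p n : ℕ} (r s : ℕ) (h : r + s = n) (τ : Fin p →o Fin n) :
    ∃ (p₁ p₂ : ℕ) (h' : p₁ + p₂ = p) (τ₁ : Fin p₁ →o Fin r) (τ₂ : Fin p₂ →o Fin s),
      τ = join h' h τ₁ τ₂ :=
  ⟨cut r τ, p - cut r τ, Nat.add_sub_cancel' (cut_le r τ), lowPart r τ, highPart r s h τ,
    (join_parts r s h τ _).symm⟩

lemma join_injective {p₁ p₂ p₁' p₂' n r s m : ℕ} (h : p₁ + p₂ = n) (h' : p₁' + p₂' = n)
    (hm : r + s = m) (τ₁ : Fin p₁ →o Fin r) (τ₂ : Fin p₂ →o Fin s)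
    (τ₁' : Fin p₁' →o Fin r) (τ₂' : Fin p₂' →o Fin s)
    (e : join h hm τ₁ τ₂ = join h' hm τ₁' τ₂') :
    p₁ = p₁' ∧ p₂ = p₂' ∧ HEq τ₁ τ₁' ∧ HEq τ₂ τ₂' := by
  obtain rfl : p₁ = p₁' := by
    rw [← cut_join h hm τ₁ τ₂, e, cut_join]
  obtain rfl : p₂ = p₂' := by omega
  refine ⟨rfl, rfl, heq_of_eq ?_, heq_of_eq ?_⟩
  · ext i
    rw [← join_left h hm τ₁ τ₂, e, join_left]
  · ext i
    have h1 := join_right h hm τ₁ τ₂ i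
    rw [e, join_right] at h1
    omega

lemma join_injective_iff {p q n r s m : ℕ} (h : p + q = n) (hm : r + s = m)
    (τ₁ : Fin p →o Fin r) (τ₂ : Fin q →o Fin s) (h₁ : Function.Injective τ₁)
    (h₂ : Function.Injective τ₂) : Function.Injective (join h hm τ₁ τ₂) := by
  have key : ∀ i : Fin n, (∃ a : Fin p, i = ⟨a.1, by omega⟩) ∨
      ∃ a : Fin q, i = ⟨p + a.1, by omega⟩ := by
    intro i
    by_cases hi : i.1 < p
    · exact Or.inl ⟨⟨i.1, hi⟩, rfl⟩
    · exact Or.inr ⟨⟨i.1 - p, by omega⟩, Fin.ext (by simp only; omega)⟩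
  intro i j hij
  replace hij := congrArg Fin.val hij
  rcases key i with ⟨a, rfl⟩ | ⟨a, rfl⟩ <;> rcases key j with ⟨b, rfl⟩ | ⟨b, rfl⟩
  · rw [join_left, join_left] at hij
    rw [h₁ (Fin.ext hij)]
  · rw [join_left, join_right] at hij
    omega
  · rw [join_left, join_right] at hij
    omega
  · rw [join_right, join_right] at hij
    rw [h₂ (Fin.ext (by omega : (τ₂ a).1 = (τ₂ b).1))]

lemma coface_val {n : ℕ} (i : Fin (n + 1)) (l : Fin n) :
    (coface i l).1 = if l.1 < i.1 then l.1 else l.1 + 1 := by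
  split_ifs with hl
  · exact congrArg Fin.val (Fin.succAbove_of_castSucc_lt _ _ (Fin.lt_def.2 hl))
  · exact congrArg Fin.val (Fin.succAbove_of_le_castSucc _ _ (Fin.le_def.2 (not_lt.1 hl)))

lemma join_comp_coface_left {p q n r s m : ℕ} (h : p + 1 + q = n + 1) (h' : p + q = n)
    (hm : r + s = m) (τ₁ : Fin (p + 1) →o Fin r) (τ₂ : Fin q →o Fin s) (i : Fin (p + 1)) :
    (join h hm τ₁ τ₂).comp (coface ⟨i.1, by omega⟩) = join h' hm (τ₁.comp (coface i)) τ₂ := by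
  apply eq_join
  · intro l
    have : (coface (n := n) ⟨i.1, by omega⟩) ⟨l.1, by omega⟩ =
        ⟨(coface i l).1, by omega⟩ :=
      Fin.ext ((coface_val _ _).trans (coface_val i l).symm)
    change (join h hm τ₁ τ₂ (coface _ _)).1 = _
    rw [this, join_left]
    rfl
  · intro l
    have : (coface (n := n) ⟨i.1, by omega⟩) ⟨p + l.1, by omega⟩ = ⟨p + 1 + l.1, by omega⟩ := by
      apply Fin.ext
      rw [coface_val, if_neg (by simp only; omega)]
      simp only
      omega
    change (join h hm τ₁ τ₂ (coface _ _)).1 = _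
    rw [this, join_right]

lemma join_comp_coface_right {p q n r s m : ℕ} (h : p + (q + 1) = n + 1) (h' : p + q = n)
    (hm : r + s = m) (τ₁ : Fin p →o Fin r) (τ₂ : Fin (q + 1) →o Fin s) (i : Fin (q + 1)) :
    (join h hm τ₁ τ₂).comp (coface ⟨p + i.1, by omega⟩) =
      join h' hm τ₁ (τ₂.comp (coface i)) := by
  apply eq_join
  · intro l
    have : (coface (n := n) ⟨p + i.1, by omega⟩) ⟨l.1, by omega⟩ = ⟨l.1, by omega⟩ := by
      apply Fin.ext
      rw [coface_val, if_pos (by simp only; omega)]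
    change (join h hm τ₁ τ₂ (coface _ _)).1 = _
    rw [this, join_left]
  · intro l
    have : (coface (n := n) ⟨p + i.1, by omega⟩) ⟨p + l.1, by omega⟩ =
        ⟨p + (coface i l).1, by omega⟩ := by
      apply Fin.ext
      have := coface_val i l
      rw [coface_val]
      simp only
      split_ifs at this ⊢ <;> omega
    change (join h hm τ₁ τ₂ (coface _ _)).1 = _
    rw [this, join_right]
    rfl

lemma sum_split {M : Type*} [AddCommMonoid M] {p q n : ℕ} (h : p + q = n) (f : Fin n → M) :
    ∑ j, f j = ∑ i : Fin p, f ⟨i.1, by omega⟩ + ∑ i : Fin q, f ⟨p + i.1, by omega⟩ := by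
  subst h
  exact Fin.sum_univ_add f

lemma neg_one_smul_congr {M : Type*} [AddCommGroup M] {a b : ℕ} (h : a % 2 = b % 2) (x : M) :
    (-1 : ℤ) ^ a • x = (-1 : ℤ) ^ b • x := by
  rw [neg_one_pow_eq_pow_mod_two a, h, ← neg_one_pow_eq_pow_mod_two b]

lemma gamma_d {K : ChainComplex (ModuleCat.{u} k) ℤ} {r : ℕ} (a : gammaObj K r) {p : ℕ}
    (τ : Fin (p + 1) →o Fin r) :
    (K.d ((p + 1 : ℕ) : ℤ) (p : ℤ)).hom (a.1 (p + 1) τ) =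
      ∑ j : Fin (p + 1), (-1 : ℤ) ^ (j : ℕ) • a.1 p (τ.comp (coface j)) := by
  by_cases hi : Function.Injective τ
  · exact a.2.2.2 p τ hi
  · rw [a.2.1 _ τ hi, map_zero]
    exact (alternating_sum_eq_zero (a.1 p) (a.2.1 p) τ hi).symm

variable (C : DGCat.{u} k)

/-- The value `m (a_{J₁} ⊗ b_{J₂})`, where `m (f ⊗ g) = (-1)^{|f||g|} g ∘ f` is the composition
`C(x,y) ⊗ C(y,z) → C(x,z)` and where `J` is split into its part `J₁` in `[r-1]` and its
part `J₂` in `[s-1]`. -/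
def gammaCompFun {x y z : C.Obj} {r s n : ℕ} (h : r + s = n)
    (a : ∀ p : ℕ, (Fin p →o Fin r) → (C.hom x y).X (p : ℤ))
    (b : ∀ p : ℕ, (Fin p →o Fin s) → (C.hom y z).X (p : ℤ))
    (p : ℕ) (τ : Fin p →o Fin n) : (C.hom x z).X (p : ℤ) :=
  (-1 : ℤ) ^ (cut r τ * (p - cut r τ)) •
    C.comp (p := ((p - cut r τ : ℕ) : ℤ)) (q := ((cut r τ : ℕ) : ℤ))
      (by have := cut_le r τ; omega)
      (b (p - cut r τ) (highPart r s h τ)) (a (cut r τ) (lowPart r τ))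

lemma gammaCompFun_join {x y z : C.Obj} {r s n : ℕ} (h : r + s = n)
    (a : ∀ p : ℕ, (Fin p →o Fin r) → (C.hom x y).X (p : ℤ))
    (b : ∀ p : ℕ, (Fin p →o Fin s) → (C.hom y z).X (p : ℤ))
    {p₁ p₂ p : ℕ} (hp : p₁ + p₂ = p) (τ₁ : Fin p₁ →o Fin r) (τ₂ : Fin p₂ →o Fin s)
    (hp' : (p₂ : ℤ) + (p₁ : ℤ) = p) :
    gammaCompFun C h a b p (join hp h τ₁ τ₂) =
      (-1 : ℤ) ^ (p₁ * p₂) • C.comp hp' (b p₂ τ₂) (a p₁ τ₁) := by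
  have key : ∀ {q₁ q₂ : ℕ} (hq : q₁ + q₂ = p) (σ₁ : Fin q₁ →o Fin r) (σ₂ : Fin q₂ →o Fin s)
      (hq' : (q₂ : ℤ) + (q₁ : ℤ) = p), join hq h σ₁ σ₂ = join hp h τ₁ τ₂ →
      (-1 : ℤ) ^ (q₁ * q₂) • C.comp hq' (b q₂ σ₂) (a q₁ σ₁) =
        (-1 : ℤ) ^ (p₁ * p₂) • C.comp hp' (b p₂ τ₂) (a p₁ τ₁) := by
    intro q₁ q₂ hq σ₁ σ₂ hq' e
    obtain ⟨rfl, rfl, e1, e2⟩ := join_injective _ _ _ _ _ _ _ e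
    rw [eq_of_heq e1, eq_of_heq e2]
  exact key _ _ _ _ (join_parts r s h _ (Nat.add_sub_cancel' (cut_le r _)))

lemma negOnePow_natCast_smul {M : Type*} [AddCommGroup M] (p : ℕ) (x : M) :
    (p : ℤ).negOnePow • x = (-1 : ℤ) ^ p • x := by
  rw [Units.smul_def]
  congr 1

lemma sum_left {x y z : C.Obj} {r s n : ℕ} (h : r + s = n)
    (a : gammaObj (C.hom x y) r) (b : gammaObj (C.hom y z) s)
    {p q m : ℕ} (hm : p + q = m + 1) (τ₁ : Fin p →o Fin r) (τ₂ : Fin q →o Fin s)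
    (p' : ℤ) (hp' : p' + 1 = p) (hc : (q : ℤ) + p' = m) :
    ∑ i : Fin p, (-1 : ℤ) ^ i.1 • gammaCompFun C h a.1 b.1 m
        ((join hm h τ₁ τ₂).comp (coface ⟨i.1, by omega⟩)) =
      (-1 : ℤ) ^ (p * q + q) •
        C.comp hc (b.1 q τ₂) (((C.hom x y).d (p : ℤ) p').hom (a.1 p τ₁)) := by
  cases p with
  | zero =>
    obtain rfl : p' = -1 := by simp at hp'; omega
    rw [a.2.2.1 τ₁]
    simp
  | succ p =>
    obtain rfl : p' = (p : ℤ) := by push_cast at hp'; omega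
    rw [gamma_d a τ₁, map_sum, Finset.smul_sum]
    refine Finset.sum_congr rfl fun i _ => ?_
    rw [join_comp_coface_left hm (by omega), gammaCompFun_join C h a.1 b.1 _ _ _ hc,
      map_zsmul, smul_smul, smul_smul, ← pow_add, ← pow_add]
    apply neg_one_smul_congr
    have : (p + 1) * q + q + i.1 = i.1 + p * q + 2 * q := by ring
    omega

lemma sum_right {x y z : C.Obj} {r s n : ℕ} (h : r + s = n)
    (a : gammaObj (C.hom x y) r) (b : gammaObj (C.hom y z) s)
    {p q m : ℕ} (hm : p + q = m + 1) (τ₁ : Fin p →o Fin r) (τ₂ : Fin q →o Fin s)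
    (q' : ℤ) (hq' : q' + 1 = q) (hc : q' + (p : ℤ) = m) :
    ∑ i : Fin q, (-1 : ℤ) ^ (p + i.1) • gammaCompFun C h a.1 b.1 m
        ((join hm h τ₁ τ₂).comp (coface ⟨p + i.1, by omega⟩)) =
      (-1 : ℤ) ^ (p * q) •
        C.comp hc (((C.hom y z).d (q : ℤ) q').hom (b.1 q τ₂)) (a.1 p τ₁) := by
  cases q with
  | zero =>
    obtain rfl : q' = -1 := by simp at hq'; omega
    rw [b.2.2.1 τ₂]
    simp
  | succ q =>
    obtain rfl : q' = (q : ℤ) := by push_cast at hq'; omega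
    rw [gamma_d b τ₂, map_sum, LinearMap.sum_apply, Finset.smul_sum]
    refine Finset.sum_congr rfl fun i _ => ?_
    rw [join_comp_coface_right hm (by omega), gammaCompFun_join C h a.1 b.1 _ _ _ hc,
      map_zsmul, LinearMap.smul_apply, smul_smul, smul_smul, ← pow_add, ← pow_add]
    apply neg_one_smul_congr
    have : p * (q + 1) + i.1 = p + i.1 + p * q := by ring
    omega

lemma gammaCompFun_mem {x y z : C.Obj} {r s n : ℕ} (h : r + s = n)
    (a : gammaObj (C.hom x y) r) (b : gammaObj (C.hom y z) s) :
    gammaCompFun C h a.1 b.1 ∈ gammaObj (C.hom x z) n := by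
  refine ⟨fun p τ hτ => ?_, fun τ => ?_, fun m τ _ => ?_⟩
  · obtain ⟨p₁, p₂, hp, τ₁, τ₂, rfl⟩ := exists_join r s h τ
    rw [gammaCompFun_join C h _ _ _ _ _ (by omega)]
    by_cases h₁ : Function.Injective τ₁
    · by_cases h₂ : Function.Injective τ₂
      · exact absurd (join_injective_iff _ _ _ _ h₁ h₂) hτ
      · rw [b.2.1 _ _ h₂, map_zero, LinearMap.zero_apply, smul_zero]
    · rw [a.2.1 _ _ h₁, map_zero, smul_zero]
  · obtain ⟨p₁, p₂, hp, τ₁, τ₂, rfl⟩ := exists_join r s h τ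
    obtain rfl : p₁ = 0 := by omega
    obtain rfl : p₂ = 0 := by omega
    rw [gammaCompFun_join C h _ _ _ _ _ (by simp), map_zsmul,
      C.leibniz (p' := -1) (q' := -1) _ (by simp) (by simp) (by simp), a.2.2.1, b.2.2.1]
    simp
  · obtain ⟨p₁, p₂, hp, τ₁, τ₂, rfl⟩ := exists_join r s h τ
    rw [gammaCompFun_join C h _ _ _ _ _ (by omega), map_zsmul,
      C.leibniz (p' := p₂ - 1) (q' := p₁ - 1) (n' := m) _ (by omega) (by omega) (by omega),
      sum_split hp, sum_left C h a b hp τ₁ τ₂ (p₁ - 1) (by omega) (by omega),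
      sum_right C h a b hp τ₁ τ₂ (p₂ - 1) (by omega) (by omega), smul_add, add_comm,
      negOnePow_natCast_smul, smul_smul, ← pow_add]

/-- The composition of the enriched category associated to a dg-category. -/
def gammaComp {x y z : C.Obj} {r s n : ℕ} (h : r + s = n) :
    gammaObj (C.hom x y) r →ₗ[k] gammaObj (C.hom y z) s →ₗ[k] gammaObj (C.hom x z) n :=
  LinearMap.mk₂ k (fun a b => ⟨gammaCompFun C h a.1 b.1, gammaCompFun_mem C h a b⟩)
    (fun a a' b => Subtype.ext <| funext fun p => funext fun τ => by
      simp [gammaCompFun])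
    (fun c a b => Subtype.ext <| funext fun p => funext fun τ => by
      simp [gammaCompFun, smul_comm c])
    (fun a b b' => Subtype.ext <| funext fun p => funext fun τ => by
      simp [gammaCompFun])
    (fun c a b => Subtype.ext <| funext fun p => funext fun τ => by
      simp [gammaCompFun, smul_comm c])

lemma gammaComp_join {x y z : C.Obj} {r s n : ℕ} (h : r + s = n)
    (a : gammaObj (C.hom x y) r) (b : gammaObj (C.hom y z) s)
    {p₁ p₂ p : ℕ} (hp : p₁ + p₂ = p) (τ₁ : Fin p₁ →o Fin r) (τ₂ : Fin p₂ →o Fin s)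
    (hp' : (p₂ : ℤ) + (p₁ : ℤ) = p) :
    (gammaComp C h a b).1 p (join hp h τ₁ τ₂) =
      (-1 : ℤ) ^ (p₁ * p₂) • C.comp hp' (b.1 p₂ τ₂) (a.1 p₁ τ₁) :=
  gammaCompFun_join C h _ _ _ _ _ _

lemma gamma_ext {K : ChainComplex (ModuleCat.{u} k) ℤ} {r : ℕ} {a b : gammaObj K r}
    (h : ∀ p τ, a.1 p τ = b.1 p τ) : a = b :=
  Subtype.ext (funext fun p => funext fun τ => h p τ)

/-- The identity of `x`, as a `(-1)`-simplex. -/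
def gammaOne (x : C.Obj) : gammaObj (C.hom x x) 0 :=
  ⟨fun p _ => if h : p = 0 then (by subst h; exact C.one x) else 0, by
    refine ⟨fun p τ h => ?_, fun τ => ?_, fun p τ _ => (τ 0).elim0⟩
    · cases p with
      | zero => exact absurd (fun i => i.elim0) h
      | succ p => exact (τ 0).elim0
    · exact C.d_one x⟩

/-- The category enriched in augmented simplicial modules associated to a dg-category `C`. -/
def gammaCat : AugCat.{u} k where
  Obj := C.Obj
  hom x y n := ModuleCat.of k (gammaObj (C.hom x y) n)
  map φ := gammaMap _ φ
  map_id _ := rfl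
  map_comp _ _ _ := rfl
  one := gammaOne C
  comp h := gammaComp C h
  map_join := by
    intro x y z p q n p' q' n' h h' φ ψ a b
    refine gamma_ext fun m τ => ?_
    obtain ⟨m₁, m₂, hm, τ₁, τ₂, rfl⟩ := exists_join p q h τ
    have e : (join h h' φ ψ).comp (join hm h τ₁ τ₂) = join hm h' (φ.comp τ₁) (ψ.comp τ₂) := by
      apply eq_join
      · intro i
        have : join hm h τ₁ τ₂ ⟨i.1, by omega⟩ = ⟨(τ₁ i).1, by omega⟩ :=
          Fin.ext (join_left _ _ _ _ _)
        change (join h h' φ ψ (join hm h τ₁ τ₂ _)).1 = _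
        rw [this, join_left]
        rfl
      · intro i
        have : join hm h τ₁ τ₂ ⟨m₁ + i.1, by omega⟩ = ⟨p + (τ₂ i).1, by omega⟩ :=
          Fin.ext (join_right _ _ _ _ _)
        change (join h h' φ ψ (join hm h τ₁ τ₂ _)).1 = _
        rw [this, join_right]
        rfl
    change (gammaComp C h' a b).1 m ((join h h' φ ψ).comp (join hm h τ₁ τ₂)) = _
    rw [e, gammaComp_join C h' a b hm _ _ (by omega)]
    exact (gammaComp_join C h (gammaMap _ φ a) (gammaMap _ ψ b) hm _ _ (by omega)).symm
  one_comp := by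
    intro x y p n h h' a
    subst h'
    refine gamma_ext fun m τ => ?_
    have e : τ = join (zero_add m) h (OrderHom.id : Fin 0 →o Fin 0) τ := by
      apply eq_join
      · exact fun i => i.elim0
      · intro i
        have e1 : (⟨0 + i.1, by omega⟩ : Fin m) = i := Fin.ext (zero_add _)
        rw [e1, zero_add]
    change (gammaComp C h (gammaOne C x) a).1 m τ = a.1 m τ
    conv_lhs => rw [e]
    rw [gammaComp_join C h _ _ _ _ _ (by simp)]
    simp only [zero_mul, pow_zero, one_smul]
    exact C.comp_one _ rfl _
  comp_one := by
    intro x y p n h h' a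
    subst h'
    refine gamma_ext fun m τ => ?_
    have e : τ = join (add_zero m) h τ (OrderHom.id : Fin 0 →o Fin 0) := by
      apply eq_join
      · intro i; rfl
      · exact fun i => i.elim0
    change (gammaComp C h a (gammaOne C y)).1 m τ = a.1 m τ
    conv_lhs => rw [e]
    rw [gammaComp_join C h _ _ _ _ _ (by simp)]
    simp only [mul_zero, pow_zero, one_smul]
    exact C.one_comp _ rfl _
  assoc := by
    intro w x y z p q r pq qr n h₁ h₂ h₃ h₄ a b c
    refine gamma_ext fun m τ => ?_
    obtain ⟨m₁₂, m₃, hm, τ₁₂, τ₃, rfl⟩ := exists_join pq r h₃ τ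
    obtain ⟨m₁, m₂, hm₁, τ₁, τ₂, rfl⟩ := exists_join p q h₁ τ₁₂
    have e : join hm h₃ (join hm₁ h₁ τ₁ τ₂) τ₃ =
        join (by omega) h₄ τ₁ (join (rfl : m₂ + m₃ = m₂ + m₃) h₂ τ₂ τ₃) := by
      apply eq_join
      · intro i
        rw [show (⟨i.1, by omega⟩ : Fin m) = ⟨(⟨i.1, by omega⟩ : Fin m₁₂).1, by omega⟩ from rfl,
          join_left, join_left]
      · intro i
        by_cases hi : i.1 < m₂
        · rw [show (⟨m₁ + i.1, by omega⟩ : Fin m) =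
              ⟨(⟨m₁ + (⟨i.1, hi⟩ : Fin m₂).1, by simp only; omega⟩ : Fin m₁₂).1,
                by simp only; omega⟩ from rfl,
            join_left, join_right]
          exact congrArg (p + ·) (join_left rfl h₂ τ₂ τ₃ ⟨i.1, hi⟩).symm
        · have e1 : (⟨m₁ + i.1, by omega⟩ : Fin m) =
              ⟨m₁₂ + (⟨i.1 - m₂, by omega⟩ : Fin m₃).1, by simp only; omega⟩ :=
            Fin.ext (by simp only; omega)
          have e2 : i = ⟨m₂ + (⟨i.1 - m₂, by omega⟩ : Fin m₃).1, by simp only; omega⟩ :=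
            Fin.ext (by simp only; omega)
          rw [e1, join_right]
          conv_rhs => rw [e2, join_right]
          omega
    change (gammaComp C h₃ (gammaComp C h₁ a b) c).1 m _ =
      (gammaComp C h₄ a (gammaComp C h₂ b c)).1 m _
    rw [gammaComp_join C h₃ _ _ hm _ _ (by omega), gammaComp_join C h₁ _ _ hm₁ _ _ (by omega),
      e, gammaComp_join C h₄ _ _ _ _ _ (by push_cast; omega),
      gammaComp_join C h₂ _ _ _ _ _ (by push_cast; omega), map_zsmul, map_zsmul,
      LinearMap.smul_apply, smul_smul, smul_smul, ← pow_add, ← pow_add,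
      C.assoc (pq := ((m₂ + m₃ : ℕ) : ℤ)) (qr := (m₁₂ : ℤ)) (by push_cast; omega) (by omega)
        (by push_cast; omega) (by omega)]
    apply neg_one_smul_congr
    subst hm₁
    congr 1
    ring

/-- The action on homs of the functor of enriched categories associated to a dg-functor. -/
def gammaHom {K L : ChainComplex (ModuleCat.{u} k) ℤ} (f : K ⟶ L) (n : ℕ) :
    gammaObj K n →ₗ[k] gammaObj L n where
  toFun a := ⟨fun p τ => (f.f (p : ℤ)).hom (a.1 p τ), by
    have comm : ∀ (i j : ℤ) (x : K.X i),
        (L.d i j).hom ((f.f i).hom x) = (f.f j).hom ((K.d i j).hom x) := by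
      intro i j x
      have := congrArg ModuleCat.Hom.hom (f.comm i j)
      exact LinearMap.congr_fun this x
    refine ⟨fun p τ h => ?_, fun τ => ?_, fun p τ _ => ?_⟩ <;> dsimp only
    · rw [a.2.1 p τ h, map_zero]
    · rw [comm, a.2.2.1, map_zero]
    · rw [comm, gamma_d, map_sum]
      exact Finset.sum_congr rfl fun j _ => map_zsmul _ _ _⟩
  map_add' a b := gamma_ext fun p τ => map_add _ _ _
  map_smul' c a := gamma_ext fun p τ => map_smul _ _ _

/-- The functor from small dg-categories to small categories enriched in augmented simplicial
modules, applying the Dold-Kan type functor `gammaObj` to all hom-complexes. -/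
def gammaFunctor (k : Type u) [CommRing k] : DGCat.{u} k ⥤ AugCat.{u} k where
  obj C := gammaCat C
  map {C D} F :=
    { obj := F.obj
      hom := fun x y n => gammaHom (F.hom x y) n
      naturality := fun _ _ => rfl
      map_one := fun x => gamma_ext fun p τ => by
        cases p with
        | zero => exact F.map_one x
        | succ p => exact (τ 0).elim0
      map_comp := fun {x y z r s n} h a b => gamma_ext fun p τ => by
        change ((F.hom x z).f (p : ℤ)).hom (gammaCompFun C h a.1 b.1 p τ) = _
        unfold gammaCompFun
        refine (map_zsmul _ _ _).trans (congrArg _ ?_)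
        exact F.map_comp _ _ _ }
  map_id _ := rfl
  map_comp _ _ := rfl

end Gamma

/-! ## Quivers of modules -/

noncomputable section Quivers

variable {k : Type u} [CommRing k]

/-- A `k`-quiver on a set `S`. -/
abbrev Quiv (k : Type u) [CommRing k] (S : Type u) := S → S → ModuleCat.{u} k

/-- The tensor product of quivers, `(Q ⊗ P)(a,b) = ⨁ c, Q(a,c) ⊗ P(c,b)`. -/
def qtensor {S : Type u} (Q P : Quiv k S) : Quiv k S :=
  fun a b => ModuleCat.of k (⨁ c : S, (Q a c ⊗[k] P c b))

/-- The unit quiver: `k` if `a = b` and `0` otherwise. -/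
abbrev qunit (k : Type u) [CommRing k] (S : Type u) : Quiv k S :=
  fun a b => ModuleCat.of k (PLift (a = b) →₀ k)

open Classical in
/-- The inclusion of a summand of the tensor product of quivers. -/
def qincl {S : Type u} (Q P : Quiv k S) (a b c : S) : Q a c ⊗[k] P c b →ₗ[k] qtensor Q P a b :=
  DirectSum.lof k S (fun c => Q a c ⊗[k] P c b) c

open Classical in
/-- Linear maps out of a tensor product of quivers. -/
def qlift {S : Type u} {Q P : Quiv k S} {a b : S} {M : Type u} [AddCommGroup M] [Module k M]
    (f : ∀ c, Q a c ⊗[k] P c b →ₗ[k] M) : qtensor Q P a b →ₗ[k] M :=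
  DirectSum.toModule k S M f

lemma qlift_qincl {S : Type u} {Q P : Quiv k S} {a b : S} {M : Type u} [AddCommGroup M]
    [Module k M] (f : ∀ c, Q a c ⊗[k] P c b →ₗ[k] M) (c : S) (x : Q a c ⊗[k] P c b) :
    qlift f (qincl Q P a b c x) = f c x := by
  classical
  exact DirectSum.toModule_lof (R := k) (M := fun c => Q a c ⊗[k] P c b) (φ := f) c x

lemma qhom_ext {S : Type u} {Q P : Quiv k S} {a b : S} {M : Type u} [AddCommGroup M]
    [Module k M] {f g : qtensor Q P a b →ₗ[k] M}
    (h : ∀ c (x : Q a c) (y : P c b),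
      f (qincl Q P a b c (x ⊗ₜ y)) = g (qincl Q P a b c (x ⊗ₜ y))) : f = g := by
  classical
  refine DirectSum.linearMap_ext k fun c => TensorProduct.ext' fun x y => ?_
  have := h c x y
  exact this

/-- The map on tensor products of quivers induced by maps of quivers over a map of sets
`f : S → T`.  A map of quivers `Q → f^* Q'` over `f` is the same as a map `f_! Q → Q'`. -/
def qmap {S T : Type u} (f : S → T) {Q P : Quiv k S} {Q' P' : Quiv k T}
    (α : ∀ a b, Q a b →ₗ[k] Q' (f a) (f b)) (β : ∀ a b, P a b →ₗ[k] P' (f a) (f b)) (a b : S) :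
    qtensor Q P a b →ₗ[k] qtensor Q' P' (f a) (f b) :=
  qlift fun c => qincl Q' P' (f a) (f b) (f c) ∘ₗ TensorProduct.map (α a c) (β c b)

@[simp]
lemma qmap_qincl {S T : Type u} (f : S → T) {Q P : Quiv k S} {Q' P' : Quiv k T}
    (α : ∀ a b, Q a b →ₗ[k] Q' (f a) (f b)) (β : ∀ a b, P a b →ₗ[k] P' (f a) (f b)) (a b c : S)
    (x : Q a c) (y : P c b) :
    qmap f α β a b (qincl Q P a b c (x ⊗ₜ y)) =
      qincl Q' P' (f a) (f b) (f c) (α a c x ⊗ₜ β c b y) := by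
  rw [qmap, qlift_qincl]
  simp

/-- The associativity isomorphism `(Q ⊗ P) ⊗ R → Q ⊗ (P ⊗ R)`. -/
def qassoc {S : Type u} (Q P R : Quiv k S) (a b : S) :
    qtensor (qtensor Q P) R a b →ₗ[k] qtensor Q (qtensor P R) a b :=
  qlift fun d => TensorProduct.lift (qlift (Q := Q) (P := P) fun c =>
    TensorProduct.curry (qincl Q (qtensor P R) a b c ∘ₗ
      TensorProduct.map LinearMap.id (qincl P R c b d) ∘ₗ
        (TensorProduct.assoc k (Q a c) (P c d) (R d b)).toLinearMap))

@[simp]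
lemma qassoc_qincl {S : Type u} (Q P R : Quiv k S) (a b c d : S) (x : Q a c) (y : P c d)
    (z : R d b) :
    qassoc Q P R a b (qincl (qtensor Q P) R a b d (qincl Q P a d c (x ⊗ₜ y) ⊗ₜ z)) =
      qincl Q (qtensor P R) a b c (x ⊗ₜ qincl P R c b d (y ⊗ₜ z)) := by
  rw [qassoc, qlift_qincl, TensorProduct.lift.tmul, qlift_qincl]
  simp

/-- Transport in the first variable. -/
def castLeft {S : Type u} (Q : Quiv k S) {a c : S} (b : S) (h : a = c) : Q c b →ₗ[k] Q a b :=
  h ▸ LinearMap.id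

/-- Transport in the second variable. -/
def castRight {S : Type u} (Q : Quiv k S) (a : S) {c b : S} (h : c = b) : Q a c →ₗ[k] Q a b :=
  h ▸ LinearMap.id

/-- The isomorphism `I ⊗ Q → Q`. -/
def qleftUnit {S : Type u} (Q : Quiv k S) (a b : S) :
    qtensor (qunit k S) Q a b →ₗ[k] Q a b :=
  qlift fun c => TensorProduct.lift
    (Finsupp.linearCombination k fun h : PLift (a = c) => castLeft Q b h.down)

/-- The isomorphism `Q ⊗ I → Q`. -/
def qrightUnit {S : Type u} (Q : Quiv k S) (a b : S) :
    qtensor Q (qunit k S) a b →ₗ[k] Q a b :=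
  qlift fun c => TensorProduct.lift
    (Finsupp.linearCombination k fun h : PLift (c = b) => castRight Q a h.down).flip

@[simp]
lemma qleftUnit_qincl {S : Type u} (Q : Quiv k S) (a b : S) (h : PLift (a = a)) (x : Q a b) :
    qleftUnit Q a b (qincl (qunit k S) Q a b a (Finsupp.single h 1 ⊗ₜ x)) = x := by
  rw [qleftUnit, qlift_qincl, TensorProduct.lift.tmul, Finsupp.linearCombination_single,
    one_smul]
  rfl

@[simp]
lemma qrightUnit_qincl {S : Type u} (Q : Quiv k S) (a b : S) (h : PLift (b = b)) (x : Q a b) :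
    qrightUnit Q a b (qincl Q (qunit k S) a b b (x ⊗ₜ Finsupp.single h 1)) = x := by
  rw [qrightUnit, qlift_qincl, TensorProduct.lift.tmul, LinearMap.flip_apply,
    Finsupp.linearCombination_single, one_smul]
  rfl

/-- The map of unit quivers over a map of sets. -/
def qunitMap {S T : Type u} (f : S → T) (a b : S) :
    qunit k S a b →ₗ[k] qunit k T (f a) (f b) :=
  Finsupp.lmapDomain k k fun h => ⟨congrArg f h.down⟩

lemma qunitMap_single {S T : Type u} (f : S → T) {a b : S} (h : PLift (a = b)) :
    qunitMap (k := k) f a b (Finsupp.single h 1) =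
      Finsupp.single (⟨congrArg f h.down⟩ : PLift (f a = f b)) 1 :=
  Finsupp.mapDomain_single

lemma qmap_qmap {R S T : Type u} (f : R → S) (g : S → T) {Q P : Quiv k R} {Q' P' : Quiv k S}
    {Q'' P'' : Quiv k T}
    (α : ∀ a b, Q a b →ₗ[k] Q' (f a) (f b)) (β : ∀ a b, P a b →ₗ[k] P' (f a) (f b))
    (α' : ∀ a b, Q' a b →ₗ[k] Q'' (g a) (g b)) (β' : ∀ a b, P' a b →ₗ[k] P'' (g a) (g b))
    (a b : R) (t : qtensor Q P a b) :
    qmap g α' β' (f a) (f b) (qmap f α β a b t) =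
      qmap (fun x => g (f x)) (fun a b => α' (f a) (f b) ∘ₗ α a b)
        (fun a b => β' (f a) (f b) ∘ₗ β a b) a b t := by
  have : qmap g α' β' (f a) (f b) ∘ₗ qmap f α β a b =
      qmap (fun x => g (f x)) (fun a b => α' (f a) (f b) ∘ₗ α a b)
        (fun a b => β' (f a) (f b) ∘ₗ β a b) a b :=
    qhom_ext fun c x y => by simp
  exact LinearMap.congr_fun this t

lemma qmap_id {S : Type u} {Q P : Quiv k S} (a b : S) (t : qtensor Q P a b) :
    qmap (fun c => c) (fun _ _ => LinearMap.id) (fun _ _ => LinearMap.id) a b t = t := by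
  have : qmap (Q := Q) (P := P) (Q' := Q) (P' := P) (fun c => c)
      (fun _ _ => LinearMap.id) (fun _ _ => LinearMap.id) a b = LinearMap.id :=
    qhom_ext fun c x y => by simp
  exact LinearMap.congr_fun this t

end Quivers

/-! ## Templicial modules -/

/-- A morphism `[m] → [n]` in the category of finite intervals: a monotone map preserving the
endpoints. -/
@[ext]
structure FinInt (m n : ℕ) where
  toHom : Fin (m + 1) →o Fin (n + 1)
  map_zero : toHom 0 = 0
  map_last : toHom (Fin.last m) = Fin.last n

namespace FinInt

/-- The identity. -/
def id (n : ℕ) : FinInt n n := ⟨OrderHom.id, rfl, rfl⟩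

/-- The composite `g ∘ f`. -/
def comp {l m n : ℕ} (g : FinInt m n) (f : FinInt l m) : FinInt l n :=
  ⟨g.toHom.comp f.toHom,
    (congrArg g.toHom f.map_zero).trans g.map_zero,
    (congrArg g.toHom f.map_last).trans g.map_last⟩

end FinInt

/-- The inclusion of `[p]` as the initial segment of `[p + q]`. -/
def leftSeg {p q n : ℕ} (h : p + q = n) : Fin (p + 1) →o Fin (n + 1) where
  toFun i := ⟨i.1, by omega⟩
  monotone' _ _ h := h

/-- The inclusion of `[q]` as the final segment of `[p + q]`. -/
def rightSeg {p q n : ℕ} (h : p + q = n) : Fin (q + 1) →o Fin (n + 1) where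
  toFun i := ⟨p + i.1, by omega⟩
  monotone' i j hij := by
    have : i.1 ≤ j.1 := hij
    exact Fin.mk_le_mk.2 (by omega)

/-- The monoidal product `f + g` of morphisms of finite intervals, given by identifying the top
endpoint of the first interval with the bottom endpoint of the second one. -/
def FinInt.sum {p q n p' q' n' : ℕ} (h : p + q = n) (h' : p' + q' = n')
    (f : FinInt p p') (g : FinInt q q') : FinInt n n' where
  toHom :=
    { toFun := fun i => if hi : i.1 ≤ p then ⟨(f.toHom ⟨i.1, by omega⟩).1, by omega⟩
        else ⟨p' + (g.toHom ⟨i.1 - p, by omega⟩).1, by omega⟩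
      monotone' := by
        intro i j hij
        have hij' : i.1 ≤ j.1 := hij
        by_cases hi : i.1 ≤ p <;> by_cases hj : j.1 ≤ p
        · simp only [hi, hj, dite_true]
          exact Fin.mk_le_mk.2 (Fin.le_def.1 (f.toHom.monotone (Fin.mk_le_mk.2 hij')))
        · simp only [hi, hj, dite_true, dite_false, Fin.mk_le_mk]
          omega
        · omega
        · simp only [hi, hj, dite_false]
          have := Fin.le_def.1 (g.toHom.monotone (show (⟨i.1 - p, by omega⟩ : Fin (q + 1)) ≤
            ⟨j.1 - p, by omega⟩ from Fin.mk_le_mk.2 (by omega)))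
          exact Fin.mk_le_mk.2 (by omega) }
  map_zero := by
    have h0 := congrArg Fin.val f.map_zero
    exact Fin.ext h0
  map_last := by
    apply Fin.ext
    have h0 := congrArg Fin.val f.map_last
    have h1 := congrArg Fin.val g.map_last
    change (dite (n ≤ p) _ _ : Fin (n' + 1)).1 = n'
    by_cases hn : n ≤ p
    · obtain rfl : q = 0 := by omega
      obtain rfl : n = p := by omega
      have h2 := congrArg Fin.val g.map_zero
      simp only [le_refl, dite_true]
      change (f.toHom (Fin.last n)).1 = n'
      have h3 : (g.toHom (Fin.last 0)).1 = (g.toHom 0).1 := rfl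
      simp only [Fin.val_last, Fin.val_zero] at h0 h1 h2
      omega
    · simp only [hn, dite_false]
      have e : (⟨(Fin.last n).1 - p, by simp only [Fin.val_last]; omega⟩ : Fin (q + 1)) =
        Fin.last q := Fin.ext (by simp only [Fin.val_last]; omega)
      rw [e, h1]
      simpa using h'

lemma FinInt.sum_left {p q n p' q' n' : ℕ} (h : p + q = n) (h' : p' + q' = n')
    (f : FinInt p p') (g : FinInt q q') :
    (f.sum h h' g).toHom.comp (leftSeg h) = (leftSeg h').comp f.toHom := by
  ext i
  exact congrArg Fin.val (dif_pos (show i.1 ≤ p by omega))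

lemma FinInt.sum_right {p q n p' q' n' : ℕ} (h : p + q = n) (h' : p' + q' = n')
    (f : FinInt p p') (g : FinInt q q') :
    (f.sum h h' g).toHom.comp (rightSeg h) = (rightSeg h').comp g.toHom := by
  ext i
  by_cases hi : i = 0
  · subst hi
    refine (congrArg Fin.val (dif_pos (show p + 0 ≤ p by omega))).trans ?_
    have h1 := congrArg Fin.val f.map_last
    have h2 := congrArg Fin.val g.map_zero
    change (f.toHom (Fin.last p)).1 = p' + (g.toHom 0).1
    rw [h1, h2]
    rfl
  · have hi' : i.1 ≠ 0 := fun h => hi (Fin.ext h)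
    refine (congrArg Fin.val (dif_neg (show ¬ (p + i.1 ≤ p) by omega))).trans ?_
    change p' + (g.toHom ⟨p + i.1 - p, _⟩).1 = p' + (g.toHom i).1
    congr 3
    exact Fin.ext (by simp only; omega)

/-- A templicial `k`-module: a set `Base` together with a strongly unital colax monoidal functor
`obj` from the opposite of the category of finite intervals to `k`-quivers on `Base`. -/
structure TemplicialModule (k : Type u) [CommRing k] where
  Base : Type u
  obj : ℕ → Quiv k Base
  map : ∀ {m n : ℕ}, FinInt m n → ∀ a b, obj n a b →ₗ[k] obj m a b
  map_id : ∀ {n : ℕ} {a b : Base} (x : obj n a b), map (FinInt.id n) a b x = x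
  map_comp : ∀ {l m n : ℕ} (g : FinInt m n) (f : FinInt l m) {a b : Base} (x : obj n a b),
    map (g.comp f) a b x = map f a b (map g a b x)
  /-- the comultiplication `obj (p + q) → obj p ⊗ obj q` -/
  comul : ∀ {p q n : ℕ}, p + q = n → ∀ a b, obj n a b →ₗ[k] qtensor (obj p) (obj q) a b
  /-- the counit `obj 0 → I` -/
  counit : ∀ a b, obj 0 a b →ₗ[k] qunit k Base a b
  comul_map : ∀ {p q n p' q' n' : ℕ} (h : p + q = n) (h' : p' + q' = n')
    (f : FinInt p p') (g : FinInt q q') {a b : Base} (x : obj n' a b),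
    comul h a b (map (f.sum h h' g) a b x) =
      qmap (fun c => c) (map f) (map g) a b (comul h' a b x)
  coassoc : ∀ {p q r pq qr n : ℕ} (h₁ : p + q = pq) (h₂ : q + r = qr) (h₃ : pq + r = n)
    (h₄ : p + qr = n) {a b : Base} (x : obj n a b),
    qassoc (obj p) (obj q) (obj r) a b
        (qmap (fun c => c) (comul h₁) (fun _ _ => LinearMap.id) a b (comul h₃ a b x)) =
      qmap (fun c => c) (fun _ _ => LinearMap.id) (comul h₂) a b (comul h₄ a b x)
  counit_left : ∀ {n : ℕ} {a b : Base} (x : obj n a b),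
    qleftUnit (obj n) a b (qmap (fun c => c) counit (fun _ _ => LinearMap.id) a b
      (comul (zero_add n) a b x)) = x
  counit_right : ∀ {n : ℕ} {a b : Base} (x : obj n a b),
    qrightUnit (obj n) a b (qmap (fun c => c) (fun _ _ => LinearMap.id) counit a b
      (comul (add_zero n) a b x)) = x
  /-- strong unitality -/
  counit_bijective : ∀ a b, Function.Bijective (counit a b)

namespace TemplicialModule

variable {k : Type u} [CommRing k]

/-- A morphism of templicial modules: a map of sets `base = f` together with a monoidal natural
transformation `f_! X → Y`, given through its components `X_n(a,b) → Y_n(f a, f b)`. -/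
@[ext]
structure Hom (X Y : TemplicialModule.{u} k) where
  base : X.Base → Y.Base
  app : ∀ n a b, X.obj n a b →ₗ[k] Y.obj n (base a) (base b)
  naturality : ∀ {m n : ℕ} (f : FinInt m n) {a b : X.Base} (x : X.obj n a b),
    app m a b (X.map f a b x) = Y.map f _ _ (app n a b x)
  comul : ∀ {p q n : ℕ} (h : p + q = n) {a b : X.Base} (x : X.obj n a b),
    Y.comul h _ _ (app n a b x) = qmap base (app p) (app q) a b (X.comul h a b x)
  counit : ∀ {a b : X.Base} (x : X.obj 0 a b),
    Y.counit _ _ (app 0 a b x) = qunitMap base a b (X.counit a b x)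

instance : Category (TemplicialModule.{u} k) where
  Hom := Hom
  id X :=
    { base := fun a => a
      app := fun _ _ _ => LinearMap.id
      naturality := fun _ _ _ _ => rfl
      comul := fun h a b x => (qmap_id a b _).symm
      counit := fun {a b} x => by
        exact (Finsupp.mapDomain_id (v := X.counit a b x)).symm }
  comp F G :=
    { base := fun a => G.base (F.base a)
      app := fun n a b => G.app n _ _ ∘ₗ F.app n a b
      naturality := fun f _ _ x => by simp [F.naturality, G.naturality]
      comul := fun h a b x => by
        rw [LinearMap.comp_apply, G.comul, F.comul, qmap_qmap]
      counit := fun {a b} x => by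
        rw [LinearMap.comp_apply, G.counit, F.counit]
        simp only [qunitMap, Finsupp.lmapDomain_apply]
        exact (Finsupp.mapDomain_comp (f := fun h : PLift (a = b) =>
          (⟨congrArg F.base h.down⟩ : PLift (F.base a = F.base b)))
          (g := fun h => (⟨congrArg G.base h.down⟩ : PLift (G.base _ = G.base _)))).symm }
  id_comp _ := rfl
  comp_id _ := rfl
  assoc _ _ _ := rfl

end TemplicialModule

/-! ## The free templicial module on a simplicial set, and its right adjoint -/

noncomputable section Free

/-- The action of a monotone map on the simplices of a simplicial set. -/
def act (Y : SSet.{u}) {m n : ℕ} (φ : Fin (m + 1) →o Fin (n + 1)) (y : Y.obj (op ⦋n⦌)) :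
    Y.obj (op ⦋m⦌) :=
  Y.map (SimplexCategory.mkHom φ).op y

lemma act_act (Y : SSet.{u}) {l m n : ℕ} (φ : Fin (l + 1) →o Fin (m + 1))
    (ψ : Fin (m + 1) →o Fin (n + 1)) (y : Y.obj (op ⦋n⦌)) :
    act Y φ (act Y ψ y) = act Y (ψ.comp φ) y :=
  (Functor.map_comp_apply Y (SimplexCategory.mkHom ψ).op (SimplexCategory.mkHom φ).op y).symm

lemma act_id (Y : SSet.{u}) {n : ℕ} (y : Y.obj (op ⦋n⦌)) : act Y OrderHom.id y = y :=
  Y.map_id_apply _ y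

lemma app_act {Y Z : SSet.{u}} (f : Y ⟶ Z) {m n : ℕ} (φ : Fin (m + 1) →o Fin (n + 1))
    (y : Y.obj (op ⦋n⦌)) : f.app _ (act Y φ y) = act Z φ (f.app _ y) :=
  NatTrans.naturality_apply f (SimplexCategory.mkHom φ).op y

/-- The `i`-th vertex of a simplex. -/
def vertex (Y : SSet.{u}) {n : ℕ} (i : Fin (n + 1)) (y : Y.obj (op ⦋n⦌)) : Y.obj (op ⦋0⦌) :=
  act Y (OrderHom.const _ i) y

lemma vertex_act (Y : SSet.{u}) {m n : ℕ} (φ : Fin (m + 1) →o Fin (n + 1)) (i : Fin (m + 1))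
    (y : Y.obj (op ⦋n⦌)) : vertex Y i (act Y φ y) = vertex Y (φ i) y := by
  rw [vertex, act_act]
  rfl

lemma app_vertex {Y Z : SSet.{u}} (f : Y ⟶ Z) {n : ℕ} (i : Fin (n + 1)) (y : Y.obj (op ⦋n⦌)) :
    f.app _ (vertex Y i y) = vertex Z i (f.app _ y) :=
  app_act f _ y

/-- The `n`-simplices with first vertex `a` and last vertex `b`. -/
abbrev Between (Y : SSet.{u}) (n : ℕ) (a b : Y.obj (op ⦋0⦌)) : Type u :=
  { y : Y.obj (op ⦋n⦌) // vertex Y 0 y = a ∧ vertex Y (Fin.last n) y = b }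

variable (k : Type u) [CommRing k]

/-- The free module on the `n`-simplices with first vertex `a` and last vertex `b`. -/
def fmod (Y : SSet.{u}) (n : ℕ) : Quiv k (Y.obj (op ⦋0⦌)) :=
  fun a b => ModuleCat.of k (Between Y n a b →₀ k)

variable {k}

/-- The basis element given by a simplex. -/
def fgen {Y : SSet.{u}} {n : ℕ} {a b : Y.obj (op ⦋0⦌)} (y : Between Y n a b) : fmod k Y n a b :=
  Finsupp.single y (1 : k)

/-- The linear map with given values on the basis elements. -/
def flift {Y : SSet.{u}} {n : ℕ} {a b : Y.obj (op ⦋0⦌)} {M : Type u} [AddCommGroup M]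
    [Module k M] (f : Between Y n a b → M) : fmod k Y n a b →ₗ[k] M :=
  Finsupp.linearCombination k f

@[simp]
lemma flift_fgen {Y : SSet.{u}} {n : ℕ} {a b : Y.obj (op ⦋0⦌)} {M : Type u} [AddCommGroup M]
    [Module k M] (f : Between Y n a b → M) (y : Between Y n a b) :
    flift (k := k) f (fgen y) = f y :=
  (Finsupp.linearCombination_single k 1 y).trans (one_smul k _)

lemma fext {Y : SSet.{u}} {n : ℕ} {a b : Y.obj (op ⦋0⦌)} {M : Type u} [AddCommGroup M]
    [Module k M] {f g : fmod k Y n a b →ₗ[k] M}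
    (h : ∀ y : Between Y n a b, f (fgen y) = g (fgen y)) (x : fmod k Y n a b) : f x = g x :=
  LinearMap.congr_fun (Finsupp.lhom_ext' fun y => LinearMap.ext_ring (h y)) x

/-- The element of the tensor product of two free quivers given by two composable simplices. -/
def fpair {Y : SSet.{u}} {p q : ℕ} {a b : Y.obj (op ⦋0⦌)} (c : Y.obj (op ⦋0⦌))
    (y : Between Y p a c) (z : Between Y q c b) : qtensor (fmod k Y p) (fmod k Y q) a b :=
  qincl _ _ a b c (fgen y ⊗ₜ fgen z)

lemma fpair_congr {Y : SSet.{u}} {p q : ℕ} {a b c c' : Y.obj (op ⦋0⦌)}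
    {y : Between Y p a c} {z : Between Y q c b} {y' : Between Y p a c'} {z' : Between Y q c' b}
    (hy : y.1 = y'.1) (hz : z.1 = z'.1) : fpair (k := k) c y z = fpair c' y' z' := by
  obtain rfl : c = c' := by rw [← y.2.2, hy, y'.2.2]
  obtain rfl : y = y' := Subtype.ext hy
  obtain rfl : z = z' := Subtype.ext hz
  rfl

lemma fpair3_congr {Y : SSet.{u}} {p q r : ℕ} {a b c d c' d' : Y.obj (op ⦋0⦌)}
    {y : Between Y p a c} {z : Between Y q c d} {w : Between Y r d b}
    {y' : Between Y p a c'} {z' : Between Y q c' d'} {w' : Between Y r d' b}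
    (hy : y.1 = y'.1) (hz : z.1 = z'.1) (hw : w.1 = w'.1) :
    qincl (fmod k Y p) (qtensor (fmod k Y q) (fmod k Y r)) a b c (fgen y ⊗ₜ fpair d z w) =
      qincl (fmod k Y p) (qtensor (fmod k Y q) (fmod k Y r)) a b c'
        (fgen y' ⊗ₜ fpair d' z' w') := by
  obtain rfl : c = c' := by rw [← y.2.2, hy, y'.2.2]
  obtain rfl : d = d' := by rw [← z.2.2, hz, z'.2.2]
  obtain rfl : y = y' := Subtype.ext hy
  obtain rfl : z = z' := Subtype.ext hz
  obtain rfl : w = w' := Subtype.ext hw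
  rfl

lemma act_congr_id (Y : SSet.{u}) {n : ℕ} (φ : Fin (n + 1) →o Fin (n + 1))
    (h : ∀ i, φ i = i) (y : Y.obj (op ⦋n⦌)) : act Y φ y = y := by
  rw [show φ = OrderHom.id from OrderHom.ext _ _ (funext h), act_id]

lemma fleft_unit {Y : SSet.{u}} {n : ℕ} {a b c : Y.obj (op ⦋0⦌)} (h : PLift (a = c))
    (y : Between Y n c b) :
    qleftUnit (fmod k Y n) a b (qincl _ _ a b c (Finsupp.single h 1 ⊗ₜ fgen y)) =
      fgen ⟨y.1, y.2.1.trans h.down.symm, y.2.2⟩ := by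
  obtain ⟨rfl⟩ := h
  exact qleftUnit_qincl _ _ _ _ _

lemma fright_unit {Y : SSet.{u}} {n : ℕ} {a b c : Y.obj (op ⦋0⦌)} (h : PLift (c = b))
    (y : Between Y n a c) :
    qrightUnit (fmod k Y n) a b (qincl _ _ a b c (fgen y ⊗ₜ Finsupp.single h 1)) =
      fgen ⟨y.1, y.2.1, y.2.2.trans h.down⟩ := by
  obtain ⟨rfl⟩ := h
  exact qrightUnit_qincl _ _ _ _ _

lemma leftSeg_zero {p q n : ℕ} (h : p + q = n) : leftSeg h 0 = 0 := rfl

lemma rightSeg_zero {p q n : ℕ} (h : p + q = n) : rightSeg h 0 = leftSeg h (Fin.last p) := rfl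

lemma rightSeg_last {p q n : ℕ} (h : p + q = n) : rightSeg h (Fin.last q) = Fin.last n :=
  Fin.ext h

variable (k) in
/-- The simplicial operators of the free templicial module. -/
def fMap (Y : SSet.{u}) {m n : ℕ} (f : FinInt m n) (a b : Y.obj (op ⦋0⦌)) :
    fmod k Y n a b →ₗ[k] fmod k Y m a b :=
  flift fun y => fgen ⟨act Y f.toHom y.1, by
    rw [vertex_act, vertex_act, f.map_zero, f.map_last]
    exact y.2⟩

variable (k) in
/-- The comultiplications of the free templicial module: a simplex is sent to the tensor product
of its front and back faces. -/
def fComul (Y : SSet.{u}) {p q n : ℕ} (h : p + q = n) (a b : Y.obj (op ⦋0⦌)) :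
    fmod k Y n a b →ₗ[k] qtensor (fmod k Y p) (fmod k Y q) a b :=
  flift fun y => fpair (vertex Y (leftSeg h (Fin.last p)) y.1)
    ⟨act Y (leftSeg h) y.1, by
      rw [vertex_act, vertex_act, leftSeg_zero]
      exact ⟨y.2.1, rfl⟩⟩
    ⟨act Y (rightSeg h) y.1, by
      rw [vertex_act, vertex_act, rightSeg_zero, rightSeg_last]
      exact ⟨rfl, y.2.2⟩⟩

/-- The equality witnessed by a `0`-simplex. -/
def betweenEq {Y : SSet.{u}} {a b : Y.obj (op ⦋0⦌)} (y : Between Y 0 a b) : PLift (a = b) :=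
  ⟨y.2.1.symm.trans y.2.2⟩

lemma vertex_zero_eq {Y : SSet.{u}} (y : Y.obj (op ⦋0⦌)) : vertex Y 0 y = y := by
  have : (OrderHom.const (Fin (0 + 1)) (0 : Fin (0 + 1))) = OrderHom.id := by
    ext i
    exact (Nat.lt_one_iff.1 i.2).symm
  rw [vertex, this, act_id]

lemma betweenEq_bijective {Y : SSet.{u}} {a b : Y.obj (op ⦋0⦌)} :
    Function.Bijective (betweenEq (a := a) (b := b)) := by
  constructor
  · intro y z _
    apply Subtype.ext
    rw [← vertex_zero_eq y.1, ← vertex_zero_eq z.1, y.2.1, z.2.1]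
  · rintro ⟨rfl⟩
    exact ⟨⟨a, vertex_zero_eq a, vertex_zero_eq a⟩, rfl⟩

variable (k) in
/-- The counit of the free templicial module. -/
def fCounit (Y : SSet.{u}) (a b : Y.obj (op ⦋0⦌)) :
    fmod k Y 0 a b →ₗ[k] qunit k (Y.obj (op ⦋0⦌)) a b :=
  Finsupp.lmapDomain k k betweenEq

lemma fCounit_fgen {Y : SSet.{u}} {a b : Y.obj (op ⦋0⦌)} (y : Between Y 0 a b) :
    fCounit k Y a b (fgen y) = Finsupp.single (betweenEq y) 1 :=
  Finsupp.mapDomain_single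

lemma qmap_fpair {Y : SSet.{u}} {T : Type u} (f : Y.obj (op ⦋0⦌) → T) {p q : ℕ}
    {Q P : Quiv k T} (α : ∀ a b, fmod k Y p a b →ₗ[k] Q (f a) (f b))
    (β : ∀ a b, fmod k Y q a b →ₗ[k] P (f a) (f b)) {a b c : Y.obj (op ⦋0⦌)}
    (y : Between Y p a c) (z : Between Y q c b) :
    qmap f α β a b (fpair c y z) = qincl Q P (f a) (f b) (f c) (α a c (fgen y) ⊗ₜ β c b (fgen z)) :=
  qmap_qincl f α β a b c (fgen y) (fgen z)

/-- The free templicial module on a simplicial set `Y`: the base is `Y₀`, and the module of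
`n`-simplices from `a` to `b` is free on the set of `n`-simplices of `Y` from `a` to `b`. -/
def freeTemplicialObj (k : Type u) [CommRing k] (Y : SSet.{u}) : TemplicialModule.{u} k where
  Base := Y.obj (op ⦋0⦌)
  obj n := fmod k Y n
  map f := fMap k Y f
  map_id {n a b} x := fext (f := fMap k Y _ a b) (g := LinearMap.id) (fun y => by
    rw [fMap, flift_fgen]
    exact congrArg fgen (Subtype.ext (act_id Y y.1))) x
  map_comp {_ _ _} g f {a b} x := fext (f := fMap k Y _ a b) (g := fMap k Y f a b ∘ₗ fMap k Y g a b)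
    (fun y => by
      simp only [LinearMap.comp_apply, fMap, flift_fgen]
      exact congrArg fgen (Subtype.ext (act_act Y f.toHom g.toHom y.1).symm)) x
  comul h := fComul k Y h
  counit := fCounit k Y
  comul_map {_ _ _ _ _ _} h h' f g {a b} x :=
    fext (f := fComul k Y h a b ∘ₗ fMap k Y _ a b)
      (g := qmap (fun c => c) (fMap k Y f) (fMap k Y g) a b ∘ₗ fComul k Y h' a b) (fun y => by
      simp only [LinearMap.comp_apply, fMap, fComul, flift_fgen]
      refine Eq.trans ?_ (qmap_fpair (fun c => c) (fMap k Y f) (fMap k Y g) _ _).symm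
      rw [fMap, fMap, flift_fgen, flift_fgen]
      refine fpair_congr ?_ ?_
      · simp only [act_act, FinInt.sum_left]
      · simp only [act_act, FinInt.sum_right]) x
  coassoc {p q r pq qr n} h₁ h₂ h₃ h₄ {a b} x :=
    fext (f := qassoc _ _ _ a b ∘ₗ
        qmap (fun c => c) (fComul k Y h₁) (fun _ _ => LinearMap.id) a b ∘ₗ fComul k Y h₃ a b)
      (g := qmap (fun c => c) (fun _ _ => LinearMap.id) (fComul k Y h₂) a b ∘ₗ fComul k Y h₄ a b)
      (fun y => by
      simp only [LinearMap.comp_apply, fComul, flift_fgen]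
      refine Eq.trans ?_ (qmap_fpair (fun c => c) (fun _ _ => LinearMap.id) (fComul k Y h₂) _ _).symm
      refine (congrArg _ (qmap_fpair _ _ _ _ _)).trans ?_
      rw [fComul, fComul, flift_fgen, flift_fgen]
      refine (qassoc_qincl _ _ _ _ _ _ _ _ _ _).trans ?_
      refine fpair3_congr ?_ ?_ ?_
      · simp only [act_act]; congr 1
      · simp only [act_act]; congr 1
      · simp only [act_act]
        congr 1
        ext i
        change pq + i.1 = p + (q + i.1)
        omega) x
  counit_left {n a b} x :=
    fext (f := qleftUnit _ a b ∘ₗ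
        qmap (fun c => c) (fCounit k Y) (fun _ _ => LinearMap.id) a b ∘ₗ fComul k Y _ a b)
      (g := LinearMap.id) (fun y => by
      simp only [LinearMap.comp_apply, fComul, flift_fgen]
      refine (congrArg _ (qmap_fpair _ _ _ _ _)).trans ?_
      rw [fCounit_fgen]
      exact (fleft_unit _ _).trans (congrArg fgen (Subtype.ext (act_congr_id Y _ (fun i => by
        simp [rightSeg]) _)))) x
  counit_right {n a b} x :=
    fext (f := qrightUnit _ a b ∘ₗ
        qmap (fun c => c) (fun _ _ => LinearMap.id) (fCounit k Y) a b ∘ₗ fComul k Y _ a b)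
      (g := LinearMap.id) (fun y => by
      simp only [LinearMap.comp_apply, fComul, flift_fgen]
      refine (congrArg _ (qmap_fpair _ _ _ _ _)).trans ?_
      rw [fCounit_fgen]
      exact (fright_unit _ _).trans (congrArg fgen (Subtype.ext (act_congr_id Y _ (fun i => by
        rfl) _)))) x
  counit_bijective a b :=
    ⟨Finsupp.mapDomain_injective betweenEq_bijective.1,
      Finsupp.mapDomain_surjective betweenEq_bijective.2⟩

/-- The action of a simplicial map on simplices with prescribed first and last vertices. -/
def fBetween {Y Z : SSet.{u}} (f : Y ⟶ Z) {n : ℕ} {a b : Y.obj (op ⦋0⦌)} (y : Between Y n a b) :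
    Between Z n (f.app _ a) (f.app _ b) :=
  ⟨f.app _ y.1, by
    rw [← app_vertex, ← app_vertex, y.2.1, y.2.2]
    exact ⟨rfl, rfl⟩⟩

variable (k) in
/-- The action of a simplicial map on the free modules. -/
def fApp {Y Z : SSet.{u}} (f : Y ⟶ Z) (n : ℕ) (a b : Y.obj (op ⦋0⦌)) :
    fmod k Y n a b →ₗ[k] fmod k Z n (f.app _ a) (f.app _ b) :=
  flift fun y => fgen (fBetween f y)

lemma fApp_fgen {Y Z : SSet.{u}} (f : Y ⟶ Z) {n : ℕ} {a b : Y.obj (op ⦋0⦌)}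
    (y : Between Y n a b) : fApp k f n a b (fgen y) = fgen (fBetween f y) :=
  flift_fgen _ _

lemma fApp_natural {Y Z : SSet.{u}} (f : Y ⟶ Z) {m n : ℕ} (φ : FinInt m n)
    {a b : Y.obj (op ⦋0⦌)} (x : fmod k Y n a b) :
    fApp k f m a b (fMap k Y φ a b x) = fMap k Z φ _ _ (fApp k f n a b x) :=
  fext (f := fApp k f m a b ∘ₗ fMap k Y φ a b) (g := fMap k Z φ _ _ ∘ₗ fApp k f n a b)
    (fun y => by
      simp only [LinearMap.comp_apply, fMap, fApp, flift_fgen]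
      exact congrArg fgen (Subtype.ext (app_act f _ _))) x

lemma fApp_comul {Y Z : SSet.{u}} (f : Y ⟶ Z) {p q n : ℕ} (h : p + q = n)
    {a b : Y.obj (op ⦋0⦌)} (x : fmod k Y n a b) :
    fComul k Z h _ _ (fApp k f n a b x) =
      qmap (fun a => f.app _ a) (fApp k f p) (fApp k f q) a b (fComul k Y h a b x) :=
  fext (f := fComul k Z h _ _ ∘ₗ fApp k f n a b)
    (g := qmap (fun a => f.app _ a) (fApp k f p) (fApp k f q) a b ∘ₗ fComul k Y h a b)
    (fun y => by
      simp only [LinearMap.comp_apply, fComul, fApp, flift_fgen]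
      refine Eq.trans ?_ (qmap_fpair (fun a => f.app _ a) (fApp k f p) (fApp k f q) _ _).symm
      rw [fApp, fApp, flift_fgen, flift_fgen]
      exact fpair_congr (app_act f _ _).symm (app_act f _ _).symm) x

lemma fApp_counit {Y Z : SSet.{u}} (f : Y ⟶ Z) {a b : Y.obj (op ⦋0⦌)} (x : fmod k Y 0 a b) :
    fCounit k Z _ _ (fApp k f 0 a b x) = qunitMap (fun a => f.app _ a) a b (fCounit k Y a b x) :=
  fext (f := fCounit k Z _ _ ∘ₗ fApp k f 0 a b)
    (g := qunitMap (fun a => f.app _ a) a b ∘ₗ fCounit k Y a b)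
    (fun y => by
      have h₁ : fCounit k Z _ _ (fApp k f 0 a b (fgen y)) =
          fCounit k Z _ _ (fgen (fBetween f y)) := congrArg _ (fApp_fgen f y)
      have h₂ : qunitMap (fun a => f.app _ a) a b (fCounit k Y a b (fgen y)) =
          qunitMap (fun a => f.app _ a) a b (Finsupp.single (betweenEq y) 1) :=
        congrArg _ (fCounit_fgen y)
      exact h₁.trans ((fCounit_fgen _).trans (h₂.trans Finsupp.mapDomain_single).symm)) x

/-- The free templicial module functor. -/
def freeTemplicial (k : Type u) [CommRing k] : SSet.{u} ⥤ TemplicialModule.{u} k where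
  obj Y := freeTemplicialObj k Y
  map {Y Z} f :=
    { base := fun a => f.app _ a
      app := fApp k f
      naturality := fApp_natural f
      comul := fApp_comul f
      counit := fApp_counit f }
  map_id Y := TemplicialModule.Hom.ext (funext fun a => rfl) (heq_of_eq (by
    funext n a b
    exact LinearMap.ext (fext (f := fApp k (𝟙 Y) n a b) (g := LinearMap.id) fun y =>
      flift_fgen _ y)))
  map_comp f g := TemplicialModule.Hom.ext (funext fun a => rfl) (heq_of_eq (by
    funext n a b
    refine LinearMap.ext (fext (f := fApp k (f ≫ g) n a b)
      (g := fApp k g n _ _ ∘ₗ fApp k f n a b) fun y => ?_)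
    refine (fApp_fgen (f ≫ g) y).trans ?_
    exact ((congrArg _ (fApp_fgen f y)).trans (fApp_fgen g (fBetween f y))).symm))

/-- The right adjoint of the free templicial module functor: the `n`-simplices of the underlying
simplicial set of `X` are the morphisms from the free templicial module on `Δ[n]` to `X`. -/
def underlyingSSet (k : Type u) [CommRing k] : TemplicialModule.{u} k ⥤ SSet.{u} :=
  yoneda ⋙ (Functor.whiskeringLeft _ _ _).obj (SSet.stdSimplex.op ⋙ (freeTemplicial k).op)

end Free

/-! ## The templicial module of a category enriched in augmented simplicial modules -/

noncomputable section Words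

/-- The `i`-th element of a finite set of natural numbers smaller than `n`. -/
def enum {n : ℕ} (S : Finset (Fin n)) : Fin S.card ≃o S := S.orderIsoOfFin rfl

lemma enum_eq {n c : ℕ} (S : Finset (Fin n)) (hc : S.card = c) (e : Fin c → Fin n)
    (he : ∀ i, e i ∈ S) (hm : StrictMono e) (i : Fin S.card) :
    (enum S i).1 = e ⟨i.1, hc ▸ i.2⟩ := by
  subst hc
  exact (congrFun (S.orderEmbOfFin_unique rfl he hm) i).symm

/-- The map on indices induced by a monotone map sending the finite set `S` into `S'`. -/
def finMap {m n : ℕ} (S : Finset (Fin m)) (S' : Finset (Fin n)) (f : Fin m →o Fin n)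
    (hf : ∀ u ∈ S, f u ∈ S') : Fin S.card →o Fin S'.card where
  toFun i := (enum S').symm ⟨f (enum S i).1, hf _ (enum S i).2⟩
  monotone' _ _ hij := (enum S').symm.monotone
    (Subtype.mk_le_mk.2 (f.monotone ((enum S).monotone hij)))

lemma enum_finMap {m n : ℕ} (S : Finset (Fin m)) (S' : Finset (Fin n)) (f : Fin m →o Fin n)
    (hf : ∀ u ∈ S, f u ∈ S') (i : Fin S.card) :
    (enum S' (finMap S S' f hf i)).1 = f (enum S i).1 :=
  congrArg Subtype.val ((enum S').apply_symm_apply _)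

lemma enum_injective {n : ℕ} (S : Finset (Fin n)) {i j : Fin S.card}
    (h : (enum S i).1 = (enum S j).1) : i = j :=
  (enum S).injective (Subtype.ext h)

lemma finMap_id {m : ℕ} (S : Finset (Fin m)) (hf : ∀ u ∈ S, OrderHom.id u ∈ S) :
    finMap S S OrderHom.id hf = OrderHom.id :=
  OrderHom.ext _ _ (funext fun i => enum_injective S (enum_finMap S S _ hf i))

lemma finMap_comp {l m n : ℕ} (S : Finset (Fin l)) (S' : Finset (Fin m)) (S'' : Finset (Fin n))
    (f : Fin l →o Fin m) (g : Fin m →o Fin n) (hf : ∀ u ∈ S, f u ∈ S')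
    (hg : ∀ u ∈ S', g u ∈ S'') (hgf : ∀ u ∈ S, g.comp f u ∈ S'') :
    finMap S S'' (g.comp f) hgf = (finMap S' S'' g hg).comp (finMap S S' f hf) :=
  OrderHom.ext _ _ (funext fun i => enum_injective S'' (by
    rw [enum_finMap]
    change _ = (enum S'' (finMap S' S'' g hg (finMap S S' f hf i))).1
    rw [enum_finMap, enum_finMap]
    rfl))

lemma card_union {n : ℕ} {S S₁ S₂ : Finset (Fin n)}
    (hS : ∀ u, u ∈ S ↔ u ∈ S₁ ∨ u ∈ S₂) (hlt : ∀ u ∈ S₁, ∀ v ∈ S₂, u < v) : S₁.card + S₂.card = S.card := by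
  rw [← Finset.card_union_of_disjoint]
  · congr 1
    ext u
    rw [hS, Finset.mem_union]
  · rw [Finset.disjoint_left]
    exact fun u h₁ h₂ => lt_irrefl _ (hlt u h₁ u h₂)

lemma enum_union {n : ℕ} {S S₁ S₂ : Finset (Fin n)}
    (hS : ∀ u, u ∈ S ↔ u ∈ S₁ ∨ u ∈ S₂) (hlt : ∀ u ∈ S₁, ∀ v ∈ S₂, u < v)
    (i : Fin S.card) : (enum S i).1 =
    if h : i.1 < S₁.card then (enum S₁ ⟨i.1, h⟩).1
    else (enum S₂ ⟨i.1 - S₁.card, by have := card_union hS hlt; omega⟩).1 := by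
  refine (enum_eq S rfl (fun i : Fin S.card => if h : i.1 < S₁.card then (enum S₁ ⟨i.1, h⟩).1
    else (enum S₂ ⟨i.1 - S₁.card, by have := card_union hS hlt; omega⟩).1) ?_ ?_ i)
  · intro i
    rw [hS]
    split_ifs
    · exact Or.inl (Subtype.prop _)
    · exact Or.inr (Subtype.prop _)
  · intro i j hij
    have hij' : i.1 < j.1 := hij
    dsimp only
    split_ifs with h₁ h₂ h₂
    · exact (enum S₁).strictMono (Fin.mk_lt_mk.2 hij')
    · exact hlt _ (Subtype.prop _) _ (Subtype.prop _)
    · omega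
    · exact (enum S₂).strictMono (Fin.mk_lt_mk.2 (by omega))

lemma enum_left {n : ℕ} {S S₁ S₂ : Finset (Fin n)}
    (hS : ∀ u, u ∈ S ↔ u ∈ S₁ ∨ u ∈ S₂) (hlt : ∀ u ∈ S₁, ∀ v ∈ S₂, u < v)
    (i : Fin S₁.card) (h : i.1 < S.card) : (enum S ⟨i.1, h⟩).1 = (enum S₁ i).1 := by
  rw [enum_union hS hlt, dif_pos i.2]

lemma enum_right {n : ℕ} {S S₁ S₂ : Finset (Fin n)}
    (hS : ∀ u, u ∈ S ↔ u ∈ S₁ ∨ u ∈ S₂) (hlt : ∀ u ∈ S₁, ∀ v ∈ S₂, u < v)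
    (i : Fin S₂.card) (h : S₁.card + i.1 < S.card) :
    (enum S ⟨S₁.card + i.1, h⟩).1 = (enum S₂ i).1 := by
  rw [enum_union hS hlt, dif_neg (by simp only; omega)]
  congr 3
  simp

lemma finMap_union {m n : ℕ} {S S₁ S₂ : Finset (Fin m)} {T T₁ T₂ : Finset (Fin n)}
    (hS : ∀ u, u ∈ S ↔ u ∈ S₁ ∨ u ∈ S₂) (hSlt : ∀ u ∈ S₁, ∀ v ∈ S₂, u < v)
    (hT : ∀ u, u ∈ T ↔ u ∈ T₁ ∨ u ∈ T₂) (hTlt : ∀ u ∈ T₁, ∀ v ∈ T₂, u < v)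
    (f : Fin m →o Fin n) (hf : ∀ u ∈ S, f u ∈ T) (hf₁ : ∀ u ∈ S₁, f u ∈ T₁)
    (hf₂ : ∀ u ∈ S₂, f u ∈ T₂) (h : S₁.card + S₂.card = S.card)
    (h' : T₁.card + T₂.card = T.card) :
    finMap S T f hf = join h h' (finMap S₁ T₁ f hf₁) (finMap S₂ T₂ f hf₂) := by
  apply eq_join
  · intro i
    suffices e : finMap S T f hf ⟨i.1, by omega⟩ = ⟨(finMap S₁ T₁ f hf₁ i).1, by omega⟩ from
      congrArg Fin.val e
    apply enum_injective
    rw [enum_finMap, enum_left hS hSlt, enum_left hT hTlt, enum_finMap]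
  · intro i
    suffices e : finMap S T f hf ⟨S₁.card + i.1, by omega⟩ =
        ⟨T₁.card + (finMap S₂ T₂ f hf₂ i).1, by omega⟩ from congrArg Fin.val e
    apply enum_injective
    rw [enum_finMap, enum_right hS hSlt, enum_right hT hTlt, enum_finMap]

open Classical in
/-- The elements strictly between `s` and `t` that do not belong to `cut`. -/
def inner {n : ℕ} (cut : Set (Fin (n + 1))) (s t : Fin (n + 1)) : Finset (Fin (n + 1)) :=
  Finset.univ.filter fun u => s < u ∧ u < t ∧ u ∉ cut

lemma mem_inner {n : ℕ} {cut : Set (Fin (n + 1))} {s t u : Fin (n + 1)} :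
    u ∈ inner cut s t ↔ s < u ∧ u < t ∧ u ∉ cut := by
  simp [inner]

lemma card_inner_self {n : ℕ} (cut : Set (Fin (n + 1))) (s : Fin (n + 1)) :
    (inner cut s s).card = 0 := by
  rw [Finset.card_eq_zero, Finset.eq_empty_iff_forall_notMem]
  intro u hu
  rw [mem_inner] at hu
  exact lt_asymm hu.1 hu.2.1

lemma mem_inner_union {n : ℕ} {cut : Set (Fin (n + 1))} {s t u : Fin (n + 1)} (ht : t ∈ cut)
    (h : s ≤ t) (h' : t ≤ u) (v : Fin (n + 1)) :
    v ∈ inner cut s u ↔ v ∈ inner cut s t ∨ v ∈ inner cut t u := by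
  simp only [mem_inner]
  constructor
  · rintro ⟨h₁, h₂, h₃⟩
    rcases lt_trichotomy v t with hv | rfl | hv
    · exact Or.inl ⟨h₁, hv, h₃⟩
    · exact absurd ht h₃
    · exact Or.inr ⟨hv, h₂, h₃⟩
  · rintro (⟨h₁, h₂, h₃⟩ | ⟨h₁, h₂, h₃⟩)
    · exact ⟨h₁, h₂.trans_le h', h₃⟩
    · exact ⟨h.trans_lt h₁, h₂, h₃⟩

lemma inner_lt {n : ℕ} {cut : Set (Fin (n + 1))} {s t u : Fin (n + 1)} :
    ∀ v ∈ inner cut s t, ∀ w ∈ inner cut t u, v < w := by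
  intro v hv w hw
  rw [mem_inner] at hv hw
  exact hv.2.1.trans hw.1

lemma card_inner {n : ℕ} {cut : Set (Fin (n + 1))} {s t u : Fin (n + 1)} (ht : t ∈ cut)
    (h : s ≤ t) (h' : t ≤ u) :
    (inner cut s t).card + (inner cut t u).card = (inner cut s u).card :=
  card_union (mem_inner_union ht h h') inner_lt

lemma map_inner {m n : ℕ} (f : Fin (m + 1) →o Fin (n + 1)) (cut : Set (Fin (n + 1)))
    {s t : Fin (m + 1)} (hs : s ∈ f ⁻¹' cut) (ht : t ∈ f ⁻¹' cut) :
    ∀ u ∈ inner (f ⁻¹' cut) s t, f u ∈ inner cut (f s) (f t) := by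
  intro u hu
  rw [mem_inner] at hu ⊢
  refine ⟨lt_of_le_of_ne (f.monotone hu.1.le) ?_, lt_of_le_of_ne (f.monotone hu.2.1.le) ?_, hu.2.2⟩
  · intro e
    exact hu.2.2 (by change f u ∈ cut; rw [← e]; exact hs)
  · intro e
    exact hu.2.2 (by change f u ∈ cut; rw [e]; exact ht)

variable {k : Type u} [CommRing k]

/-- The shape of a word: a subset `cut = {0 = i_0 < … < i_m = n}` of `[n]` containing the
endpoints, together with objects `vert i_0 = a, …, vert i_m = b`. -/
structure Shape (A : AugCat.{u} k) (n : ℕ) (a b : A.Obj) where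
  cut : Set (Fin (n + 1))
  zero_mem : 0 ∈ cut
  last_mem : Fin.last n ∈ cut
  vert : cut → A.Obj
  vert_zero : vert ⟨0, zero_mem⟩ = a
  vert_last : vert ⟨Fin.last n, last_mem⟩ = b

/-- A tuple of elements of `A(vert i_{j-1}, vert i_j)` of degrees `[i_j - i_{j-1} - 2]`
(`i_j - i_{j-1} - 1` being the number of vertices strictly between `i_{j-1}` and `i_j`), one for
each `1 ≤ j ≤ m`.  The tuple is given through all the composites `arr s t` of its consecutive
members, so that `arr i_{j-1} i_j` are the members and the other values are determined by these. -/
structure Arr {A : AugCat.{u} k} {n : ℕ} {a b : A.Obj} (σ : Shape A n a b) where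
  arr : ∀ s t : σ.cut, s ≤ t → A.hom (σ.vert s) (σ.vert t) (inner σ.cut s.1 t.1).card
  arr_self : ∀ s, arr s s le_rfl = A.one' (σ.vert s) (card_inner_self σ.cut s.1)
  arr_comp : ∀ (s t u : σ.cut) (h : s ≤ t) (h' : t ≤ u),
    A.comp (card_inner t.2 h h') (arr s t h) (arr t u h') = arr s u (h.trans h')

lemma Arr.ext' {A : AugCat.{u} k} {n : ℕ} {a b : A.Obj} {σ : Shape A n a b} {α β : Arr σ}
    (h : ∀ s t hst, α.arr s t hst = β.arr s t hst) : α = β := by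
  cases α; cases β
  congr 1
  funext s t hst
  exact h s t hst

/-- The multilinearity relation: the tuples `α`, `α₁`, `α₂` only differ in the member
`i_{j-1} ≤ g < i_j`, which is `r • α₁ + r' • α₂` for `α`. -/
def IsLin {A : AugCat.{u} k} {n : ℕ} {a b : A.Obj} {σ : Shape A n a b} (g : Fin n) (r r' : k)
    (α α₁ α₂ : Arr σ) : Prop :=
  ∀ (s t : σ.cut) (h : s ≤ t),
    ((s.1.1 ≤ g.1 ∧ g.1 < t.1.1) → α.arr s t h = r • α₁.arr s t h + r' • α₂.arr s t h) ∧
    (¬ (s.1.1 ≤ g.1 ∧ g.1 < t.1.1) → α₁.arr s t h = α.arr s t h ∧ α₂.arr s t h = α.arr s t h)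

/-- The relations of the tensor product. -/
def tensRel {A : AugCat.{u} k} {n : ℕ} {a b : A.Obj} (σ : Shape A n a b) :
    Submodule k (Arr σ →₀ k) :=
  Submodule.span k { x | ∃ (g : Fin n) (r r' : k) (α α₁ α₂ : Arr σ), IsLin g r r' α α₁ α₂ ∧
    x = Finsupp.single α 1 - r • Finsupp.single α₁ 1 - r' • Finsupp.single α₂ 1 }

/-- The tensor product `A(vert i_0, vert i_1) ⊗ ⋯ ⊗ A(vert i_{m-1}, vert i_m)`: the quotient of
the free module on all tuples by the multilinearity relations. -/
def Tens {A : AugCat.{u} k} {n : ℕ} {a b : A.Obj} (σ : Shape A n a b) : ModuleCat.{u} k :=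
  ModuleCat.of k ((Arr σ →₀ k) ⧸ tensRel σ)

/-- The pure tensor of a tuple. -/
def pureTensor {A : AugCat.{u} k} {n : ℕ} {a b : A.Obj} {σ : Shape A n a b} (α : Arr σ) : Tens σ :=
  (tensRel σ).mkQ (Finsupp.single α 1)

/-- The quiver of `n`-simplices: the direct sum of all tensor products of letters. -/
def tmod (A : AugCat.{u} k) (n : ℕ) : Quiv k A.Obj :=
  fun a b => ModuleCat.of k (⨁ σ : Shape A n a b, Tens σ)

open Classical in
/-- The pure tensor of a tuple, as an element of the direct sum. -/
def word {A : AugCat.{u} k} {n : ℕ} {a b : A.Obj} (σ : Shape A n a b) (α : Arr σ) :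
    tmod A n a b :=
  DirectSum.lof k (Shape A n a b) (fun σ => Tens σ) σ
    (pureTensor α)

/-- The multilinearity of a map defined on tuples. -/
def Multilin {A : AugCat.{u} k} {n : ℕ} {a b : A.Obj} {M : Type u} [AddCommGroup M] [Module k M]
    (f : ∀ σ : Shape A n a b, Arr σ → M) : Prop :=
  ∀ σ (g : Fin n) (r r' : k) (α α₁ α₂ : Arr σ), IsLin g r r' α α₁ α₂ →
    f σ α = r • f σ α₁ + r' • f σ α₂

open Classical in
/-- The linear map with prescribed values on pure tensors. -/
def tlift {A : AugCat.{u} k} {n : ℕ} {a b : A.Obj} {M : Type u} [AddCommGroup M] [Module k M]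
    (f : ∀ σ : Shape A n a b, Arr σ → M) (hf : Multilin f) : tmod A n a b →ₗ[k] M :=
  DirectSum.toModule k (Shape A n a b) M fun σ =>
    (tensRel σ).liftQ (Finsupp.linearCombination k (f σ)) (by
      rw [tensRel, Submodule.span_le]
      rintro x ⟨g, r, r', α, α₁, α₂, h, rfl⟩
      rw [SetLike.mem_coe, LinearMap.mem_ker, map_sub, map_sub, map_smul, map_smul,
        Finsupp.linearCombination_single, Finsupp.linearCombination_single,
        Finsupp.linearCombination_single, one_smul, one_smul, one_smul, hf σ g r r' α α₁ α₂ h]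
      abel)

@[simp]
lemma tlift_word {A : AugCat.{u} k} {n : ℕ} {a b : A.Obj} {M : Type u} [AddCommGroup M]
    [Module k M] (f : ∀ σ : Shape A n a b, Arr σ → M) (hf : Multilin f) (σ : Shape A n a b)
    (α : Arr σ) : tlift f hf (word σ α) = f σ α := by
  classical
  refine (DirectSum.toModule_lof (R := k) (M := fun σ : Shape A n a b => Tens σ) σ _).trans ?_
  exact (Finsupp.linearCombination_single k 1 α).trans (one_smul k _)

lemma text {A : AugCat.{u} k} {n : ℕ} {a b : A.Obj} {M : Type u} [AddCommGroup M] [Module k M]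
    {f g : tmod A n a b →ₗ[k] M} (h : ∀ σ α, f (word σ α) = g (word σ α)) (x : tmod A n a b) :
    f x = g x := by
  classical
  have : f = g := by
    refine DirectSum.linearMap_ext k fun σ => ?_
    exact Submodule.linearMap_qext (tensRel σ) (Finsupp.lhom_ext' fun α =>
      LinearMap.ext_ring (h σ α))
  rw [this]

lemma word_lin {A : AugCat.{u} k} {n : ℕ} {a b : A.Obj} {σ : Shape A n a b} {g : Fin n} {r r' : k}
    {α α₁ α₂ : Arr σ} (h : IsLin g r r' α α₁ α₂) :
    word σ α = r • word σ α₁ + r' • word σ α₂ := by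
  classical
  have : pureTensor α = r • pureTensor α₁ + r' • pureTensor α₂ := by
    have h₁ : (tensRel σ).mkQ
        (Finsupp.single α 1 - r • Finsupp.single α₁ 1 - r' • Finsupp.single α₂ 1) = 0 :=
      (Submodule.Quotient.mk_eq_zero _).2 (Submodule.subset_span ⟨g, r, r', α, α₁, α₂, h, rfl⟩)
    rw [map_sub, map_sub, map_smul, map_smul, sub_sub, sub_eq_zero] at h₁
    exact h₁
  unfold word
  rw [this]
  exact (map_add _ _ _).trans (congrArg₂ _ (map_smul _ _ _) (map_smul _ _ _))

/-! ### Restriction of words along monotone maps -/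

/-- The restriction of a shape along a monotone map `f` preserving the endpoints up to elements
of `cut`. -/
def pullShape {A : AugCat.{u} k} {m n : ℕ} {a b a' b' : A.Obj} (f : Fin (m + 1) →o Fin (n + 1))
    (σ : Shape A n a b) (h₀ : f 0 ∈ σ.cut) (h₁ : f (Fin.last m) ∈ σ.cut)
    (ha : σ.vert ⟨f 0, h₀⟩ = a') (hb : σ.vert ⟨f (Fin.last m), h₁⟩ = b') : Shape A m a' b' where
  cut := f ⁻¹' σ.cut
  zero_mem := h₀
  last_mem := h₁
  vert s := σ.vert ⟨f s.1, s.2⟩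
  vert_zero := ha
  vert_last := hb

/-- The restriction of a tuple: the members of the restricted tuple are obtained by composing
consecutive members (or inserting identities) and by applying simplicial operators. -/
def pullArr {A : AugCat.{u} k} {m n : ℕ} {a b a' b' : A.Obj} (f : Fin (m + 1) →o Fin (n + 1))
    {σ : Shape A n a b} (α : Arr σ) (h₀ : f 0 ∈ σ.cut) (h₁ : f (Fin.last m) ∈ σ.cut)
    (ha : σ.vert ⟨f 0, h₀⟩ = a') (hb : σ.vert ⟨f (Fin.last m), h₁⟩ = b') :
    Arr (pullShape f σ h₀ h₁ ha hb) where
  arr s t h := A.map (finMap _ _ f (map_inner f σ.cut s.2 t.2))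
    (α.arr ⟨f s.1, s.2⟩ ⟨f t.1, t.2⟩ (f.monotone h))
  arr_self s := by
    rw [α.arr_self]
    exact A.map_one' _ _ _ _
  arr_comp s t u h h' := by
    refine (A.map_join (card_inner (cut := f ⁻¹' σ.cut) t.2 h h')
      (card_inner (cut := σ.cut) (t := f t.1) t.2 (f.monotone h) (f.monotone h'))
      _ _ _ _).symm.trans ?_
    refine (congrArg (A.map _) (α.arr_comp ⟨f s.1, s.2⟩ ⟨f t.1, t.2⟩ ⟨f u.1, u.2⟩
      (f.monotone h) (f.monotone h'))).trans ?_
    exact congrArg (fun φ => A.map φ _) (finMap_union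
      (mem_inner_union (cut := f ⁻¹' σ.cut) t.2 h h') inner_lt
      (mem_inner_union (cut := σ.cut) (t := f t.1) t.2 (f.monotone h) (f.monotone h')) inner_lt
      f _ _ _ _ _).symm

/-- The restriction of a word. -/
def pull {A : AugCat.{u} k} {m n : ℕ} {a b a' b' : A.Obj} (f : Fin (m + 1) →o Fin (n + 1))
    {σ : Shape A n a b} (α : Arr σ) (h₀ : f 0 ∈ σ.cut) (h₁ : f (Fin.last m) ∈ σ.cut)
    (ha : σ.vert ⟨f 0, h₀⟩ = a') (hb : σ.vert ⟨f (Fin.last m), h₁⟩ = b') : tmod A m a' b' :=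
  word (pullShape f σ h₀ h₁ ha hb) (pullArr f α h₀ h₁ ha hb)

lemma pullArr_comp {A : AugCat.{u} k} {l m n : ℕ} {a b a' b' a'' b'' : A.Obj}
    (g : Fin (m + 1) →o Fin (n + 1)) (f : Fin (l + 1) →o Fin (m + 1))
    {σ : Shape A n a b} (α : Arr σ) (h₀ : g 0 ∈ σ.cut) (h₁ : g (Fin.last m) ∈ σ.cut)
    (ha : σ.vert ⟨g 0, h₀⟩ = a') (hb : σ.vert ⟨g (Fin.last m), h₁⟩ = b')
    (h₀' : g (f 0) ∈ σ.cut) (h₁' : g (f (Fin.last l)) ∈ σ.cut)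
    (ha' : σ.vert ⟨g (f 0), h₀'⟩ = a'') (hb' : σ.vert ⟨g (f (Fin.last l)), h₁'⟩ = b'') :
    pullArr (a' := a'') (b' := b'') f (pullArr g α h₀ h₁ ha hb) h₀' h₁' ha' hb' =
      pullArr (g.comp f) α h₀' h₁' ha' hb' := by
  refine Arr.ext' fun s t hst => ?_
  refine (A.map_comp _ _ _).symm.trans ?_
  exact congrArg (fun φ => A.map φ _) (finMap_comp _ _ _ _ _ _ _ _).symm

lemma pull_congr {A : AugCat.{u} k} {m n : ℕ} {a b a' b' : A.Obj}
    {f f' : Fin (m + 1) →o Fin (n + 1)} (hf : f = f')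
    {σ : Shape A n a b} (α : Arr σ) {h₀ h₁ ha hb h₀' h₁' ha' hb'} :
    pull (a' := a') (b' := b') f α h₀ h₁ ha hb = pull f' α h₀' h₁' ha' hb' := by
  subst hf
  rfl

/-- Restriction is functorial. -/
lemma pull_pull {A : AugCat.{u} k} {l m n : ℕ} {a b a' b' a'' b'' : A.Obj}
    (g : Fin (m + 1) →o Fin (n + 1)) (f : Fin (l + 1) →o Fin (m + 1))
    (χ : Fin (l + 1) →o Fin (n + 1)) (hχ : g.comp f = χ)
    {σ : Shape A n a b} (α : Arr σ) (h₀ : g 0 ∈ σ.cut) (h₁ : g (Fin.last m) ∈ σ.cut)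
    (ha : σ.vert ⟨g 0, h₀⟩ = a') (hb : σ.vert ⟨g (Fin.last m), h₁⟩ = b') {h₀' h₁' ha' hb'}
    {h₀'' h₁'' ha'' hb''} :
    pull (a' := a'') (b' := b'') f (pullArr g α h₀ h₁ ha hb) h₀' h₁' ha' hb' =
      pull χ α h₀'' h₁'' ha'' hb'' := by
  subst hχ
  exact congrArg (word _) (pullArr_comp g f α h₀ h₁ ha hb h₀' h₁' ha' hb')

lemma pull_pull' {A : AugCat.{u} k} {l m m' n : ℕ} {a b a' b' c c' a'' b'' : A.Obj}
    {g : Fin (m + 1) →o Fin (n + 1)} {f : Fin (l + 1) →o Fin (m + 1)}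
    {g' : Fin (m' + 1) →o Fin (n + 1)} {f' : Fin (l + 1) →o Fin (m' + 1)}
    (hχ : g.comp f = g'.comp f') {σ : Shape A n a b} (α : Arr σ)
    {h₀ h₁ ha hb h₀' h₁' ha' hb' i₀ i₁ ia ib i₀' i₁' ia' ib'} :
    pull (a' := a'') (b' := b'') f (pullArr (a' := a') (b' := b') g α h₀ h₁ ha hb) h₀' h₁' ha' hb' =
      pull f' (pullArr (a' := c) (b' := c') g' α i₀ i₁ ia ib) i₀' i₁' ia' ib' :=
  (pull_pull g f _ hχ α h₀ h₁ ha hb (h₀'' := i₀') (h₁'' := i₁') (ha'' := ia') (hb'' := ib')).trans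
    (pull_pull g' f' _ rfl α i₀ i₁ ia ib).symm

lemma pull_id {A : AugCat.{u} k} {n : ℕ} {a b : A.Obj} {f : Fin (n + 1) →o Fin (n + 1)}
    (hf : f = OrderHom.id) {σ : Shape A n a b} (α : Arr σ) {h₀ h₁ ha hb} :
    pull (a' := a) (b' := b) f α h₀ h₁ ha hb = word σ α := by
  subst hf
  refine congrArg (word σ) (Arr.ext' fun s t hst => ?_)
  refine (congrArg (fun φ => A.map φ _) (finMap_id _ _)).trans ?_
  exact A.map_id _

/-- A multilinearity relation restricts to a multilinearity relation. -/
lemma IsLin.pull {A : AugCat.{u} k} {m n : ℕ} {a b a' b' : A.Obj}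
    (f : Fin (m + 1) →o Fin (n + 1)) {σ : Shape A n a b} {g : Fin n} {r r' : k}
    {α α₁ α₂ : Arr σ} (h : IsLin g r r' α α₁ α₂) (h₀ : f 0 ∈ σ.cut)
    (h₁ : f (Fin.last m) ∈ σ.cut) (ha : σ.vert ⟨f 0, h₀⟩ = a')
    (hb : σ.vert ⟨f (Fin.last m), h₁⟩ = b') (g' : Fin m)
    (hg : (f g'.castSucc).1 ≤ g.1) (hg' : g.1 < (f g'.succ).1) :
    IsLin g' r r' (pullArr f α h₀ h₁ ha hb) (pullArr f α₁ h₀ h₁ ha hb)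
      (pullArr f α₂ h₀ h₁ ha hb) := by
  intro s t hst
  obtain ⟨H, H'⟩ := h ⟨f s.1, s.2⟩ ⟨f t.1, t.2⟩ (f.monotone hst)
  have hs : s.1.1 ≤ g'.1 ↔ (f s.1).1 ≤ g.1 := by
    constructor
    · intro h
      exact (Fin.le_def.1 (f.monotone (show s.1 ≤ g'.castSucc from h))).trans hg
    · intro h
      by_contra hc
      have := Fin.le_def.1 (f.monotone (show g'.succ ≤ s.1 from Nat.lt_of_not_le hc))
      omega
  have ht : g'.1 < t.1.1 ↔ g.1 < (f t.1).1 := by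
    constructor
    · intro h
      exact hg'.trans_le (Fin.le_def.1 (f.monotone (show g'.succ ≤ t.1 from h)))
    · intro h
      by_contra hc
      have := Fin.le_def.1 (f.monotone (show t.1 ≤ g'.castSucc from Nat.le_of_not_lt hc))
      omega
  rw [hs, ht]
  refine ⟨fun hc => ?_, fun hc => ?_⟩
  · refine (congrArg (A.map _) (H hc)).trans ?_
    rw [map_add, map_smul, map_smul]
    rfl
  · exact ⟨congrArg (A.map _) (H' hc).1, congrArg (A.map _) (H' hc).2⟩

lemma IsLin.pull_eq {A : AugCat.{u} k} {m n : ℕ} {a b a' b' : A.Obj}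
    (f : Fin (m + 1) →o Fin (n + 1)) {σ : Shape A n a b} {g : Fin n} {r r' : k}
    {α α₁ α₂ : Arr σ} (h : IsLin g r r' α α₁ α₂) (h₀ : f 0 ∈ σ.cut)
    (h₁ : f (Fin.last m) ∈ σ.cut) (ha : σ.vert ⟨f 0, h₀⟩ = a')
    (hb : σ.vert ⟨f (Fin.last m), h₁⟩ = b')
    (hg : ¬ ((f 0).1 ≤ g.1 ∧ g.1 < (f (Fin.last m)).1)) :
    pullArr f α₁ h₀ h₁ ha hb = pullArr f α h₀ h₁ ha hb ∧
      pullArr f α₂ h₀ h₁ ha hb = pullArr f α h₀ h₁ ha hb := by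
  have key : ∀ (s t : (pullShape f σ h₀ h₁ ha hb).cut),
      ¬ ((f s.1).1 ≤ g.1 ∧ g.1 < (f t.1).1) := by
    intro s t hc
    have e₁ := Fin.le_def.1 (f.monotone (Fin.zero_le s.1))
    have e₂ := Fin.le_def.1 (f.monotone (Fin.le_last t.1))
    omega
  constructor <;> refine Arr.ext' fun s t hst => congrArg (A.map _) ?_
  · exact ((h ⟨f s.1, s.2⟩ ⟨f t.1, t.2⟩ (f.monotone hst)).2 (key s t)).1
  · exact ((h ⟨f s.1, s.2⟩ ⟨f t.1, t.2⟩ (f.monotone hst)).2 (key s t)).2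

lemma exists_step {m n : ℕ} (f : Fin (m + 1) →o Fin (n + 1)) (g : ℕ) (h₀ : (f 0).1 ≤ g)
    (h₁ : g < (f (Fin.last m)).1) :
    ∃ g' : Fin m, (f g'.castSucc).1 ≤ g ∧ g < (f g'.succ).1 := by
  by_contra hc
  push Not at hc
  have : ∀ i : Fin (m + 1), (f i).1 ≤ g := by
    intro i
    induction i using Fin.induction with
    | zero => exact h₀
    | succ i ih => exact hc i ih
  exact absurd (this (Fin.last m)) (by omega)

lemma pull_lin {A : AugCat.{u} k} {m n : ℕ} {a b a' b' : A.Obj}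
    (f : Fin (m + 1) →o Fin (n + 1)) {σ : Shape A n a b} {g : Fin n} {r r' : k}
    {α α₁ α₂ : Arr σ} (h : IsLin g r r' α α₁ α₂) (h₀ : f 0 ∈ σ.cut)
    (h₁ : f (Fin.last m) ∈ σ.cut) (ha : σ.vert ⟨f 0, h₀⟩ = a')
    (hb : σ.vert ⟨f (Fin.last m), h₁⟩ = b')
    (hg : (f 0).1 ≤ g.1 ∧ g.1 < (f (Fin.last m)).1) :
    pull f α h₀ h₁ ha hb = r • pull f α₁ h₀ h₁ ha hb + r' • pull f α₂ h₀ h₁ ha hb := by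
  obtain ⟨g', hg₁, hg₂⟩ := exists_step f g.1 hg.1 hg.2
  exact word_lin (h.pull f h₀ h₁ ha hb g' hg₁ hg₂)

/-! ### The structure maps -/

lemma Shape.vert_eq {A : AugCat.{u} k} {n : ℕ} {a b : A.Obj} (σ : Shape A n a b)
    {s t : Fin (n + 1)} (h : s = t) (hs : s ∈ σ.cut) (ht : t ∈ σ.cut) :
    σ.vert ⟨s, hs⟩ = σ.vert ⟨t, ht⟩ := by
  subst h
  rfl

lemma FinInt.zero_mem {A : AugCat.{u} k} {m n : ℕ} (f : FinInt m n) {a b : A.Obj}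
    (σ : Shape A n a b) : f.toHom 0 ∈ σ.cut := by
  rw [f.map_zero]
  exact σ.zero_mem

lemma FinInt.last_mem {A : AugCat.{u} k} {m n : ℕ} (f : FinInt m n) {a b : A.Obj}
    (σ : Shape A n a b) : f.toHom (Fin.last m) ∈ σ.cut := by
  rw [f.map_last]
  exact σ.last_mem

lemma Shape.left_zero {A : AugCat.{u} k} {p q n : ℕ} (h : p + q = n) {a b : A.Obj}
    (σ : Shape A n a b) : leftSeg h 0 ∈ σ.cut :=
  σ.zero_mem

lemma Shape.right_last {A : AugCat.{u} k} {p q n : ℕ} (h : p + q = n) {a b : A.Obj}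
    (σ : Shape A n a b) : rightSeg h (Fin.last q) ∈ σ.cut := by
  rw [rightSeg_last]
  exact σ.last_mem

lemma Shape.vert_left {A : AugCat.{u} k} {p q n : ℕ} (h : p + q = n) {a b : A.Obj}
    (σ : Shape A n a b) : σ.vert ⟨leftSeg h 0, σ.left_zero h⟩ = a :=
  σ.vert_zero

lemma Shape.vert_right {A : AugCat.{u} k} {p q n : ℕ} (h : p + q = n) {a b : A.Obj}
    (σ : Shape A n a b) : σ.vert ⟨rightSeg h (Fin.last q), σ.right_last h⟩ = b :=
  (σ.vert_eq (rightSeg_last h) _ _).trans σ.vert_last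

/-- The simplicial operators: restriction of words. -/
def tMap (A : AugCat.{u} k) {m n : ℕ} (f : FinInt m n) (a b : A.Obj) :
    tmod A n a b →ₗ[k] tmod A m a b :=
  tlift (fun σ α => pull f.toHom α (f.zero_mem σ) (f.last_mem σ)
      ((σ.vert_eq f.map_zero _ _).trans σ.vert_zero) ((σ.vert_eq f.map_last _ _).trans σ.vert_last))
    (fun σ g r r' α α₁ α₂ h => pull_lin f.toHom h _ _ _ _ (by
      rw [f.map_zero, f.map_last]
      exact ⟨Nat.zero_le _, g.2⟩))

lemma tMap_word {A : AugCat.{u} k} {m n : ℕ} (f : FinInt m n) {a b : A.Obj} (σ : Shape A n a b)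
    (α : Arr σ) :
    tMap A f a b (word σ α) = pull f.toHom α (f.zero_mem σ) (f.last_mem σ)
      ((σ.vert_eq f.map_zero _ _).trans σ.vert_zero)
      ((σ.vert_eq f.map_last _ _).trans σ.vert_last) :=
  tlift_word _ _ _ _

open Classical in
/-- The value of the comultiplication on a word: the word is cut at the vertex `p` if `p` belongs
to `cut`, and is sent to zero otherwise. -/
def tComulFun {A : AugCat.{u} k} {p q n : ℕ} (h : p + q = n) {a b : A.Obj} (σ : Shape A n a b)
    (α : Arr σ) : qtensor (tmod A p) (tmod A q) a b :=
  if hp : leftSeg h (Fin.last p) ∈ σ.cut then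
    qincl (tmod A p) (tmod A q) a b (σ.vert ⟨leftSeg h (Fin.last p), hp⟩)
      (pull (leftSeg h) α (σ.left_zero h) hp (σ.vert_left h) rfl ⊗ₜ
        pull (rightSeg h) α hp (σ.right_last h) rfl (σ.vert_right h))
  else 0

lemma tmul_lin_left {M N : Type u} [AddCommGroup M] [AddCommGroup N] [Module k M] [Module k N]
    {r r' : k} {x x₁ x₂ : M} {y y₁ y₂ : N} (hx : x = r • x₁ + r' • x₂) (h₁ : y₁ = y)
    (h₂ : y₂ = y) : x ⊗ₜ[k] y = r • x₁ ⊗ₜ[k] y₁ + r' • x₂ ⊗ₜ[k] y₂ := by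
  rw [h₁, h₂, hx, TensorProduct.add_tmul, TensorProduct.smul_tmul', TensorProduct.smul_tmul']

lemma tmul_lin_right {M N : Type u} [AddCommGroup M] [AddCommGroup N] [Module k M] [Module k N]
    {r r' : k} {x x₁ x₂ : M} {y y₁ y₂ : N} (hy : y = r • y₁ + r' • y₂) (h₁ : x₁ = x)
    (h₂ : x₂ = x) : x ⊗ₜ[k] y = r • x₁ ⊗ₜ[k] y₁ + r' • x₂ ⊗ₜ[k] y₂ := by
  rw [h₁, h₂, hy, TensorProduct.tmul_add, TensorProduct.tmul_smul, TensorProduct.tmul_smul]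

lemma tComulFun_multilin {A : AugCat.{u} k} {p q n : ℕ} (h : p + q = n) {a b : A.Obj} :
    Multilin (fun (σ : Shape A n a b) α => tComulFun h σ α) := by
  intro σ g r r' α α₁ α₂ hl
  by_cases hp : leftSeg h (Fin.last p) ∈ σ.cut
  · simp only [tComulFun, dif_pos hp]
    rw [← map_smul, ← map_smul, ← map_add]
    congr 1
    by_cases hg : g.1 < p
    · have e := hl.pull_eq (rightSeg h) hp (σ.right_last h) rfl (σ.vert_right h) (by
          change ¬ (p + 0 ≤ g.1 ∧ _)
          omega)
      have e₁ := congrArg (word _) e.1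
      have e₂ := congrArg (word _) e.2
      have e₃ := pull_lin (leftSeg h) hl (σ.left_zero h) hp (σ.vert_left h) rfl
        ⟨Nat.zero_le _, hg⟩
      exact tmul_lin_left e₃ e₁ e₂
    · have e := hl.pull_eq (leftSeg h) (σ.left_zero h) hp (σ.vert_left h) rfl (by
          change ¬ (_ ∧ g.1 < p)
          omega)
      have e₁ := congrArg (word _) e.1
      have e₂ := congrArg (word _) e.2
      have e₃ := pull_lin (rightSeg h) hl hp (σ.right_last h) rfl (σ.vert_right h)
        ⟨Nat.not_lt.1 hg, by
          rw [rightSeg_last]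
          exact g.2⟩
      exact tmul_lin_right e₃ e₁ e₂
  · simp only [tComulFun, dif_neg hp, smul_zero, add_zero]

/-- The comultiplication. -/
def tComul (A : AugCat.{u} k) {p q n : ℕ} (h : p + q = n) (a b : A.Obj) :
    tmod A n a b →ₗ[k] qtensor (tmod A p) (tmod A q) a b :=
  tlift (fun σ α => tComulFun h σ α) (tComulFun_multilin h)

lemma tComul_word_of_mem {A : AugCat.{u} k} {p q n : ℕ} (h : p + q = n) {a b : A.Obj}
    (σ : Shape A n a b) (α : Arr σ) (hp : leftSeg h (Fin.last p) ∈ σ.cut) (c : A.Obj)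
    (hc : σ.vert ⟨leftSeg h (Fin.last p), hp⟩ = c) :
    tComul A h a b (word σ α) = qincl (tmod A p) (tmod A q) a b c
      (pull (leftSeg h) α (σ.left_zero h) hp (σ.vert_left h) hc ⊗ₜ
        pull (rightSeg h) α hp (σ.right_last h) hc (σ.vert_right h)) := by
  subst hc
  rw [tComul, tlift_word, tComulFun, dif_pos hp]

lemma tComul_word_of_notMem {A : AugCat.{u} k} {p q n : ℕ} (h : p + q = n) {a b : A.Obj}
    (σ : Shape A n a b) (α : Arr σ) (hp : leftSeg h (Fin.last p) ∉ σ.cut) :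
    tComul A h a b (word σ α) = 0 := by
  rw [tComul, tlift_word, tComulFun, dif_neg hp]

/-- The counit. -/
def tCounit (A : AugCat.{u} k) (a b : A.Obj) : tmod A 0 a b →ₗ[k] qunit k A.Obj a b :=
  tlift (fun σ _ => Finsupp.single ⟨σ.vert_zero.symm.trans σ.vert_last⟩ 1)
    (fun _ g => g.elim0)

lemma tCounit_pull {A : AugCat.{u} k} {n : ℕ} {a b a' b' : A.Obj}
    (f : Fin (0 + 1) →o Fin (n + 1)) {σ : Shape A n a b} (α : Arr σ) {h₀ h₁ ha hb}
    (h : PLift (a' = b')) :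
    tCounit A a' b' (pull f α h₀ h₁ ha hb) = Finsupp.single h 1 :=
  tlift_word _ _ _ _

lemma tCounit_word {A : AugCat.{u} k} {a b : A.Obj} (σ : Shape A 0 a b) (α : Arr σ)
    (h : PLift (a = b)) : tCounit A a b (word σ α) = Finsupp.single h 1 :=
  tlift_word _ _ _ _

/-- The unique shape of length `0`. -/
def zeroShape (A : AugCat.{u} k) (a : A.Obj) : Shape A 0 a a where
  cut := Set.univ
  zero_mem := trivial
  last_mem := trivial
  vert _ := a
  vert_zero := rfl
  vert_last := rfl

/-- The unique tuple of length `0`. -/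
def zeroArr (A : AugCat.{u} k) (a : A.Obj) : Arr (zeroShape A a) where
  arr s t _ := A.one' a (Finset.card_eq_zero.2 (Finset.eq_empty_iff_forall_notMem.2 fun _ hu =>
    (mem_inner.1 hu).2.2 trivial))
  arr_self _ := rfl
  arr_comp s t u h h' := by
    have key : ∀ {p q n : ℕ} (h : p + q = n) (hp : p = 0) (hq : q = 0) (hn : n = 0),
        A.comp h (A.one' a hp) (A.one' a hq) = A.one' a hn := by
      intro p q n h hp hq hn
      subst hp hq hn
      exact A.one_comp _ rfl _
    exact key _ _ _ _

lemma word_zero {A : AugCat.{u} k} {a : A.Obj} (σ : Shape A 0 a a) (α : Arr σ) :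
    word σ α = word (zeroShape A a) (zeroArr A a) := by
  obtain rfl : σ = zeroShape A a := by
    obtain ⟨cut, h₀, h₁, vert, hv, hv'⟩ := σ
    obtain rfl : cut = Set.univ := by
      ext i
      rw [Subsingleton.elim (α := Fin 1) i 0]
      exact ⟨fun _ => trivial, fun _ => h₀⟩
    obtain rfl : vert = fun _ => a := by
      funext ⟨i, hi⟩
      rw [← hv]
      congr 1
      exact Subtype.ext (Subsingleton.elim (α := Fin 1) _ _)
    rfl
  congr 1
  refine Arr.ext' fun s t hst => ?_
  obtain rfl : s = t := Subtype.ext (Subsingleton.elim (α := Fin 1) _ _)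
  exact (α.arr_self s).trans ((zeroArr A a).arr_self s).symm

lemma tCounit_bijective (A : AugCat.{u} k) (a b : A.Obj) :
    Function.Bijective (tCounit A a b) := by
  by_cases hab : a = b
  · subst hab
    rw [Function.bijective_iff_has_inverse]
    let inv : qunit k A.Obj a a →ₗ[k] tmod A 0 a a :=
      Finsupp.linearCombination k fun _ => word (zeroShape A a) (zeroArr A a)
    have hinv : ∀ h, inv (Finsupp.single h 1) = word (zeroShape A a) (zeroArr A a) := fun h =>
      (Finsupp.linearCombination_single k 1 h).trans (one_smul k _)
    refine ⟨inv, fun x => ?_, fun y => ?_⟩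
    · refine text (f := inv ∘ₗ tCounit A a a) (g := LinearMap.id) (fun σ α => ?_) x
      rw [LinearMap.comp_apply, tCounit_word σ α ⟨rfl⟩, hinv]
      exact (word_zero σ α).symm
    · have : tCounit A a a ∘ₗ inv = LinearMap.id := by
        refine Finsupp.lhom_ext' fun h => LinearMap.ext_ring ?_
        change tCounit A a a (inv (Finsupp.single h 1)) = Finsupp.single h 1
        rw [hinv, tCounit_word]
      exact LinearMap.congr_fun this y
  · constructor
    · intro x y _
      have : ∀ z : tmod A 0 a b, z = 0 := fun z =>
        text (f := LinearMap.id) (g := 0)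
          (fun σ _ => absurd (σ.vert_zero.symm.trans σ.vert_last) hab) z
      rw [this x, this y]
    · intro y
      refine ⟨0, ?_⟩
      rw [map_zero]
      ext h
      exact absurd h.down hab

lemma tComul_coassoc {A : AugCat.{u} k} {p q r pq qr n : ℕ} (h₁ : p + q = pq) (h₂ : q + r = qr)
    (h₃ : pq + r = n) (h₄ : p + qr = n) {a b : A.Obj} (σ : Shape A n a b) (α : Arr σ) :
    qassoc (tmod A p) (tmod A q) (tmod A r) a b
        (qmap (fun c => c) (tComul A h₁) (fun _ _ => LinearMap.id) a b
          (tComul A h₃ a b (word σ α))) =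
      qmap (fun c => c) (fun _ _ => LinearMap.id) (tComul A h₂) a b
        (tComul A h₄ a b (word σ α)) := by
  by_cases hq : leftSeg h₃ (Fin.last pq) ∈ σ.cut
  · have e₃ := tComul_word_of_mem h₃ σ α hq _ rfl
    refine (congrArg (qassoc _ _ _ a b) ((congrArg (qmap (fun c => c) (tComul A h₁)
      (fun _ _ => LinearMap.id) a b) e₃).trans (qmap_qincl (fun c => c) (tComul A h₁)
      (fun _ _ => LinearMap.id) a b _ _ _))).trans ?_
    by_cases hp : leftSeg h₄ (Fin.last p) ∈ σ.cut
    · have e₄ := tComul_word_of_mem h₄ σ α hp _ rfl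
      refine Eq.trans ?_ ((congrArg (qmap (fun c => c) (fun _ _ => LinearMap.id)
        (tComul A h₂) a b) e₄).trans (qmap_qincl (fun c => c) (fun _ _ => LinearMap.id)
        (tComul A h₂) a b _ _ _)).symm
      have e' : (rightSeg h₄).comp (rightSeg h₂) = rightSeg h₃ :=
        OrderHom.ext _ _ (funext fun i => Fin.ext (by
          change p + (q + i.1) = pq + i.1
          omega))
      have e : rightSeg h₄ (leftSeg h₂ (Fin.last q)) = leftSeg h₃ (Fin.last pq) := Fin.ext h₁
      have e₁ := tComul_word_of_mem h₁ (pullShape (leftSeg h₃) σ _ hq (σ.vert_left h₃) rfl)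
        (pullArr (leftSeg h₃) α (σ.left_zero h₃) hq (σ.vert_left h₃) rfl) hp _ rfl
      have e₂ := tComul_word_of_mem h₂
        (pullShape (rightSeg h₄) σ hp (σ.right_last h₄) rfl (σ.vert_right h₄))
        (pullArr (rightSeg h₄) α hp (σ.right_last h₄) rfl (σ.vert_right h₄))
        (by change rightSeg h₄ (leftSeg h₂ (Fin.last q)) ∈ σ.cut; rw [e]; exact hq) _
        (σ.vert_eq e _ hq)
      refine (congrArg (fun x => qassoc (tmod A p) (tmod A q) (tmod A r) a b
        (qincl _ _ a b _ (x ⊗ₜ _))) e₁).trans ?_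
      refine (qassoc_qincl _ _ _ _ _ _ _ _ _ _).trans ?_
      refine Eq.trans ?_ (congrArg (fun x => qincl (tmod A p)
        (qtensor (tmod A q) (tmod A r)) a b _ (_ ⊗ₜ x)) e₂).symm
      refine congrArg (qincl _ _ a b _) (congrArg₂ (fun x y => x ⊗ₜ y) ?_
        (congrArg (qincl _ _ _ b _) (congrArg₂ (fun x y => x ⊗ₜ y) ?_ ?_)))
      · exact pull_pull (leftSeg h₃) (leftSeg h₁) (leftSeg h₄) rfl α _ _ _ _
      · exact pull_pull' (g := leftSeg h₃) (f := rightSeg h₁) (g' := rightSeg h₄)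
          (f' := leftSeg h₂) rfl α
      · exact (pull_pull (rightSeg h₄) (rightSeg h₂) (rightSeg h₃) e' α _ _ _ _).symm
    · have e₁ := tComul_word_of_notMem h₁ (pullShape (leftSeg h₃) σ _ hq (σ.vert_left h₃) rfl)
        (pullArr (leftSeg h₃) α (σ.left_zero h₃) hq (σ.vert_left h₃) rfl) hp
      have e₄ := tComul_word_of_notMem h₄ σ α hp
      refine Eq.trans ?_ (congrArg (qmap (fun c => c) (fun _ _ => LinearMap.id)
        (tComul A h₂) a b) e₄).symm
      refine (congrArg (fun x => qassoc (tmod A p) (tmod A q) (tmod A r) a b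
        (qincl _ _ a b _ (x ⊗ₜ _))) e₁).trans ?_
      simp only [TensorProduct.zero_tmul, map_zero]
  · have e₃ := tComul_word_of_notMem h₃ σ α hq
    refine (congrArg (fun x => qassoc _ _ _ a b (qmap (fun c => c) (tComul A h₁)
      (fun _ _ => LinearMap.id) a b x)) e₃).trans ?_
    by_cases hp : leftSeg h₄ (Fin.last p) ∈ σ.cut
    · have e₄ := tComul_word_of_mem h₄ σ α hp _ rfl
      refine Eq.trans ?_ ((congrArg (qmap (fun c => c) (fun _ _ => LinearMap.id)
        (tComul A h₂) a b) e₄).trans (qmap_qincl (fun c => c) (fun _ _ => LinearMap.id)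
        (tComul A h₂) a b _ _ _)).symm
      have e : rightSeg h₄ (leftSeg h₂ (Fin.last q)) = leftSeg h₃ (Fin.last pq) := Fin.ext h₁
      have e₂ := tComul_word_of_notMem h₂
        (pullShape (rightSeg h₄) σ hp (σ.right_last h₄) rfl (σ.vert_right h₄))
        (pullArr (rightSeg h₄) α hp (σ.right_last h₄) rfl (σ.vert_right h₄))
        (by change rightSeg h₄ (leftSeg h₂ (Fin.last q)) ∉ σ.cut; rw [e]; exact hq)
      refine Eq.trans ?_ (congrArg (fun x => qincl (tmod A p)
        (qtensor (tmod A q) (tmod A r)) a b _ (_ ⊗ₜ x)) e₂).symm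
      exact ((congrArg (qincl (tmod A p) (qtensor (tmod A q) (tmod A r)) a b _)
        (TensorProduct.tmul_zero _ _)).trans (map_zero _)).symm
    · have e₄ := tComul_word_of_notMem h₄ σ α hp
      refine Eq.trans ?_ (congrArg (qmap (fun c => c) (fun _ _ => LinearMap.id)
        (tComul A h₂) a b) e₄).symm
      simp only [map_zero]

/-- The templicial module of a category `A` enriched in augmented simplicial modules:
its module of `n`-simplices from `a` to `b` is the direct sum of the modules
`A(x_0, x_1)_{[i_1 - i_0 - 2]} ⊗ ⋯ ⊗ A(x_{m-1}, x_m)_{[i_m - i_{m-1} - 2]}` over all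
`{0 = i_0 < … < i_m = n} ⊆ [n]` and all objects `a = x_0, …, x_m = b`. -/
def tObj (A : AugCat.{u} k) : TemplicialModule.{u} k where
  Base := A.Obj
  obj n := tmod A n
  map f := tMap A f
  map_id {n a b} x := text (f := tMap A _ a b) (g := LinearMap.id) (fun σ α =>
    (tMap_word _ σ α).trans (pull_id rfl α)) x
  map_comp {l m n} g f {a b} x := text (f := tMap A _ a b) (g := tMap A f a b ∘ₗ tMap A g a b)
    (fun σ α => by
      refine (tMap_word (g.comp f) σ α).trans ?_
      refine Eq.trans ?_ (congrArg (tMap A f a b) (tMap_word g σ α)).symm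
      refine Eq.trans ?_ (tMap_word f _ _).symm
      exact (pull_pull _ _ _ rfl _ _ _ _ _).symm) x
  comul h := tComul A h
  counit := tCounit A
  comul_map {_ _ _ _ _ _} h h' f g {a b} x :=
    text (f := tComul A h a b ∘ₗ tMap A _ a b)
      (g := qmap (fun c => c) (tMap A f) (tMap A g) a b ∘ₗ tComul A h' a b) (fun σ α => by
      have e : (FinInt.sum h h' f g).toHom (leftSeg h (Fin.last _)) = leftSeg h' (Fin.last _) :=
        (DFunLike.congr_fun (FinInt.sum_left h h' f g) _).trans (congrArg (leftSeg h') f.map_last)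
      refine (congrArg (tComul A h a b) (tMap_word _ σ α)).trans ?_
      by_cases hp : leftSeg h' (Fin.last _) ∈ σ.cut
      · refine (tComul_word_of_mem h _ _ (by rw [← e] at hp; exact hp) _
          (σ.vert_eq e _ hp)).trans ?_
        refine Eq.trans ?_ (congrArg (qmap (fun c => c) (tMap A f) (tMap A g) a b)
          (tComul_word_of_mem h' σ α hp _ rfl)).symm
        refine Eq.trans ?_ (qmap_qincl (fun c => c) (tMap A f) (tMap A g) a b _ _ _).symm
        refine congrArg (qincl _ _ a b _) (congrArg₂ (fun x y => x ⊗ₜ y) ?_ ?_)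
        · exact (pull_pull' (FinInt.sum_left h h' f g) α).trans (tMap_word f _ _).symm
        · exact (pull_pull' (FinInt.sum_right h h' f g) α).trans (tMap_word g _ _).symm
      · refine (tComul_word_of_notMem h _ _ (by rw [← e] at hp; exact hp)).trans ?_
        refine Eq.trans ?_ (congrArg (qmap (fun c => c) (tMap A f) (tMap A g) a b)
          (tComul_word_of_notMem h' σ α hp)).symm
        exact (map_zero _).symm) x
  coassoc {p q r pq qr n} h₁ h₂ h₃ h₄ {a b} x :=
    text (f := qassoc _ _ _ a b ∘ₗ
        qmap (fun c => c) (tComul A h₁) (fun _ _ => LinearMap.id) a b ∘ₗ tComul A h₃ a b)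
      (g := qmap (fun c => c) (fun _ _ => LinearMap.id) (tComul A h₂) a b ∘ₗ tComul A h₄ a b)
      (tComul_coassoc h₁ h₂ h₃ h₄) x
  counit_left {n a b} x :=
    text (f := qleftUnit _ a b ∘ₗ
        qmap (fun c => c) (tCounit A) (fun _ _ => LinearMap.id) a b ∘ₗ tComul A _ a b)
      (g := LinearMap.id) (fun σ α => by
      have e₁ := tComul_word_of_mem (zero_add n) σ α (σ.zero_mem) a σ.vert_zero
      refine (congrArg (qleftUnit (tmod A n) a b) ((congrArg
        (qmap (fun c => c) (tCounit A) (fun _ _ => LinearMap.id) a b) e₁).trans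
          (qmap_qincl _ _ _ _ _ _ _ _))).trans ?_
      refine (congrArg (fun x => qleftUnit (tmod A n) a b (qincl (qunit k A.Obj) (tmod A n) a b a
        (x ⊗ₜ _))) (tCounit_pull (leftSeg (zero_add n)) α ⟨rfl⟩)).trans ?_
      refine (qleftUnit_qincl _ _ _ _ _).trans ?_
      exact pull_id (OrderHom.ext _ _ (funext fun i => Fin.ext (zero_add _))) α) x
  counit_right {n a b} x :=
    text (f := qrightUnit _ a b ∘ₗ
        qmap (fun c => c) (fun _ _ => LinearMap.id) (tCounit A) a b ∘ₗ tComul A _ a b)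
      (g := LinearMap.id) (fun σ α => by
      have e₁ := tComul_word_of_mem (add_zero n) σ α (σ.last_mem) b σ.vert_last
      refine (congrArg (qrightUnit (tmod A n) a b) ((congrArg
        (qmap (fun c => c) (fun _ _ => LinearMap.id) (tCounit A) a b) e₁).trans
          (qmap_qincl _ _ _ _ _ _ _ _))).trans ?_
      refine (congrArg (fun x => qrightUnit (tmod A n) a b (qincl (tmod A n) (qunit k A.Obj) a b b
        (_ ⊗ₜ x))) (tCounit_pull (rightSeg (add_zero n)) α ⟨rfl⟩)).trans ?_
      refine (qrightUnit_qincl _ _ _ _ _).trans ?_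
      exact pull_id rfl α) x
  counit_bijective := tCounit_bijective A

end Words

noncomputable section WordsFunctor

variable {k : Type u} [CommRing k]

/-- The image of a shape under an enriched functor. -/
def mapShape {A B : AugCat.{u} k} (H : A.Functor B) {n : ℕ} {a b : A.Obj} (σ : Shape A n a b) :
    Shape B n (H.obj a) (H.obj b) where
  cut := σ.cut
  zero_mem := σ.zero_mem
  last_mem := σ.last_mem
  vert s := H.obj (σ.vert s)
  vert_zero := congrArg H.obj σ.vert_zero
  vert_last := congrArg H.obj σ.vert_last

lemma AugCat.Functor.map_one' {A B : AugCat.{u} k} (H : A.Functor B) (x : A.Obj) {n : ℕ}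
    (h : n = 0) : H.hom x x n (A.one' x h) = B.one' (H.obj x) h := by
  subst h
  exact H.map_one x

/-- The image of a tuple under an enriched functor. -/
def mapArr {A B : AugCat.{u} k} (H : A.Functor B) {n : ℕ} {a b : A.Obj} {σ : Shape A n a b}
    (α : Arr σ) : Arr (mapShape H σ) where
  arr s t h := H.hom _ _ _ (α.arr s t h)
  arr_self s := (congrArg _ (α.arr_self s)).trans (H.map_one' _ _)
  arr_comp s t u h h' := (H.map_comp _ _ _).symm.trans (congrArg _ (α.arr_comp s t u h h'))

lemma IsLin.map {A B : AugCat.{u} k} (H : A.Functor B) {n : ℕ} {a b : A.Obj}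
    {σ : Shape A n a b} {g : Fin n} {r r' : k} {α α₁ α₂ : Arr σ} (h : IsLin g r r' α α₁ α₂) :
    IsLin g r r' (mapArr H α) (mapArr H α₁) (mapArr H α₂) := by
  intro s t hst
  obtain ⟨h₁, h₂⟩ := h s t hst
  refine ⟨fun hc => ?_, fun hc => ⟨congrArg (H.hom _ _ _) (h₂ hc).1,
    congrArg (H.hom _ _ _) (h₂ hc).2⟩⟩
  refine (congrArg (H.hom _ _ _) (h₁ hc)).trans ?_
  rw [map_add, map_smul, map_smul]
  rfl

/-- The map on words induced by an enriched functor. -/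
def tApp {A B : AugCat.{u} k} (H : A.Functor B) (n : ℕ) (a b : A.Obj) :
    tmod A n a b →ₗ[k] tmod B n (H.obj a) (H.obj b) :=
  tlift (fun σ α => word (mapShape H σ) (mapArr H α))
    (fun _ _ _ _ _ _ _ h => word_lin (h.map H))

lemma tApp_word {A B : AugCat.{u} k} (H : A.Functor B) {n : ℕ} {a b : A.Obj} (σ : Shape A n a b)
    (α : Arr σ) : tApp H n a b (word σ α) = word (mapShape H σ) (mapArr H α) :=
  tlift_word _ _ _ _

lemma tApp_pull {A B : AugCat.{u} k} (H : A.Functor B) {m n : ℕ} {a b a' b' : A.Obj}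
    (f : Fin (m + 1) →o Fin (n + 1)) {σ : Shape A n a b} (α : Arr σ) (h₀ : f 0 ∈ σ.cut)
    (h₁ : f (Fin.last m) ∈ σ.cut) (ha : σ.vert ⟨f 0, h₀⟩ = a')
    (hb : σ.vert ⟨f (Fin.last m), h₁⟩ = b') :
    tApp H m a' b' (pull f α h₀ h₁ ha hb) =
      pull f (mapArr H α) h₀ h₁ (congrArg H.obj ha) (congrArg H.obj hb) := by
  refine (tApp_word H _ _).trans (congrArg (word _) (Arr.ext' fun s t hst => ?_))
  exact H.naturality _ _

lemma tApp_natural {A B : AugCat.{u} k} (H : A.Functor B) {m n : ℕ} (f : FinInt m n)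
    {a b : A.Obj} (x : tmod A n a b) :
    tApp H m a b (tMap A f a b x) = tMap B f _ _ (tApp H n a b x) :=
  text (f := tApp H m a b ∘ₗ tMap A f a b) (g := tMap B f _ _ ∘ₗ tApp H n a b) (fun σ α => by
    refine (congrArg (tApp H m a b) (tMap_word f σ α)).trans ?_
    refine (tApp_pull H _ _ _ _ _ _).trans ?_
    exact ((congrArg (tMap B f _ _) (tApp_word H σ α)).trans (tMap_word f _ _)).symm) x

lemma tApp_comul {A B : AugCat.{u} k} (H : A.Functor B) {p q n : ℕ} (h : p + q = n)
    {a b : A.Obj} (x : tmod A n a b) :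
    tComul B h _ _ (tApp H n a b x) =
      qmap H.obj (tApp H p) (tApp H q) a b (tComul A h a b x) :=
  text (f := tComul B h _ _ ∘ₗ tApp H n a b)
    (g := qmap H.obj (tApp H p) (tApp H q) a b ∘ₗ tComul A h a b) (fun σ α => by
    refine (congrArg (tComul B h _ _) (tApp_word H σ α)).trans ?_
    by_cases hp : leftSeg h (Fin.last p) ∈ σ.cut
    · refine (tComul_word_of_mem h (mapShape H σ) (mapArr H α) hp _ rfl).trans ?_
      refine Eq.trans ?_ ((congrArg (qmap H.obj (tApp H p) (tApp H q) a b)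
        (tComul_word_of_mem h σ α hp _ rfl)).trans
          (qmap_qincl H.obj (tApp H p) (tApp H q) a b _ _ _)).symm
      refine congrArg (qincl _ _ _ _ _) (congrArg₂ (fun x y => x ⊗ₜ y) ?_ ?_)
      · exact (tApp_pull H _ _ _ _ _ _).symm
      · exact (tApp_pull H _ _ _ _ _ _).symm
    · refine (tComul_word_of_notMem h (mapShape H σ) (mapArr H α) hp).trans ?_
      refine Eq.trans ?_ (congrArg (qmap H.obj (tApp H p) (tApp H q) a b)
        (tComul_word_of_notMem h σ α hp)).symm
      exact (map_zero _).symm) x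

lemma tApp_counit {A B : AugCat.{u} k} (H : A.Functor B) {a b : A.Obj} (x : tmod A 0 a b) :
    tCounit B _ _ (tApp H 0 a b x) = qunitMap H.obj a b (tCounit A a b x) :=
  text (f := tCounit B _ _ ∘ₗ tApp H 0 a b) (g := qunitMap H.obj a b ∘ₗ tCounit A a b)
    (fun σ α => by
    have e : a = b := σ.vert_zero.symm.trans σ.vert_last
    refine (congrArg (tCounit B _ _) (tApp_word H σ α)).trans ?_
    refine (tCounit_word _ _ ⟨congrArg H.obj e⟩).trans ?_
    refine Eq.trans ?_ (congrArg (qunitMap H.obj a b) (tCounit_word σ α ⟨e⟩)).symm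
    exact (qunitMap_single H.obj ⟨e⟩).symm) x

/-- The functor from categories enriched in augmented simplicial modules to templicial modules. -/
def tFunctor (k : Type u) [CommRing k] : AugCat.{u} k ⥤ TemplicialModule.{u} k where
  obj A := tObj A
  map {A B} H :=
    { base := AugCat.Functor.obj H
      app := tApp H
      naturality := tApp_natural H
      comul := tApp_comul H
      counit := tApp_counit H }
  map_id A := TemplicialModule.Hom.ext rfl (heq_of_eq (by
    funext n a b
    exact LinearMap.ext (text (f := tApp (𝟙 A) n a b) (g := LinearMap.id) fun σ α =>
      tApp_word _ σ α)))
  map_comp {A B C} H K := TemplicialModule.Hom.ext rfl (heq_of_eq (by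
    funext n a b
    refine LinearMap.ext (text (f := tApp (H ≫ K) n a b)
      (g := tApp K n _ _ ∘ₗ tApp H n a b) fun σ α => ?_)
    refine (tApp_word (H ≫ K) σ α).trans ?_
    exact ((congrArg (tApp K n _ _) (tApp_word H σ α)).trans (tApp_word K _ _)).symm))

end WordsFunctor

/-! ## The dg-nerve -/

noncomputable section Nerve

/-- A chain `src ≤ mid 0 ≤ ⋯ ≤ mid (m - 1) ≤ tgt` in `[n]`.  The strict chains are the subsets of
`[n]` with `m + 2` elements. -/
@[ext]
structure Chain (n m : ℕ) where
  src : Fin (n + 1)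
  tgt : Fin (n + 1)
  mid : Fin m →o Fin (n + 1)
  src_le_tgt : src ≤ tgt
  src_le : ∀ i, src ≤ mid i
  le_tgt : ∀ i, mid i ≤ tgt

namespace Chain

/-- All inequalities of the chain are strict. -/
def Strict {n m : ℕ} (σ : Chain n m) : Prop :=
  σ.src < σ.tgt ∧ StrictMono σ.mid ∧ (∀ i, σ.src < σ.mid i) ∧ ∀ i, σ.mid i < σ.tgt

/-- The chain `i ≤ i`. -/
def point {n : ℕ} (i : Fin (n + 1)) : Chain n 0 where
  src := i
  tgt := i
  mid := ⟨fun j => j.elim0, fun j => j.elim0⟩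
  src_le_tgt := le_rfl
  src_le := fun j => j.elim0
  le_tgt := fun j => j.elim0

/-- Removing `mid j`. -/
def drop {n m : ℕ} (σ : Chain n (m + 1)) (j : Fin (m + 1)) : Chain n m where
  src := σ.src
  tgt := σ.tgt
  mid := σ.mid.comp (coface j)
  src_le_tgt := σ.src_le_tgt
  src_le _ := σ.src_le _
  le_tgt _ := σ.le_tgt _

/-- The chain `src ≤ mid 0 ≤ ⋯ ≤ mid j`. -/
def left {n m : ℕ} (σ : Chain n (m + 1)) (j : Fin (m + 1)) : Chain n j.1 where
  src := σ.src
  tgt := σ.mid j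
  mid := ⟨fun i => σ.mid ⟨i.1, by omega⟩, fun _ _ h => σ.mid.monotone h⟩
  src_le_tgt := σ.src_le _
  src_le _ := σ.src_le _
  le_tgt i := σ.mid.monotone (Fin.le_def.2 (by simp only; omega))

/-- The chain `mid j ≤ ⋯ ≤ mid m ≤ tgt`. -/
def right {n m : ℕ} (σ : Chain n (m + 1)) (j : Fin (m + 1)) : Chain n (m - j.1) where
  src := σ.mid j
  tgt := σ.tgt
  mid := ⟨fun i => σ.mid ⟨j.1 + 1 + i.1, by omega⟩, fun a b h => σ.mid.monotone (by
    have : a.1 ≤ b.1 := h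
    exact Fin.mk_le_mk.2 (by omega))⟩
  src_le_tgt := σ.le_tgt _
  src_le i := σ.mid.monotone (Fin.le_def.2 (by simp only; omega))
  le_tgt _ := σ.le_tgt _

/-- The image of a chain under a monotone map. -/
def map {n n' m : ℕ} (f : Fin (n + 1) →o Fin (n' + 1)) (σ : Chain n m) : Chain n' m where
  src := f σ.src
  tgt := f σ.tgt
  mid := f.comp σ.mid
  src_le_tgt := f.monotone σ.src_le_tgt
  src_le i := f.monotone (σ.src_le i)
  le_tgt i := f.monotone (σ.le_tgt i)

lemma Strict.of_map {n n' m : ℕ} {f : Fin (n + 1) →o Fin (n' + 1)} {σ : Chain n m}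
    (h : (σ.map f).Strict) : σ.Strict := by
  obtain ⟨h₁, h₂, h₃, h₄⟩ := h
  exact ⟨f.monotone.reflect_lt h₁, fun i j hij => f.monotone.reflect_lt (h₂ hij),
    fun i => f.monotone.reflect_lt (h₃ i), fun i => f.monotone.reflect_lt (h₄ i)⟩

lemma eq_point {n : ℕ} (σ : Chain n 0) (h : σ.src = σ.tgt) : σ = point σ.src :=
  Chain.ext rfl h.symm (OrderHom.ext _ _ (funext fun i => i.elim0))

lemma not_strict {n m : ℕ} {σ : Chain n (m + 1)} (h : ¬ σ.Strict) :
    σ.src = σ.mid 0 ∨ σ.mid (Fin.last m) = σ.tgt ∨ ¬ Function.Injective σ.mid := by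
  by_contra hc
  push Not at hc
  obtain ⟨h₁, h₂, h₃⟩ := hc
  have e₁ : σ.src < σ.mid 0 := lt_of_le_of_ne (σ.src_le 0) h₁
  have e₂ : σ.mid (Fin.last m) < σ.tgt := lt_of_le_of_ne (σ.le_tgt _) h₂
  exact h ⟨e₁.trans_le (σ.le_tgt 0), σ.mid.monotone.strictMono_of_injective h₃,
    fun i => e₁.trans_le (σ.mid.monotone (Fin.zero_le i)),
    fun i => (σ.mid.monotone (Fin.le_last i)).trans_lt e₂⟩

end Chain

variable {k : Type u} [CommRing k]

/-- `a_{I ∖ {i_{j+1}}}` for `I = {i_0 < … < i_{m+2}}`. -/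
def dropTerm (C : DGCat.{u} k) {n : ℕ} (obj : Fin (n + 1) → C.Obj)
    (arr : ∀ (m : ℕ) (σ : Chain n m), (C.hom (obj σ.src) (obj σ.tgt)).X (m : ℤ))
    {m : ℕ} (σ : Chain n (m + 1)) (j : Fin (m + 1)) :
    (C.hom (obj σ.src) (obj σ.tgt)).X (m : ℤ) :=
  arr m (σ.drop j)

/-- `a_{i_{j+1} < … < i_{m+2}} ∘ a_{i_0 < … < i_{j+1}}` for `I = {i_0 < … < i_{m+2}}`. -/
def compTerm (C : DGCat.{u} k) {n : ℕ} (obj : Fin (n + 1) → C.Obj)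
    (arr : ∀ (m : ℕ) (σ : Chain n m), (C.hom (obj σ.src) (obj σ.tgt)).X (m : ℤ))
    {m : ℕ} (σ : Chain n (m + 1)) (j : Fin (m + 1)) :
    (C.hom (obj σ.src) (obj σ.tgt)).X (m : ℤ) :=
  C.comp (y := obj (σ.mid j)) (p := ((m - j.1 : ℕ) : ℤ)) (q := (j.1 : ℤ)) (by omega)
    (arr (m - j.1) (σ.right j)) (arr j.1 (σ.left j))

/-- An `n`-simplex of the dg-nerve: objects `x_0, …, x_n` of `C` and elements
`a_I ∈ C_{m-1}(x_{i_0}, x_{i_m})` for all `I = {i_0 < … < i_m} ⊆ [n]` with `m ≥ 1`, such that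
`∂ a_I = ∑_{j=1}^{m-1} ((-1)^j a_{I ∖ {i_j}} + (-1)^{m(j+1)} a_{i_j < … < i_m} ∘ a_{i_0 < … < i_j})`.
The families are extended to non-strict chains by `a_{i ≤ i} = 1` and by zero otherwise. -/
@[ext]
structure DGSimplex (C : DGCat.{u} k) (n : ℕ) where
  obj : Fin (n + 1) → C.Obj
  arr : ∀ (m : ℕ) (σ : Chain n m), (C.hom (obj σ.src) (obj σ.tgt)).X (m : ℤ)
  arr_point : ∀ i, arr 0 (Chain.point i) = C.one (obj i)
  arr_zero : ∀ (m : ℕ) (σ : Chain n m), m ≠ 0 → ¬ σ.Strict → arr m σ = 0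
  d_arr_zero : ∀ σ : Chain n 0, σ.Strict →
    ((C.hom (obj σ.src) (obj σ.tgt)).d ((0 : ℕ) : ℤ) (-1)).hom (arr 0 σ) = 0
  d_arr : ∀ (m : ℕ) (σ : Chain n (m + 1)), σ.Strict →
    ((C.hom (obj σ.src) (obj σ.tgt)).d ((m + 1 : ℕ) : ℤ) (m : ℤ)).hom (arr (m + 1) σ) =
      ∑ j : Fin (m + 1), ((-1 : ℤ) ^ (j.1 + 1) • dropTerm C obj arr σ j +
        (-1 : ℤ) ^ ((m + 2) * (j.1 + 2)) • compTerm C obj arr σ j)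

namespace DGSimplex

variable {C : DGCat.{u} k} {n : ℕ}

lemma arr_point' (s : DGSimplex C n) {y : Fin (n + 1)} {μ : Fin 0 →o Fin (n + 1)} {h₁ h₂ h₃} :
    s.arr 0 ⟨y, y, μ, h₁, h₂, h₃⟩ = C.one (s.obj y) := by
  have e' : ∀ i : Fin 0 →o Fin (n + 1), i = μ := fun i => OrderHom.ext _ _ (funext fun j => j.elim0)
  obtain rfl := e' ⟨fun j => j.elim0, fun j => j.elim0⟩
  exact s.arr_point y

lemma d_arr_zero' (s : DGSimplex C n) (σ : Chain n 0) :
    ((C.hom (s.obj σ.src) (s.obj σ.tgt)).d ((0 : ℕ) : ℤ) (-1)).hom (s.arr 0 σ) = 0 := by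
  by_cases hs : σ.Strict
  · exact s.d_arr_zero _ hs
  · obtain ⟨x, y, μ, h₁, h₂, h₃⟩ := σ
    obtain rfl : x = y := by
      by_contra hc
      exact hs ⟨lt_of_le_of_ne h₁ hc, fun i => i.elim0, fun i => i.elim0, fun i => i.elim0⟩
    refine (congrArg _ s.arr_point').trans (C.d_one _)

lemma comp_arr_point (s : DGSimplex C n) {p q m : ℕ} (hp : p = 0) (hq : q = m)
    {x y z : Fin (n + 1)} (hy : y = z) {μ : Fin p →o Fin (n + 1)} {ν : Fin q →o Fin (n + 1)}
    {ν' : Fin m →o Fin (n + 1)} (hν : ∀ i : Fin q, ν i = ν' ⟨i.1, hq ▸ i.2⟩) {h₁ h₂ h₃ h₁' h₂' h₃'}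
    {h₁'' h₂'' h₃''} (h : (p : ℤ) + (q : ℤ) = (m : ℤ)) :
    C.comp h (s.arr p ⟨y, z, μ, h₁, h₂, h₃⟩) (s.arr q ⟨x, y, ν, h₁', h₂', h₃'⟩) =
      s.arr m ⟨x, z, ν', h₁'', h₂'', h₃''⟩ := by
  subst hp hq hy
  obtain rfl : ν = ν' := OrderHom.ext _ _ (funext hν)
  refine (congrArg (fun g => C.comp h g _) s.arr_point').trans ?_
  exact C.one_comp h rfl _

lemma comp_point_arr (s : DGSimplex C n) {p q m : ℕ} (hp : p = 0) (hq : q = m)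
    {x y z : Fin (n + 1)} (hy : x = y) {μ : Fin p →o Fin (n + 1)} {ν : Fin q →o Fin (n + 1)}
    {ν' : Fin m →o Fin (n + 1)} (hν : ∀ i : Fin q, ν i = ν' ⟨i.1, hq ▸ i.2⟩) {h₁ h₂ h₃ h₁' h₂' h₃'}
    {h₁'' h₂'' h₃''} (h : (q : ℤ) + (p : ℤ) = (m : ℤ)) :
    C.comp h (s.arr q ⟨y, z, ν, h₁', h₂', h₃'⟩) (s.arr p ⟨x, y, μ, h₁, h₂, h₃⟩) =
      s.arr m ⟨x, z, ν', h₁'', h₂'', h₃''⟩ := by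
  subst hp hq hy
  obtain rfl : ν = ν' := OrderHom.ext _ _ (funext hν)
  refine (congrArg (fun g => C.comp h _ g) s.arr_point').trans ?_
  exact C.comp_one h rfl _

/-- The sum over the removals of an inner point of a chain vanishes if the chain is degenerate. -/
lemma sum_drop (s : DGSimplex C n) {m : ℕ} (σ : Chain n (m + 1))
    (h : ¬ Function.Injective σ.mid) :
    ∑ j : Fin (m + 1), (-1 : ℤ) ^ (j.1 + 1) • dropTerm C s.obj s.arr σ j = 0 := by
  classical
  let a : (Fin m →o Fin (n + 1)) → (C.hom (s.obj σ.src) (s.obj σ.tgt)).X (m : ℤ) := fun ν =>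
    if hν : (∀ i, σ.src ≤ ν i) ∧ ∀ i, ν i ≤ σ.tgt then
      s.arr m ⟨σ.src, σ.tgt, ν, σ.src_le_tgt, hν.1, hν.2⟩ else 0
  have ha : ∀ ν : Fin m →o Fin (n + 1), ¬ Function.Injective ν → a ν = 0 := by
    intro ν hν
    by_cases hb : (∀ i, σ.src ≤ ν i) ∧ ∀ i, ν i ≤ σ.tgt
    · simp only [a, dif_pos hb]
      refine s.arr_zero _ _ ?_ fun hs => hν hs.2.1.injective
      rintro rfl
      exact hν fun i => i.elim0
    · simp only [a, dif_neg hb]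
  have e : ∀ j, dropTerm C s.obj s.arr σ j = a (σ.mid.comp (coface j)) := fun j =>
    (dif_pos (⟨fun i => σ.src_le _, fun i => σ.le_tgt _⟩ :
      (∀ i, σ.src ≤ σ.mid.comp (coface j) i) ∧ ∀ i, σ.mid.comp (coface j) i ≤ σ.tgt) :
      a (σ.mid.comp (coface j)) = _).symm
  have := alternating_sum_eq_zero a ha σ.mid h
  calc ∑ j : Fin (m + 1), (-1 : ℤ) ^ (j.1 + 1) • dropTerm C s.obj s.arr σ j
      = ∑ j : Fin (m + 1), -((-1 : ℤ) ^ j.1 • a (σ.mid.comp (coface j))) :=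
        Finset.sum_congr rfl fun j _ => by rw [e, pow_succ, mul_neg_one, neg_smul]
    _ = 0 := by rw [Finset.sum_neg_distrib, this, neg_zero]

lemma dropTerm_eq_zero (s : DGSimplex C n) {m : ℕ} (σ : Chain n (m + 1)) (j : Fin (m + 1))
    (hm : m ≠ 0) (h : ¬ (σ.drop j).Strict) : dropTerm C s.obj s.arr σ j = 0 :=
  s.arr_zero _ _ hm h

lemma compTerm_eq_zero_left (s : DGSimplex C n) {m : ℕ} (σ : Chain n (m + 1)) (j : Fin (m + 1))
    (hj : j.1 ≠ 0) (h : ¬ (σ.left j).Strict) : compTerm C s.obj s.arr σ j = 0 := by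
  refine (congrArg (C.comp _ _) (s.arr_zero _ _ hj h)).trans ?_
  exact map_zero _

lemma compTerm_eq_zero_right (s : DGSimplex C n) {m : ℕ} (σ : Chain n (m + 1)) (j : Fin (m + 1))
    (hj : m - j.1 ≠ 0) (h : ¬ (σ.right j).Strict) : compTerm C s.obj s.arr σ j = 0 := by
  refine (congrArg (fun g => C.comp _ g _) (s.arr_zero _ _ hj h)).trans ?_
  rw [map_zero]
  rfl

/-- The equation for the differential also holds for non-strict chains. -/
lemma d_arr' (s : DGSimplex C n) (m : ℕ) (σ : Chain n (m + 1)) :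
    ((C.hom (s.obj σ.src) (s.obj σ.tgt)).d ((m + 1 : ℕ) : ℤ) (m : ℤ)).hom (s.arr (m + 1) σ) =
      ∑ j : Fin (m + 1), ((-1 : ℤ) ^ (j.1 + 1) • dropTerm C s.obj s.arr σ j +
        (-1 : ℤ) ^ ((m + 2) * (j.1 + 2)) • compTerm C s.obj s.arr σ j) := by
  by_cases hs : σ.Strict
  · exact s.d_arr m σ hs
  rw [s.arr_zero _ σ (Nat.succ_ne_zero m) hs, map_zero]
  symm
  rcases Chain.not_strict hs with h | h | h
  · rw [Finset.sum_eq_single 0]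
    · have e : compTerm C s.obj s.arr σ 0 = dropTerm C s.obj s.arr σ 0 :=
        s.comp_point_arr (μ := (σ.left 0).mid) (ν := (σ.right 0).mid) (ν' := (σ.drop 0).mid)
          rfl rfl h (fun i => congrArg σ.mid (Fin.ext ((Nat.add_comm 1 i.1).trans
            (coface_val (0 : Fin (m + 1)) ⟨i.1, i.2⟩).symm))) _
      rw [e, ← add_smul, pow_mul']
      simp
    · intro j _ hj
      have hj' : j.1 ≠ 0 := fun h => hj (Fin.ext h)
      have hm : m ≠ 0 := by have := j.2; omega
      rw [dropTerm_eq_zero s σ j hm, compTerm_eq_zero_left s σ j hj', smul_zero, smul_zero,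
        add_zero]
      · intro hc
        exact (hc.2.2.1 ⟨0, by omega⟩).ne h
      · intro hc
        refine (hc.2.2.1 ⟨0, by omega⟩).ne (h.trans (congrArg σ.mid (Fin.ext ?_)))
        rw [coface_val, if_pos (by simp only; omega)]
        rfl
    · simp
  · rw [Finset.sum_eq_single (Fin.last m)]
    · have e : compTerm C s.obj s.arr σ (Fin.last m) = dropTerm C s.obj s.arr σ (Fin.last m) :=
        s.comp_arr_point (μ := (σ.right (Fin.last m)).mid) (ν := (σ.left (Fin.last m)).mid)
          (ν' := (σ.drop (Fin.last m)).mid) (Nat.sub_self m) rfl h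
          (fun i => congrArg σ.mid (Fin.ext (by
          have : i.1 < m := i.2
          rw [coface_val, if_pos (by exact this)]))) _
      rw [e, ← add_smul]
      have : (-1 : ℤ) ^ ((Fin.last m).1 + 1) + (-1) ^ ((m + 2) * ((Fin.last m).1 + 2)) = 0 := by
        rw [Fin.val_last]
        rcases Nat.even_or_odd m with hm | hm
        · rw [hm.add_one.neg_one_pow, ((hm.add even_two).mul_right _).neg_one_pow]
          norm_num
        · rw [hm.add_one.neg_one_pow, ((hm.add_even even_two).mul (hm.add_even even_two)).neg_one_pow]
          norm_num
      rw [this, zero_smul]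
    · intro j _ hj
      have hj' : j.1 < m := by
        have : j.1 ≠ m := fun h => hj (Fin.ext h)
        omega
      rw [dropTerm_eq_zero s σ j (by omega), compTerm_eq_zero_right s σ j (by omega), smul_zero,
        smul_zero, add_zero]
      · intro hc
        refine (hc.2.2.2 ⟨m - j.1 - 1, by omega⟩).ne (Eq.trans (congrArg σ.mid (Fin.ext ?_)) h)
        simp only [Fin.val_last]
        omega
      · intro hc
        refine (hc.2.2.2 ⟨m - 1, by omega⟩).ne (Eq.trans (congrArg σ.mid (Fin.ext ?_)) h)
        rw [coface_val, if_neg (by simp only; omega)]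
        simp only [Fin.val_last]
        omega
    · simp
  · rw [Finset.sum_add_distrib, s.sum_drop σ h, zero_add]
    refine Finset.sum_eq_zero fun j _ => ?_
    obtain ⟨i, hi⟩ := exists_eq_of_not_injective σ.mid h
    by_cases hj : j.1 ≤ i.1
    · rw [compTerm_eq_zero_right s σ j (by omega), smul_zero]
      intro hc
      by_cases hj' : j.1 = i.1
      · refine (hc.2.2.1 ⟨0, by omega⟩).ne ?_
        refine (congrArg σ.mid (Fin.ext ?_)).trans (hi.trans (congrArg σ.mid (Fin.ext ?_)))
        · exact hj'
        · simp only [Fin.val_succ]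
          omega
      · refine (hc.2.1 (show (⟨i.1 - j.1 - 1, by omega⟩ : Fin (m - j.1)) < ⟨i.1 - j.1, by omega⟩ from
          Fin.mk_lt_mk.2 (by omega))).ne ?_
        refine (congrArg σ.mid (Fin.ext ?_)).trans (hi.trans (congrArg σ.mid (Fin.ext ?_)))
        · simp only [Fin.val_castSucc]
          omega
        · simp only [Fin.val_succ]
          omega
    · rw [compTerm_eq_zero_left s σ j (by omega), smul_zero]
      intro hc
      by_cases hj' : j.1 = i.1 + 1
      · refine (hc.2.2.2 ⟨i.1, by omega⟩).ne ?_
        refine (congrArg σ.mid (Fin.ext ?_)).trans (hi.trans (congrArg σ.mid (Fin.ext ?_)))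
        · rfl
        · simp only [Fin.val_succ]
          omega
      · refine (hc.2.1 (show (⟨i.1, by omega⟩ : Fin j.1) < ⟨i.1 + 1, by omega⟩ from
          Fin.mk_lt_mk.2 (by omega))).ne ?_
        exact hi

/-- The action of a monotone map. -/
def map {n' : ℕ} (f : Fin (n + 1) →o Fin (n' + 1)) (s : DGSimplex C n') : DGSimplex C n where
  obj i := s.obj (f i)
  arr m σ := s.arr m (σ.map f)
  arr_point _ := s.arr_point'
  arr_zero m σ hm hs := s.arr_zero m _ hm fun h => hs h.of_map
  d_arr_zero τ _ := s.d_arr_zero' (τ.map f)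
  d_arr m σ _ := s.d_arr' m (σ.map f)

/-- The action of a dg-functor. -/
def mapFunctor {D : DGCat.{u} k} (F : C.Functor D) (s : DGSimplex C n) : DGSimplex D n where
  obj i := F.obj (s.obj i)
  arr m σ := ((F.hom _ _).f (m : ℤ)).hom (s.arr m σ)
  arr_point i := (congrArg _ (s.arr_point i)).trans (F.map_one _)
  arr_zero m σ hm hs := (congrArg _ (s.arr_zero m σ hm hs)).trans (map_zero _)
  d_arr_zero σ hσ := by
    have comm := LinearMap.congr_fun (congrArg ModuleCat.Hom.hom
      ((F.hom (s.obj σ.src) (s.obj σ.tgt)).comm ((0 : ℕ) : ℤ) (-1))) (s.arr 0 σ)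
    exact comm.trans ((congrArg ((F.hom _ _).f (-1)).hom (s.d_arr_zero σ hσ)).trans (map_zero _))
  d_arr m σ hσ := by
    have comm := LinearMap.congr_fun (congrArg ModuleCat.Hom.hom
      ((F.hom (s.obj σ.src) (s.obj σ.tgt)).comm ((m + 1 : ℕ) : ℤ) (m : ℤ))) (s.arr (m + 1) σ)
    refine comm.trans ((congrArg ((F.hom _ _).f (m : ℤ)).hom (s.d_arr m σ hσ)).trans ?_)
    rw [map_sum]
    refine Finset.sum_congr rfl fun j _ => ?_
    rw [map_add, map_zsmul, map_zsmul]
    refine congrArg₂ _ rfl (congrArg _ ?_)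
    exact F.map_comp _ _ _

lemma map_mapFunctor {D : DGCat.{u} k} (F : C.Functor D) {n' : ℕ}
    (f : Fin (n + 1) →o Fin (n' + 1)) (s : DGSimplex C n') :
    mapFunctor F (map f s) = map f (mapFunctor F s) :=
  DGSimplex.ext rfl (heq_of_eq (by funext m σ; rfl))

end DGSimplex

/-- The dg-nerve functor. -/
def dgNerve (k : Type u) [CommRing k] : DGCat.{u} k ⥤ SSet.{u} where
  obj C :=
    { obj := fun Δ => DGSimplex C Δ.unop.len
      map := fun f => TypeCat.ofHom (DGSimplex.map f.unop.toOrderHom)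
      map_id := fun _ => rfl
      map_comp := fun _ _ => rfl }
  map F :=
    { app := fun _ => TypeCat.ofHom (DGSimplex.mapFunctor F)
      naturality := fun _ Y f => ConcreteCategory.hom_ext _ _ fun s =>
        (DGSimplex.map_mapFunctor (n := Y.unop.len) F f.unop.toOrderHom s).symm }
  map_id _ := rfl
  map_comp _ _ := rfl

end Nerve

/-- The linear dg-nerve of small dg-categories. -/
noncomputable def linearDGNerve (k : Type u) [CommRing k] : DGCat.{u} k ⥤ TemplicialModule.{u} k :=
  gammaFunctor k ⋙ tFunctor k

end LinDG

/-! Let `A` be the enriched category of `C`. An `n`-simplex of the underlying simplicial set is a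
morphism `G` from the free templicial module on `Δ[n]`. It consists of objects `x_i` and, for each
monotone `y : [m] → [n]` from `s` to `t`, a sum of words of length `m` from `x_s` to `x_t`. These
values are natural in `y` and group-like: comultiplying the value at `y` gives the tensor product of
the values at its two segments.

A word with several letters can be cut at an inner vertex of `cut` and glued back. Hence a sum of
words is determined by its one-letter component and its inner comultiplications
(`eq_zero_of_proj_of_tComul`), and `G` is determined by the objects and the letters `g_y`, the
one-letter components of its values. An inner face of a word has one letter in two ways: a single
letter is restricted, or the only inner vertex of `cut` is removed and the two letters around it are
composed. This gives `g_{d_j y} = d_j g_y + g_{left} · g_{right}` (`proj_innerFace`,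
`homProj_innerFace`), where `·` is the composition of `A`.

A letter is a family of elements of a hom-complex in which `∂` is the alternating sum of the faces.
By the face relation all its non-top values come from shorter simplices, so only the top value is
new, and its differential is an alternating sum of terms "drop a vertex" and "compose at a vertex".
Up to the sign `(-1)^m` this is the equation of the dg-nerve. Top values of degenerate simplices of
positive degree vanish (`gval_proj_tMap`). This defines `toNerve`, and the same recursion shows that
it is injective (`homEval_eq`).

Surjectivity uses no formula for the inverse. Any choice of letters `ℓ s t` of maximal degree gives
a morphism: `y` is sent to the restriction along `y` of the sum of all words over the interval from
`s` to `t`, one for each set of omitted vertices. This is group-like because a subset of the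
interval that misses `c` is a pair of subsets of the two halves (`tComul_wordSum`). The letters are
then fitted to a given simplex by induction on `t - s`. If the error vanishes on shorter intervals,
the composition terms cancel in its differential, so the error over the interval is itself an
admissible letter (`defect_mem`). Adding it to `ℓ s t` removes the error there and disturbs no
shorter interval (`proj_wordSum`, `exists_letters`). -/

namespace LinDG

/-! ### Words and their letters: transport, coordinates, reconstruction. -/

section Letters

variable {k : Type u} [CommRing k]

namespace AugCat

/-- Transport of a morphism along equalities of objects. -/
def hcast (A : AugCat.{u} k) {x x' y y' : A.Obj} {n : ℕ} (hx : x = x') (hy : y = y') :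
    A.hom x y n →ₗ[k] A.hom x' y' n := by
  subst hx hy
  exact LinearMap.id

lemma hcast_map (A : AugCat.{u} k) {x x' y y' : A.Obj} {m n : ℕ} (hx : x = x') (hy : y = y')
    (φ : Fin m →o Fin n) (a : A.hom x y n) :
    A.hcast hx hy (A.map φ a) = A.map φ (A.hcast hx hy a) := by
  subst hx hy
  rfl

lemma hcast_comp (A : AugCat.{u} k) {x x' y y' z z' : A.Obj} {p q n : ℕ} (hx : x = x')
    (hy : y = y') (hz : z = z') (h : p + q = n) (a : A.hom x y p) (b : A.hom y z q) :
    A.comp h (A.hcast hx hy a) (A.hcast hy hz b) = A.hcast hx hz (A.comp h a b) := by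
  subst hx hy hz
  rfl

lemma hcast_hcast (A : AugCat.{u} k) {x x' x'' y y' y'' : A.Obj} {n : ℕ} (hx : x = x')
    (hy : y = y') (hx' : x' = x'') (hy' : y' = y'') (a : A.hom x y n) :
    A.hcast hx' hy' (A.hcast hx hy a) = A.hcast (hx.trans hx') (hy.trans hy') a := by
  subst hx hy hx' hy'
  rfl

lemma one'_comp (A : AugCat.{u} k) {x y : A.Obj} {m p : ℕ} (h₀ : m = 0) (h : m + p = p)
    (a : A.hom x y p) : A.comp h (A.one' x h₀) a = a := by
  subst h₀
  exact A.one_comp h rfl a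

lemma comp_one' (A : AugCat.{u} k) {x y : A.Obj} {m p : ℕ} (h₀ : m = 0) (h : p + m = p)
    (a : A.hom x y p) : A.comp h a (A.one' y h₀) = a := by
  subst h₀
  exact A.comp_one h rfl a

end AugCat

/-- The map to the indices of a finite set `S` induced by a monotone map with values in `S`. -/
noncomputable def idx {p n : ℕ} (S : Finset (Fin n)) (τ : Fin p →o Fin n) (hτ : ∀ i, τ i ∈ S) :
    Fin p →o Fin S.card where
  toFun i := (enum S).symm ⟨τ i, hτ i⟩
  monotone' _ _ hij := (enum S).symm.monotone (Subtype.mk_le_mk.2 (τ.monotone hij))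

lemma enum_idx {p n : ℕ} (S : Finset (Fin n)) (τ : Fin p →o Fin n) (hτ : ∀ i, τ i ∈ S)
    (i : Fin p) : (enum S (idx S τ hτ i)).1 = τ i :=
  congrArg Subtype.val ((enum S).apply_symm_apply _)

lemma idx_comp {p q n : ℕ} (S : Finset (Fin n)) (τ : Fin p →o Fin n) (hτ : ∀ i, τ i ∈ S)
    (φ : Fin q →o Fin p) : (idx S τ hτ).comp φ = idx S (τ.comp φ) fun i => hτ (φ i) := rfl

lemma finMap_idx {p m n : ℕ} (S : Finset (Fin m)) (S' : Finset (Fin n)) (f : Fin m →o Fin n)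
    (hf : ∀ u ∈ S, f u ∈ S') (τ : Fin p →o Fin m) (hτ : ∀ i, τ i ∈ S) (τ' : Fin p →o Fin n)
    (hτ' : ∀ i, τ' i ∈ S') (h : ∀ i, f (τ i) = τ' i) :
    (finMap S S' f hf).comp (idx S τ hτ) = idx S' τ' hτ' :=
  OrderHom.ext _ _ (funext fun i => enum_injective S' (by
    exact (((enum_finMap S S' f hf _).trans (congrArg f (enum_idx S τ hτ i))).trans (h i)).trans
      (enum_idx S' τ' hτ' i).symm))

/-- The elements of `S₁` are enumerated before those of `S₂`, so the coordinate map is a join. This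
is the form in which `map_join` evaluates a composite of two letters in `proj_innerFace_word`. -/
lemma idx_union {p q m n : ℕ} {S S₁ S₂ : Finset (Fin n)}
    (hS : ∀ u, u ∈ S ↔ u ∈ S₁ ∨ u ∈ S₂) (hlt : ∀ u ∈ S₁, ∀ v ∈ S₂, u < v)
    (h : p + q = m) (h' : S₁.card + S₂.card = S.card) (τ : Fin m →o Fin n) (hτ : ∀ i, τ i ∈ S)
    (τ₁ : Fin p →o Fin n) (hτ₁ : ∀ i, τ₁ i ∈ S₁) (τ₂ : Fin q →o Fin n) (hτ₂ : ∀ i, τ₂ i ∈ S₂)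
    (e₁ : ∀ i : Fin p, τ ⟨i.1, by omega⟩ = τ₁ i)
    (e₂ : ∀ i : Fin q, τ ⟨p + i.1, by omega⟩ = τ₂ i) :
    idx S τ hτ = join h h' (idx S₁ τ₁ hτ₁) (idx S₂ τ₂ hτ₂) := by
  apply eq_join
  · intro i
    suffices e : idx S τ hτ ⟨i.1, by omega⟩ = ⟨(idx S₁ τ₁ hτ₁ i).1, by omega⟩ from
      congrArg Fin.val e
    apply enum_injective
    rw [enum_idx, enum_left hS hlt, enum_idx, e₁]
  · intro i
    suffices e : idx S τ hτ ⟨p + i.1, by omega⟩ = ⟨S₁.card + (idx S₂ τ₂ hτ₂ i).1, by omega⟩ from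
      congrArg Fin.val e
    apply enum_injective
    rw [enum_idx, enum_right hS hlt, enum_idx, e₂]

variable {A : AugCat.{u} k} {n : ℕ} {a b : A.Obj}

/-- The two index maps have different codomains before the endpoints are identified, so they are
compared through the vertices that they enumerate. -/
lemma Arr.hcast_arr {σ : Shape A n a b} (α : Arr σ) {m : ℕ} {s t s' t' : σ.cut} (hs : s = s')
    (ht : t = t') (h : s ≤ t) (h' : s' ≤ t') (x : σ.vert s = σ.vert s') (y : σ.vert t = σ.vert t')
    (φ : Fin m →o Fin (inner σ.cut s.1 t.1).card) (φ' : Fin m →o Fin (inner σ.cut s'.1 t'.1).card)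
    (hφ : ∀ i, (enum _ (φ i)).1 = (enum _ (φ' i)).1) :
    A.hcast x y (A.map φ (α.arr s t h)) = A.map φ' (α.arr s' t' h') := by
  subst hs ht
  obtain rfl : φ = φ' := OrderHom.ext _ _ (funext fun i => enum_injective _ (hφ i))
  rfl

/-! ### Tuples with prescribed letters -/

/-- The next element of `cut`. -/
noncomputable def Shape.next (σ : Shape A n a b) (s : σ.cut) (h : ∃ t, s < t) : σ.cut :=
  wellFounded_lt.min {w | s < w} h

lemma Shape.lt_next (σ : Shape A n a b) (s : σ.cut) (h : ∃ t, s < t) : s < σ.next s h :=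
  wellFounded_lt.min_mem {w | s < w} h

lemma Shape.next_le (σ : Shape A n a b) (s : σ.cut) (h : ∃ t, s < t) {t : σ.cut} (ht : s < t) :
    σ.next s h ≤ t :=
  not_lt.1 fun hc => wellFounded_lt.not_lt_min {w | s < w} ht hc

/-- A family of letters of a shape. -/
abbrev LetterFam (σ : Shape A n a b) :=
  ∀ s t : σ.cut, s < t → A.hom (σ.vert s) (σ.vert t) (inner σ.cut s.1 t.1).card

open Classical in
/-- The composites of consecutive letters. -/
noncomputable def buildFun {σ : Shape A n a b} (L : LetterFam σ) (s t : σ.cut) (h : s ≤ t) :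
    A.hom (σ.vert s) (σ.vert t) (inner σ.cut s.1 t.1).card :=
  if e : s = t then e ▸ A.one' (σ.vert s) (card_inner_self σ.cut s.1)
  else
    have hl : s < t := lt_of_le_of_ne h e
    -- Termination: peeling off the first letter moves `s` strictly upwards, and `s < t` prevents
    -- truncation of the measure.
    have : t.1.1 - (σ.next s ⟨t, hl⟩).1.1 < t.1.1 - s.1.1 := by
      have h₁ : s.1.1 < (σ.next s ⟨t, hl⟩).1.1 := σ.lt_next s ⟨t, hl⟩
      have h₂ : s.1.1 < t.1.1 := hl
      omega
    A.comp (card_inner (σ.next s ⟨t, hl⟩).2 (σ.lt_next s ⟨t, hl⟩).le (σ.next_le s _ hl))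
      (L s (σ.next s ⟨t, hl⟩) (σ.lt_next _ _))
      (buildFun L (σ.next s ⟨t, hl⟩) t (σ.next_le s _ hl))
termination_by t.1.1 - s.1.1

lemma buildFun_self {σ : Shape A n a b} (L : LetterFam σ) (s : σ.cut) (h : s ≤ s) :
    buildFun L s s h = A.one' (σ.vert s) (card_inner_self σ.cut s.1) := by
  rw [buildFun, dif_pos rfl]

/-- A minimal `v` above `s` is unique, so it is the successor chosen in the recursion. Later
arguments can work with minimality and forget the choice. -/
lemma buildFun_next {σ : Shape A n a b} (L : LetterFam σ) {s t v : σ.cut} (h : s ≤ t)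
    (hv : s < v) (hvt : v ≤ t) (hmin : ∀ w, s < w → v ≤ w) :
    buildFun L s t h = A.comp (card_inner v.2 hv.le hvt) (L s v hv) (buildFun L v t hvt) := by
  have hl : s < t := hv.trans_le hvt
  obtain rfl : v = σ.next s ⟨t, hl⟩ :=
    le_antisymm (hmin _ (σ.lt_next _ _)) (σ.next_le s _ hv)
  rw [buildFun, dif_neg hl.ne]

lemma Shape.exists_next (σ : Shape A n a b) {s t : σ.cut} (h : s < t) :
    ∃ v, s < v ∧ v ≤ t ∧ ∀ w, s < w → v ≤ w :=
  ⟨σ.next s ⟨t, h⟩, σ.lt_next _ _, σ.next_le _ _ h, fun _ hw => σ.next_le _ _ hw⟩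

/-- Induction over the elements of `cut`, from `t` downwards. -/
lemma Shape.induction (σ : Shape A n a b) {t : σ.cut} {P : ∀ s, s ≤ t → Prop}
    (h₀ : P t le_rfl)
    (h₁ : ∀ s v (hv : s < v) (hvt : v ≤ t), (∀ w, s < w → v ≤ w) → P v hvt → P s (hv.le.trans hvt))
    (s : σ.cut) (h : s ≤ t) : P s h := by
  induction s using WellFoundedGT.induction with
  | ind s ih =>
    rcases h.eq_or_lt with rfl | hl
    · exact h₀
    · obtain ⟨v, hv, hvt, hmin⟩ := σ.exists_next hl
      exact h₁ s v hv hvt hmin (ih v hv hvt)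

/-- The tuple with given letters. -/
noncomputable def build {σ : Shape A n a b} (L : LetterFam σ) : Arr σ where
  arr := buildFun L
  arr_self s := buildFun_self L s _
  arr_comp s t w h h' := by
    induction s, h using σ.induction with
    | h₀ => rw [buildFun_self, A.one'_comp]
    | h₁ s v hv hvt hmin ih =>
      rw [buildFun_next L (hv.le.trans hvt) hv hvt hmin,
        buildFun_next L ((hv.le.trans hvt).trans h') hv (hvt.trans h') hmin, ← ih]
      exact A.assoc _ _ _ _ _ _ _

/-- Only consecutive elements of `cut` contribute their value of `L`. On other pairs `L` never
enters the tuple, which allows arbitrary default values in the families below. -/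
lemma build_next {σ : Shape A n a b} (L : LetterFam σ) {s v : σ.cut} (hv : s < v)
    (hmin : ∀ w, s < w → v ≤ w) : (build L).arr s v hv.le = L s v hv := by
  change buildFun L s v hv.le = _
  rw [buildFun_next L hv.le hv le_rfl hmin, buildFun_self, A.comp_one']

/-- A tuple is determined by its letters. -/
lemma Arr.ext_letters {σ : Shape A n a b} {α β : Arr σ} {s t : σ.cut}
    (h : ∀ s' v (hv : s' < v), s ≤ s' → v ≤ t → (∀ w, s' < w → v ≤ w) →
      α.arr s' v hv.le = β.arr s' v hv.le) (hst : s ≤ t) : α.arr s t hst = β.arr s t hst := by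
  induction s, hst using σ.induction with
  | h₀ => rw [α.arr_self, β.arr_self]
  | h₁ s v hv hvt hmin ih =>
    rw [← α.arr_comp s v t hv.le hvt, ← β.arr_comp s v t hv.le hvt, h s v hv le_rfl hvt hmin,
      ih fun s' v' hv' hs' => h s' v' hv' (hv.le.trans hs')]

lemma build_eq {σ : Shape A n a b} (L : LetterFam σ) (α : Arr σ)
    (h : ∀ s v (hv : s < v), (∀ w, s < w → v ≤ w) → L s v hv = α.arr s v hv.le) :
    build L = α :=
  Arr.ext' fun _ _ hst => Arr.ext_letters (fun s' v hv _ _ hmin =>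
    (build_next L hv hmin).trans (h s' v hv hmin)) hst

/-- Tuples whose letters only differ linearly in one place. -/
lemma isLin_build {σ : Shape A n a b} {g : Fin n} {r r' : k} {L L₁ L₂ : LetterFam σ}
    (h : ∀ s t (hst : s < t),
      ((s.1.1 ≤ g.1 ∧ g.1 < t.1.1) → L s t hst = r • L₁ s t hst + r' • L₂ s t hst) ∧
      (¬ (s.1.1 ≤ g.1 ∧ g.1 < t.1.1) → L₁ s t hst = L s t hst ∧ L₂ s t hst = L s t hst)) :
    IsLin g r r' (build L) (build L₁) (build L₂) := by
  intro s t hst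
  change (_ → buildFun L s t hst = r • buildFun L₁ s t hst + r' • buildFun L₂ s t hst) ∧
    (_ → buildFun L₁ s t hst = buildFun L s t hst ∧ buildFun L₂ s t hst = buildFun L s t hst)
  induction s, hst using σ.induction with
  | h₀ =>
    -- No gap lies between `t` and itself, so only the second alternative can occur, and all three
    -- members are identities.
    refine ⟨fun hc => by omega, fun _ => ?_⟩
    rw [buildFun_self, buildFun_self, buildFun_self]
    exact ⟨rfl, rfl⟩
  | h₁ s v hv hvt hmin ih =>
    obtain ⟨ih₁, ih₂⟩ := ih
    obtain ⟨hL₁, hL₂⟩ := h s v hv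
    have hv' : s.1.1 < v.1.1 := hv
    have hvt' : v.1.1 ≤ t.1.1 := hvt
    rw [buildFun_next L (hv.le.trans hvt) hv hvt hmin,
      buildFun_next L₁ (hv.le.trans hvt) hv hvt hmin,
      buildFun_next L₂ (hv.le.trans hvt) hv hvt hmin]
    refine ⟨fun hc => ?_, fun hc => ?_⟩
    -- The gap `g` lies in exactly one of the two factors, the first letter or the rest. That factor
    -- varies linearly, the other one is common to the three tuples, and composition is bilinear.
    · by_cases hg : g.1 < v.1.1
      · rw [hL₁ ⟨hc.1, hg⟩, (ih₂ (by omega)).1, (ih₂ (by omega)).2, map_add, map_smul, map_smul]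
        rfl
      · rw [ih₁ ⟨by omega, hc.2⟩, (hL₂ (by omega)).1, (hL₂ (by omega)).2, map_add, map_smul,
          map_smul]
    · rw [(hL₂ (by omega)).1, (hL₂ (by omega)).2, (ih₂ (by omega)).1, (ih₂ (by omega)).2]
      exact ⟨rfl, rfl⟩

end Letters

/-! ### The one-letter component and its inner faces. -/

noncomputable section Projection

variable {k : Type u} [CommRing k] {A : AugCat.{u} k}

/-- The inclusion of the vertices of `[m + 1]` strictly between the endpoints. -/
def innerVertex (m : ℕ) : Fin m →o Fin (m + 1 + 1) where
  toFun i := ⟨i.1 + 1, by omega⟩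
  monotone' i j h := by
    have : i.1 ≤ j.1 := h
    exact Fin.mk_le_mk.2 (by omega)

lemma exists_innerVertex {m : ℕ} {v : Fin (m + 1 + 1)} (h₀ : v ≠ 0) (h₁ : v ≠ Fin.last _) :
    ∃ i, v = innerVertex m i := by
  have h₀' : v.1 ≠ 0 := fun h => h₀ (Fin.ext h)
  have h₁' : v.1 ≠ m + 1 := fun h => h₁ (Fin.ext h)
  exact ⟨⟨v.1 - 1, by omega⟩, Fin.ext (by change v.1 = v.1 - 1 + 1; omega)⟩

/-- No vertex strictly between the endpoints belongs to `cut`. -/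
def Shape.Avoids {n m : ℕ} {a b : A.Obj} (σ : Shape A n a b)
    (y : Fin (m + 1 + 1) →o Fin (n + 1)) : Prop :=
  ∀ i, y (innerVertex m i) ∉ σ.cut

lemma Shape.Avoids.mem {n m : ℕ} {a b : A.Obj} {σ : Shape A n a b}
    {y : Fin (m + 1 + 1) →o Fin (n + 1)} (h : σ.Avoids y) {s t : σ.cut} (hs : y 0 = s.1)
    (ht : y (Fin.last _) = t.1) (i : Fin m) :
    y.comp (innerVertex m) i ∈ inner σ.cut s.1 t.1 := by
  refine mem_inner.2 ⟨lt_of_le_of_ne ?_ fun e => h i ?_, lt_of_le_of_ne ?_ fun e => h i ?_, h i⟩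
  · rw [← hs]
    exact y.monotone (Fin.zero_le _)
  · change y.comp (innerVertex m) i ∈ _
    rw [← e]
    exact s.2
  · rw [← ht]
    exact y.monotone (Fin.le_last _)
  · change y.comp (innerVertex m) i ∈ _
    rw [e]
    exact t.2

lemma Shape.le_of_eq {n m : ℕ} {a b : A.Obj} {σ : Shape A n a b}
    {y : Fin (m + 1 + 1) →o Fin (n + 1)} {s t : σ.cut} (hs : y 0 = s.1)
    (ht : y (Fin.last _) = t.1) : s ≤ t := by
  change s.1 ≤ t.1
  rw [← hs, ← ht]
  exact y.monotone (Fin.zero_le _)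

open Classical in
/-- The value of a tuple on the inner vertices of a simplex of the shape, if they are not in
`cut`. -/
def evalAlong {n m : ℕ} {a b a' b' : A.Obj} {σ : Shape A n a b} (α : Arr σ)
    (y : Fin (m + 1 + 1) →o Fin (n + 1)) {s t : σ.cut} (hs : y 0 = s.1)
    (ht : y (Fin.last _) = t.1) (ha : σ.vert s = a') (hb : σ.vert t = b') : A.hom a' b' m :=
  -- The restriction of the word along `y` has one letter exactly in this case. Expressing that
  -- letter through `σ` itself lets faces and segments of a word be compared inside one shape, with
  -- `hcast` absorbing the equalities of objects.
  if h : σ.Avoids y then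
    A.hcast ha hb (A.map (idx _ (y.comp (innerVertex m)) (h.mem hs ht))
      (α.arr s t (Shape.le_of_eq hs ht)))
  else 0

lemma evalAlong_of_not {n m : ℕ} {a b a' b' : A.Obj} {σ : Shape A n a b} (α : Arr σ)
    (y : Fin (m + 1 + 1) →o Fin (n + 1)) {s t : σ.cut} (hs : y 0 = s.1)
    (ht : y (Fin.last _) = t.1) (ha : σ.vert s = a') (hb : σ.vert t = b') (h : ¬ σ.Avoids y) :
    evalAlong α y hs ht ha hb = 0 := dif_neg h

lemma evalAlong_of {n m : ℕ} {a b a' b' : A.Obj} {σ : Shape A n a b} (α : Arr σ)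
    (y : Fin (m + 1 + 1) →o Fin (n + 1)) {s t : σ.cut} (hs : y 0 = s.1)
    (ht : y (Fin.last _) = t.1) (ha : σ.vert s = a') (hb : σ.vert t = b') (h : σ.Avoids y) :
    evalAlong α y hs ht ha hb =
      A.hcast ha hb (A.map (idx _ (y.comp (innerVertex m)) (h.mem hs ht))
        (α.arr s t (Shape.le_of_eq hs ht))) :=
  dif_pos h

lemma evalAlong_congr {n m : ℕ} {a b a' b' : A.Obj} {σ : Shape A n a b} (α : Arr σ)
    {y y' : Fin (m + 1 + 1) →o Fin (n + 1)} (hy : y = y') {s t s' t' : σ.cut} (hs : y 0 = s.1)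
    (ht : y (Fin.last _) = t.1) (hs' : y' 0 = s'.1) (ht' : y' (Fin.last _) = t'.1)
    (ha : σ.vert s = a') (hb : σ.vert t = b') (ha' : σ.vert s' = a') (hb' : σ.vert t' = b') :
    evalAlong α y hs ht ha hb = evalAlong α y' hs' ht' ha' hb' := by
  subst hy
  obtain rfl : s = s' := Subtype.ext (hs.symm.trans hs')
  obtain rfl : t = t' := Subtype.ext (ht.symm.trans ht')
  rfl

/-- Both sides read the same member of `α` at the same inner vertices; the two coordinate maps agree
by `finMap_idx`, and the conditions `Avoids` are literally the same. -/
lemma evalAlong_pullArr {l m n : ℕ} {a b c d a' b' : A.Obj} (f : Fin (l + 1) →o Fin (n + 1))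
    (y : Fin (m + 1 + 1) →o Fin (l + 1)) {σ : Shape A n a b} (α : Arr σ) (h₀ : f 0 ∈ σ.cut)
    (h₁ : f (Fin.last _) ∈ σ.cut) (hc : σ.vert ⟨f 0, h₀⟩ = c)
    (hd : σ.vert ⟨f (Fin.last _), h₁⟩ = d) {s t : (pullShape f σ h₀ h₁ hc hd).cut} (hs : y 0 = s.1)
    (ht : y (Fin.last _) = t.1) (ha : σ.vert ⟨f s.1, s.2⟩ = a') (hb : σ.vert ⟨f t.1, t.2⟩ = b') :
    evalAlong (pullArr f α h₀ h₁ hc hd) y hs ht ha hb =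
      evalAlong α (f.comp y) (s := ⟨f s.1, s.2⟩) (t := ⟨f t.1, t.2⟩) (congrArg f hs)
        (congrArg f ht) ha hb := by
  by_cases h : σ.Avoids (f.comp y)
  · have h' : (pullShape f σ h₀ h₁ hc hd).Avoids y := h
    refine (evalAlong_of _ _ _ _ _ _ h').trans (Eq.trans ?_ (evalAlong_of _ _ _ _ _ _ h).symm)
    refine congrArg (A.hcast ha hb) ?_
    refine (A.map_comp _ _ _).symm.trans ?_
    exact congrArg (fun φ => A.map φ _) (finMap_idx _ _ _ _ _ _ _ _ fun _ => rfl)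
  · have h' : ¬ (pullShape f σ h₀ h₁ hc hd).Avoids y := h
    exact (evalAlong_of_not _ _ _ _ _ _ h').trans (evalAlong_of_not _ _ _ _ _ _ h).symm

/-- The first element of `cut`. -/
abbrev Shape.first {n : ℕ} {a b : A.Obj} (σ : Shape A n a b) : σ.cut := ⟨0, σ.zero_mem⟩

/-- The last element of `cut`. -/
abbrev Shape.final {n : ℕ} {a b : A.Obj} (σ : Shape A n a b) : σ.cut := ⟨_, σ.last_mem⟩

lemma Shape.id_first {n : ℕ} {a b : A.Obj} (σ : Shape A n a b) :
    (OrderHom.id : Fin (n + 1) →o Fin (n + 1)) 0 = σ.first.1 := rfl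

lemma Shape.id_final {n : ℕ} {a b : A.Obj} (σ : Shape A n a b) :
    (OrderHom.id : Fin (n + 1) →o Fin (n + 1)) (Fin.last n) = σ.final.1 := rfl

/-- The projection of the module of words onto the words with one letter. -/
def proj (A : AugCat.{u} k) (m : ℕ) (a b : A.Obj) : tmod A (m + 1) a b →ₗ[k] A.hom a b m :=
  tlift (fun σ α => evalAlong α OrderHom.id σ.id_first σ.id_final σ.vert_zero σ.vert_last) (by
    intro σ g r r' α α₁ α₂ hl
    -- The letter of a one-letter word spans every gap, so any multilinearity relation is linearity
    -- in that letter. All other words are sent to zero.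
    by_cases h : σ.Avoids OrderHom.id
    · simp only [evalAlong, dif_pos h]
      rw [(hl _ _ _).1 ⟨Nat.zero_le _, g.2⟩, map_add, map_smul, map_smul, map_add, map_smul,
        map_smul]
    · simp only [evalAlong, dif_neg h, smul_zero, add_zero])

lemma proj_word {m : ℕ} {a b : A.Obj} (σ : Shape A (m + 1) a b) (α : Arr σ) :
    proj A m a b (word σ α) =
      evalAlong α OrderHom.id σ.id_first σ.id_final
        σ.vert_zero σ.vert_last :=
  tlift_word _ _ _ _

lemma proj_pull {m n : ℕ} {a b a' b' : A.Obj} (y : Fin (m + 1 + 1) →o Fin (n + 1))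
    {σ : Shape A n a b} (α : Arr σ) (h₀ : y 0 ∈ σ.cut) (h₁ : y (Fin.last _) ∈ σ.cut)
    (ha : σ.vert ⟨y 0, h₀⟩ = a') (hb : σ.vert ⟨y (Fin.last _), h₁⟩ = b') {s t : σ.cut}
    (hs : y 0 = s.1) (ht : y (Fin.last _) = t.1) (ha' : σ.vert s = a') (hb' : σ.vert t = b') :
    proj A m a' b' (pull y α h₀ h₁ ha hb) = evalAlong α y hs ht ha' hb' :=
  (proj_word _ _).trans ((evalAlong_pullArr y OrderHom.id α h₀ h₁ ha hb _ _ _ _).trans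
    (evalAlong_congr α rfl _ _ _ _ _ _ _ _))

/-- The coface of finite intervals leaving out an inner vertex. -/
def innerFace {m : ℕ} (j : Fin (m + 1)) : FinInt (m + 1) (m + 1 + 1) where
  toHom := coface (innerVertex (m + 1) j)
  map_zero := Fin.ext ((coface_val _ _).trans (if_pos (Nat.succ_pos _)))
  map_last := Fin.ext (by
    rw [coface_val, if_neg]
    · rfl
    · change ¬ (m + 1 < j.1 + 1)
      omega)

lemma innerFace_innerVertex {m : ℕ} (j : Fin (m + 1)) :
    (innerFace j).toHom.comp (innerVertex m) = (innerVertex (m + 1)).comp (coface j) :=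
  OrderHom.ext _ _ (funext fun i => Fin.ext (by
    refine (coface_val _ _).trans ?_
    change (if i.1 + 1 < j.1 + 1 then i.1 + 1 else i.1 + 1 + 1) = (coface j i).1 + 1
    rw [coface_val]
    split_ifs <;> omega))

/-- The composition of the letters of a tensor product of two words. -/
def projComp (A : AugCat.{u} k) {p q m : ℕ} (h : p + q = m) (a b : A.Obj) :
    qtensor (tmod A (p + 1)) (tmod A (q + 1)) a b →ₗ[k] A.hom a b m :=
  qlift fun c => TensorProduct.lift ((A.comp h).compl₁₂ (proj A p a c) (proj A q c b))

lemma projComp_qincl {p q m : ℕ} (h : p + q = m) {a b c : A.Obj} (x : tmod A (p + 1) a c)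
    (y : tmod A (q + 1) c b) :
    projComp A h a b (qincl _ _ a b c (x ⊗ₜ y)) = A.comp h (proj A p a c x) (proj A q c b y) := by
  rw [projComp, qlift_qincl]
  rfl

/-- The face has one letter in two disjoint situations. Either the word already had one letter,
which is restricted along `coface j`, or the removed vertex was the only inner vertex of `cut`, and
the letters on its two sides are composed. These are the two summands. -/
lemma proj_innerFace_word {m p q : ℕ} (j : Fin (m + 1)) (hp : p = j.1) (h : p + q = m)
    (h' : p + 1 + (q + 1) = m + 1 + 1) {a b : A.Obj} (σ : Shape A (m + 1 + 1) a b) (α : Arr σ) :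
    proj A m a b (tMap A (innerFace j) a b (word σ α)) =
      A.map (coface j) (proj A (m + 1) a b (word σ α)) +
        projComp A h a b (tComul A h' a b (word σ α)) := by
  have hj : leftSeg h' (Fin.last (p + 1)) = innerVertex (m + 1) j := Fin.ext (by
    change p + 1 = j.1 + 1
    omega)
  have hF : ∀ i, (innerFace j).toHom (innerVertex m i) = innerVertex (m + 1) (coface j i) := fun i =>
    DFunLike.congr_fun (innerFace_innerVertex j) i
  have e₁ : proj A m a b (tMap A (innerFace j) a b (word σ α)) = evalAlong α (innerFace j).toHom
      (s := σ.first) (t := σ.final) (innerFace j).map_zero (innerFace j).map_last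
      σ.vert_zero σ.vert_last :=
    (congrArg _ (tMap_word _ σ α)).trans (proj_pull _ α _ _ _ _ _ _ _ _)
  rw [e₁, proj_word]
  -- If the removed vertex lies in `cut`, the word has at least two letters and the first summand
  -- vanishes. Otherwise the comultiplication at that vertex vanishes on the word.
  by_cases hc : innerVertex (m + 1) j ∈ σ.cut
  · have e₂ := evalAlong_of_not α OrderHom.id σ.id_first σ.id_final
      σ.vert_zero σ.vert_last fun hn => hn j hc
    have e₃ := tComul_word_of_mem h' σ α (by rw [hj]; exact hc) _ (σ.vert_eq hj _ hc)
    have l₀ : leftSeg h' 0 = σ.first.1 := rfl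
    have r₀ : rightSeg h' 0 = (⟨_, hc⟩ : σ.cut).1 := hj
    rw [e₂, map_zero, zero_add, e₃]
    refine Eq.trans ?_ (projComp_qincl h _ _).symm
    refine Eq.trans ?_ (congrArg₂ (fun x y => A.comp h x y)
      (proj_pull (leftSeg h') α _ _ _ _ (s := σ.first) (t := ⟨_, hc⟩) l₀ hj σ.vert_zero rfl)
      (proj_pull (rightSeg h') α _ _ _ _ (s := ⟨_, hc⟩) (t := σ.final) r₀
        (rightSeg_last h') rfl σ.vert_last)).symm
    by_cases hl : σ.Avoids (leftSeg h')
    · by_cases hr : σ.Avoids (rightSeg h')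
      -- When both halves avoid `cut`, so does the face; `arr_comp` and `map_join` then turn the
      -- composite letter, restricted to the face, into the product of the two restricted letters.
      · have hf : σ.Avoids (innerFace j).toHom := by
          intro i
          rw [hF]
          by_cases hi : i.1 < p
          · have : innerVertex (m + 1) (coface j i) = leftSeg h' (innerVertex p ⟨i.1, hi⟩) :=
              Fin.ext (by
                change (coface j i).1 + 1 = i.1 + 1
                rw [coface_val, if_pos (hp ▸ hi)])
            rw [this]
            exact hl _
          · have : innerVertex (m + 1) (coface j i) =
                rightSeg h' (innerVertex q ⟨i.1 - p, by omega⟩) :=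
              Fin.ext (by
                change (coface j i).1 + 1 = p + 1 + (i.1 - p + 1)
                rw [coface_val, if_neg (hp ▸ hi)]
                omega)
            rw [this]
            exact hr _
        rw [evalAlong_of _ _ _ _ _ _ hl, evalAlong_of _ _ _ _ _ _ hr, evalAlong_of _ _ _ _ _ _ hf,
          A.hcast_comp, ← α.arr_comp ⟨0, σ.zero_mem⟩ ⟨_, hc⟩ ⟨_, σ.last_mem⟩ (Fin.zero_le _)
            (Fin.le_last _), ← A.map_join]
        refine congrArg (A.hcast _ _) (congrArg (fun φ => A.map φ _) ?_)
        refine idx_union (mem_inner_union hc (Fin.zero_le _) (Fin.le_last _)) inner_lt h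
          (card_inner hc (Fin.zero_le _) (Fin.le_last _)) _ _ _ _ _ _
          (fun i => ?_) fun i => ?_
        · refine (hF _).trans (Fin.ext ?_)
          change (coface j _).1 + 1 = i.1 + 1
          rw [coface_val, if_pos (hp ▸ i.2)]
        · refine (hF _).trans (Fin.ext ?_)
          change (coface j _).1 + 1 = p + 1 + (i.1 + 1)
          rw [coface_val, if_neg (by simp only; omega)]
          simp only
          omega
      -- A cut vertex inside the right half survives in the face, at position `p + i`, so both sides
      -- vanish.
      · rw [evalAlong_of_not _ (rightSeg h') _ _ _ _ hr, map_zero]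
        refine evalAlong_of_not _ _ _ _ _ _ fun hf => hr fun i hi => hf ⟨p + i.1, by omega⟩ ?_
        rw [hF]
        convert hi using 1
        refine Fin.ext ?_
        change (coface j _).1 + 1 = p + 1 + (i.1 + 1)
        rw [coface_val, if_neg (by simp only; omega)]
        simp only
        omega
    · rw [evalAlong_of_not _ (leftSeg h') _ _ _ _ hl, map_zero, LinearMap.zero_apply]
      refine evalAlong_of_not _ _ _ _ _ _ fun hf => hl fun i hi => hf ⟨i.1, by omega⟩ ?_
      rw [hF]
      convert hi using 1
      refine Fin.ext ?_
      change (coface j _).1 + 1 = i.1 + 1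
      rw [coface_val, if_pos (hp ▸ i.2)]
  · have e₃ := tComul_word_of_notMem h' σ α (by rw [hj]; exact hc)
    rw [e₃, map_zero (projComp A h a b), add_zero]
    by_cases hn : σ.Avoids OrderHom.id
    · rw [evalAlong_of _ _ _ _ _ _ hn, evalAlong_of _ _ _ _ _ _ (fun i => by
        rw [hF]
        exact hn _), ← A.hcast_map, ← A.map_comp, idx_comp]
      exact congrArg (A.hcast _ _) (congrArg (fun φ => A.map φ _) (by
        congr 1
        exact innerFace_innerVertex j))
    · rw [evalAlong_of_not _ OrderHom.id _ _ _ _ hn, map_zero]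
      refine evalAlong_of_not _ _ _ _ _ _ fun hf => hn fun i hi => ?_
      by_cases hij : i = j
      · subst hij
        exact hc hi
      -- A cut vertex different from the removed one is still a vertex of the face.
      · obtain ⟨i', rfl⟩ := Fin.exists_succAbove_eq hij
        refine hf i' ?_
        rw [hF]
        exact hi

lemma proj_innerFace {m p q : ℕ} (j : Fin (m + 1)) (hp : p = j.1) (h : p + q = m)
    (h' : p + 1 + (q + 1) = m + 1 + 1) {a b : A.Obj} (x : tmod A (m + 1 + 1) a b) :
    proj A m a b (tMap A (innerFace j) a b x) =
      A.map (coface j) (proj A (m + 1) a b x) + projComp A h a b (tComul A h' a b x) :=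
  text (f := proj A m a b ∘ₗ tMap A (innerFace j) a b)
    (g := A.map (coface j) ∘ₗ proj A (m + 1) a b + projComp A h a b ∘ₗ tComul A h' a b)
    (proj_innerFace_word j hp h h') x

end Projection

/-! ### Splitting a word at a vertex of `cut` and gluing it back. -/

noncomputable section Gluing

variable {k : Type u} [CommRing k] {A : AugCat.{u} k}

lemma pureTensor_lin {n : ℕ} {a b : A.Obj} {σ : Shape A n a b} {g : Fin n} {r r' : k}
    {α α₁ α₂ : Arr σ} (h : IsLin g r r' α α₁ α₂) :
    pureTensor α = r • pureTensor α₁ + r' • pureTensor α₂ := by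
  have h₁ : (tensRel σ).mkQ
      (Finsupp.single α 1 - r • Finsupp.single α₁ 1 - r' • Finsupp.single α₂ 1) = 0 :=
    (Submodule.Quotient.mk_eq_zero _).2 (Submodule.subset_span ⟨g, r, r', α, α₁, α₂, h, rfl⟩)
  rw [map_sub, map_sub, map_smul, map_smul, sub_sub, sub_eq_zero] at h₁
  exact h₁

section Push

variable {m n : ℕ} {a b a' b' : A.Obj} {σ : Shape A n a b} {f : Fin (m + 1) →o Fin (n + 1)}
  (r : Fin (n + 1) →o Fin (m + 1)) {h₀ : f 0 ∈ σ.cut} {h₁ : f (Fin.last m) ∈ σ.cut}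
  {ha : σ.vert ⟨f 0, h₀⟩ = a'} {hb : σ.vert ⟨f (Fin.last m), h₁⟩ = b'}

lemma mem_inner_push {s t : σ.cut} (hr : ∀ v, s.1 ≤ v → v ≤ t.1 → f (r v) = v) (u : Fin (n + 1))
    (hu : u ∈ inner σ.cut s.1 t.1) : r u ∈ inner (f ⁻¹' σ.cut) (r s.1) (r t.1) := by
  rw [mem_inner] at hu ⊢
  have hst : s.1 ≤ t.1 := (hu.1.trans hu.2.1).le
  refine ⟨lt_of_le_of_ne (r.monotone hu.1.le) fun e => hu.1.ne ?_,
    lt_of_le_of_ne (r.monotone hu.2.1.le) fun e => hu.2.1.ne ?_, fun h => hu.2.2 ?_⟩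
  · rw [← hr s.1 le_rfl hst, e, hr u hu.1.le hu.2.1.le]
  · rw [← hr u hu.1.le hu.2.1.le, e, hr t.1 hst le_rfl]
  · change f (r u) ∈ σ.cut at h
    rwa [hr u hu.1.le hu.2.1.le] at h

/-- The member of a tuple whose restriction along `f` is given, where `r` is a partial inverse of
`f`. -/
def pushArr (β : Arr (pullShape f σ h₀ h₁ ha hb)) (s t : σ.cut) (hst : s ≤ t)
    (hr : ∀ v, s.1 ≤ v → v ≤ t.1 → f (r v) = v) :
    A.hom (σ.vert s) (σ.vert t) (inner σ.cut s.1 t.1).card :=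
  A.hcast (σ.vert_eq (hr s.1 le_rfl hst) (by rw [hr s.1 le_rfl hst]; exact s.2) s.2)
    (σ.vert_eq (hr t.1 hst le_rfl) (by rw [hr t.1 hst le_rfl]; exact t.2) t.2)
    (A.map (finMap _ (inner (f ⁻¹' σ.cut) (r s.1) (r t.1)) r (mem_inner_push r hr))
      (β.arr ⟨r s.1, by change f (r s.1) ∈ σ.cut; rw [hr s.1 le_rfl hst]; exact s.2⟩
        ⟨r t.1, by change f (r t.1) ∈ σ.cut; rw [hr t.1 hst le_rfl]; exact t.2⟩ (r.monotone hst)))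

/-- The composite of `r` and `f` fixes every vertex from `s` to `t`, so it acts trivially on the
member between them, up to transport along equal endpoints. -/
lemma pushArr_pullArr (α : Arr σ) (s t : σ.cut) (hst : s ≤ t)
    (hr : ∀ v, s.1 ≤ v → v ≤ t.1 → f (r v) = v) :
    pushArr r (pullArr f α h₀ h₁ ha hb) s t hst hr = α.arr s t hst := by
  have hs := hr s.1 le_rfl hst
  have ht := hr t.1 hst le_rfl
  refine (congrArg (A.hcast _ _) (A.map_comp _ _ _).symm).trans ?_
  refine (α.hcast_arr (Subtype.ext hs) (Subtype.ext ht) _ hst _ _ _ OrderHom.id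
    fun i => ?_).trans (A.map_id _)
  refine (enum_finMap (inner (f ⁻¹' σ.cut) (r s.1) (r t.1)) (inner σ.cut (f (r s.1)) (f (r t.1)))
    f (map_inner f σ.cut (show f (r s.1) ∈ σ.cut by rw [hs]; exact s.2)
      (show f (r t.1) ∈ σ.cut by rw [ht]; exact t.2)) _).trans ?_
  refine (congrArg f (enum_finMap _ _ r _ i)).trans ?_
  have hi := mem_inner.1 (enum (inner σ.cut s.1 t.1) i).2
  exact hr _ hi.1.le hi.2.1.le

lemma pushArr_lin {g : Fin m} {x y : k} {β β₁ β₂ : Arr (pullShape f σ h₀ h₁ ha hb)}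
    (h : IsLin g x y β β₁ β₂) (s t : σ.cut) (hst : s ≤ t)
    (hr : ∀ v, s.1 ≤ v → v ≤ t.1 → f (r v) = v) :
    (((r s.1).1 ≤ g.1 ∧ g.1 < (r t.1).1) → pushArr r β s t hst hr =
      x • pushArr r β₁ s t hst hr + y • pushArr r β₂ s t hst hr) ∧
    (¬ ((r s.1).1 ≤ g.1 ∧ g.1 < (r t.1).1) → pushArr r β₁ s t hst hr = pushArr r β s t hst hr ∧
      pushArr r β₂ s t hst hr = pushArr r β s t hst hr) := by
  have hs : r s.1 ∈ f ⁻¹' σ.cut := by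
    change f (r s.1) ∈ σ.cut
    rw [hr s.1 le_rfl hst]
    exact s.2
  have ht : r t.1 ∈ f ⁻¹' σ.cut := by
    change f (r t.1) ∈ σ.cut
    rw [hr t.1 hst le_rfl]
    exact t.2
  obtain ⟨h₁, h₂⟩ := h ⟨r s.1, hs⟩ ⟨r t.1, ht⟩ (r.monotone hst)
  refine ⟨fun hc => ?_, fun hc => ⟨?_, ?_⟩⟩
  · refine (congrArg (fun z => A.hcast _ _ (A.map _ z)) (h₁ hc)).trans ?_
    rw [map_add, map_smul, map_smul, map_add, map_smul, map_smul]
    rfl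
  · exact congrArg (fun z => A.hcast _ _ (A.map _ z)) (h₂ hc).1
  · exact congrArg (fun z => A.hcast _ _ (A.map _ z)) (h₂ hc).2

end Push

/-- The retraction onto the initial segment. -/
def leftRetr {p q n : ℕ} (_ : p + q = n) : Fin (n + 1) →o Fin (p + 1) where
  toFun i := ⟨min i.1 p, by omega⟩
  monotone' i j hij := Fin.mk_le_mk.2 (min_le_min_right p (Fin.le_def.1 hij))

/-- The retraction onto the final segment. -/
def rightRetr {p q n : ℕ} (h : p + q = n) : Fin (n + 1) →o Fin (q + 1) where
  toFun i := ⟨i.1 - p, by omega⟩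
  monotone' i j hij := Fin.mk_le_mk.2 (Nat.sub_le_sub_right (Fin.le_def.1 hij) p)

variable {p q n : ℕ} (h : p + q = n) {a b c : A.Obj} (σ : Shape A n a b)
  (hc : leftSeg h (Fin.last p) ∈ σ.cut) (hv : σ.vert ⟨leftSeg h (Fin.last p), hc⟩ = c)

/-- The left part of a shape. -/
abbrev leftShape : Shape A p a c := pullShape (leftSeg h) σ (σ.left_zero h) hc (σ.vert_left h) hv

/-- The right part of a shape. -/
abbrev rightShape : Shape A q c b :=
  pullShape (rightSeg h) σ hc (σ.right_last h) hv (σ.vert_right h)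

lemma left_leftRetr {v : Fin (n + 1)} (hv : v.1 ≤ p) : leftSeg h (leftRetr h v) = v :=
  Fin.ext (min_eq_left hv)

lemma right_rightRetr {v : Fin (n + 1)} (hv : p ≤ v.1) : rightSeg h (rightRetr h v) = v :=
  Fin.ext (Nat.add_sub_cancel' hv)

variable {h σ hc hv}

/-- The letters of a word given by its left and right parts. -/
def glueFam (β : Arr (leftShape h σ hc hv)) (γ : Arr (rightShape h σ hc hv)) : LetterFam σ :=
  fun s t hst =>
    -- Letters below `p` come from `β` and letters above `p` from `γ`. A pair with `p` strictly
    -- between is never consecutive, because `p` belongs to `cut`, so its value `0` does not enter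
    -- the tuple.
    if ht : t.1.1 ≤ p then pushArr (leftRetr h) β s t hst.le fun _ _ hv' =>
      left_leftRetr h ((Fin.le_def.1 hv').trans ht)
    else if hs : p ≤ s.1.1 then pushArr (rightRetr h) γ s t hst.le fun _ hv' _ =>
      right_rightRetr h (hs.trans (Fin.le_def.1 hv'))
    else 0

lemma glue_pull (α : Arr σ) :
    build (glueFam (pullArr (leftSeg h) α (σ.left_zero h) hc (σ.vert_left h) hv)
      (pullArr (rightSeg h) α hc (σ.right_last h) hv (σ.vert_right h))) = α := by
  refine build_eq _ α fun s v hsv hmin => ?_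
  unfold glueFam
  split_ifs with h₁ h₂
  · exact pushArr_pullArr _ _ _ _ _ _
  · exact pushArr_pullArr _ _ _ _ _ _
  -- Here `p` would lie strictly between consecutive elements of `cut`, although it belongs to
  -- `cut`.
  · have : v.1.1 ≤ p := Fin.le_def.1 (hmin ⟨_, hc⟩ (Nat.lt_of_not_le h₂))
    exact absurd this h₁

/-- A gap of the left part is the same gap of the glued word. Letters from the right part do not
contain it, and the values on pairs across `p` are zero in all three families. On the right the same
holds with the gap shifted by `p`. -/
lemma glue_lin_left {g : Fin p} {x y : k} {β β₁ β₂ : Arr (leftShape h σ hc hv)}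
    (hl : IsLin g x y β β₁ β₂) (γ : Arr (rightShape h σ hc hv)) :
    IsLin ⟨g.1, by omega⟩ x y (build (glueFam β γ)) (build (glueFam β₁ γ))
      (build (glueFam β₂ γ)) := by
  refine isLin_build fun s t hst => ?_
  have hst' : s.1.1 < t.1.1 := hst
  unfold glueFam
  split_ifs with h₁ h₂
  · have key := pushArr_lin (leftRetr h) hl s t hst.le fun _ _ hv' =>
      left_leftRetr h ((Fin.le_def.1 hv').trans h₁)
    have e₁ : (leftRetr h s.1).1 = s.1.1 := min_eq_left (by omega)
    have e₂ : (leftRetr h t.1).1 = t.1.1 := min_eq_left h₁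
    rwa [e₁, e₂] at key
  · exact ⟨fun hc => by have := g.2; simp only at hc; omega, fun _ => ⟨rfl, rfl⟩⟩
  · exact ⟨fun _ => by rw [smul_zero, smul_zero, add_zero], fun _ => ⟨rfl, rfl⟩⟩

lemma glue_lin_right {g : Fin q} {x y : k} (β : Arr (leftShape h σ hc hv))
    {γ γ₁ γ₂ : Arr (rightShape h σ hc hv)} (hl : IsLin g x y γ γ₁ γ₂) :
    IsLin ⟨p + g.1, by omega⟩ x y (build (glueFam β γ)) (build (glueFam β γ₁))
      (build (glueFam β γ₂)) := by
  refine isLin_build fun s t hst => ?_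
  have hst' : s.1.1 < t.1.1 := hst
  unfold glueFam
  split_ifs with h₁ h₂
  · exact ⟨fun hc => by simp only at hc; omega, fun _ => ⟨rfl, rfl⟩⟩
  · have key := pushArr_lin (rightRetr h) hl s t hst.le fun _ hv' _ =>
      right_rightRetr h (h₂.trans (Fin.le_def.1 hv'))
    have e : ((rightRetr h s.1).1 ≤ g.1 ∧ g.1 < (rightRetr h t.1).1) ↔
        (s.1.1 ≤ p + g.1 ∧ p + g.1 < t.1.1) := by
      change (s.1.1 - p ≤ g.1 ∧ g.1 < t.1.1 - p) ↔ _
      omega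
    rwa [e] at key
  · exact ⟨fun _ => by rw [smul_zero, smul_zero, add_zero], fun _ => ⟨rfl, rfl⟩⟩

variable (h σ hc hv)

open Classical in
/-- Gluing a tuple and a word, with values in the tensor product of a given shape. -/
def glueRight (β : Arr (leftShape h σ hc hv)) : tmod A q c b →ₗ[k] Tens σ :=
  -- Keeping only one right shape, and one left shape in `glue`, makes the target the single summand
  -- of `σ`. The result is a retraction for that summand and not a map to all words.
  tlift (fun τ γ => if e : τ = rightShape h σ hc hv then
    pureTensor (build (glueFam β (e ▸ γ))) else 0) (by
    intro τ g r r' γ γ₁ γ₂ hl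
    by_cases e : τ = rightShape h σ hc hv
    · subst e
      simp only [dite_true]
      exact pureTensor_lin (glue_lin_right β hl)
    · simp only [dif_neg e, smul_zero, add_zero])

lemma glueRight_word (β : Arr (leftShape h σ hc hv)) (γ : Arr (rightShape h σ hc hv)) :
    glueRight h σ hc hv β (word _ γ) = pureTensor (build (glueFam β γ)) := by
  classical
  exact (tlift_word _ _ _ _).trans (dif_pos rfl)

lemma glueRight_word_of_ne (β : Arr (leftShape h σ hc hv)) {τ : Shape A q c b} (γ : Arr τ)
    (e : τ ≠ rightShape h σ hc hv) : glueRight h σ hc hv β (word _ γ) = 0 := by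
  classical
  exact (tlift_word _ _ _ _).trans (dif_neg e)

open Classical in
/-- Gluing words, with values in the tensor product of a given shape. -/
def glue : tmod A p a c →ₗ[k] tmod A q c b →ₗ[k] Tens σ :=
  tlift (fun τ β => if e : τ = leftShape h σ hc hv then glueRight h σ hc hv (e ▸ β) else 0) (by
    intro τ g r r' β β₁ β₂ hl
    by_cases e : τ = leftShape h σ hc hv
    · subst e
      simp only [dite_true]
      refine LinearMap.ext (text fun τ' γ => ?_)
      rw [LinearMap.add_apply, LinearMap.smul_apply, LinearMap.smul_apply]
      by_cases e' : τ' = rightShape h σ hc hv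
      · subst e'
        rw [glueRight_word, glueRight_word, glueRight_word]
        exact pureTensor_lin (glue_lin_left hl γ)
      · rw [glueRight_word_of_ne _ _ _ _ _ _ e', glueRight_word_of_ne _ _ _ _ _ _ e',
          glueRight_word_of_ne _ _ _ _ _ _ e', smul_zero, smul_zero, add_zero]
    · simp only [dif_neg e, smul_zero, add_zero])

lemma glue_word (β : Arr (leftShape h σ hc hv)) :
    glue h σ hc hv (word _ β) = glueRight h σ hc hv β := by
  classical
  exact (tlift_word _ _ _ _).trans (dif_pos rfl)

lemma glue_word_of_ne {τ : Shape A p a c} (β : Arr τ) (e : τ ≠ leftShape h σ hc hv) :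
    glue h σ hc hv (word _ β) = 0 := by
  classical
  exact (tlift_word _ _ _ _).trans (dif_neg e)

open Classical in
/-- A retraction of a component of the comultiplication. -/
def comulRetr : qtensor (tmod A p) (tmod A q) a b →ₗ[k] Tens σ :=
  qlift fun c => if hv : σ.vert ⟨leftSeg h (Fin.last p), hc⟩ = c then
    TensorProduct.lift (glue h σ hc hv) else 0

open Classical in
/-- The component of a sum of words of a given shape. -/
def component : tmod A n a b →ₗ[k] Tens σ :=
  DirectSum.component k (Shape A n a b) (fun σ => Tens σ) σ

lemma component_word (α : Arr σ) : component σ (word σ α) = pureTensor α := by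
  classical
  exact DirectSum.component.lof_self k (M := fun σ : Shape A n a b => Tens σ) σ (pureTensor α)

lemma component_word_of_ne {σ' : Shape A n a b} (α : Arr σ') (e : σ' ≠ σ) :
    component σ (word σ' α) = 0 := by
  classical
  refine (DirectSum.component.of k (M := fun σ : Shape A n a b => Tens σ) σ σ'
    (pureTensor α)).trans ?_
  exact dif_neg e

lemma eq_zero_of_component {x : tmod A n a b} (hx : ∀ σ, component σ x = 0) : x = 0 := by
  classical
  exact DFinsupp.ext hx

lemma Shape.vert_congr {n : ℕ} {a b : A.Obj} {σ τ : Shape A n a b} (e : σ = τ) {s : Fin (n + 1)}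
    (hs : s ∈ σ.cut) (hs' : s ∈ τ.cut) : σ.vert ⟨s, hs⟩ = τ.vert ⟨s, hs'⟩ := by
  subst e
  rfl

lemma Shape.ext_of {n : ℕ} {a b : A.Obj} {σ τ : Shape A n a b} (e : ∀ s, s ∈ σ.cut ↔ s ∈ τ.cut)
    (e' : ∀ s (hs : s ∈ σ.cut) (hs' : s ∈ τ.cut), σ.vert ⟨s, hs⟩ = τ.vert ⟨s, hs'⟩) : σ = τ := by
  obtain ⟨cut, h₀, h₁, vert, hv, hv'⟩ := σ
  obtain ⟨cut', h₀', h₁', vert', hw, hw'⟩ := τ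
  obtain rfl : cut = cut' := Set.ext e
  obtain rfl : vert = vert' := funext fun s => e' s.1 s.2 s.2
  rfl

lemma glue_eq_zero {τ : Shape A p a c} {τ' : Shape A q c b} (β : Arr τ) (γ : Arr τ')
    (e : τ = leftShape h σ hc hv) (e' : τ' ≠ rightShape h σ hc hv) :
    glue h σ hc hv (word τ β) (word τ' γ) = 0 := by
  subst e
  exact (LinearMap.congr_fun (glue_word h σ hc hv β) _).trans
    (glueRight_word_of_ne h σ hc hv β γ e')

/-- Every vertex lies in one of the two segments, so a shape is recovered from its halves. Words of
a shape other than `σ` thus cannot contribute to the gluing in `component_eq`. -/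
lemma Shape.ext_parts {σ τ : Shape A n a b} (hc : leftSeg h (Fin.last p) ∈ σ.cut)
    (hv : σ.vert ⟨leftSeg h (Fin.last p), hc⟩ = c) (hc' : leftSeg h (Fin.last p) ∈ τ.cut)
    (hv' : τ.vert ⟨leftSeg h (Fin.last p), hc'⟩ = c)
    (hl : leftShape h σ hc hv = leftShape h τ hc' hv')
    (hr : rightShape h σ hc hv = rightShape h τ hc' hv') : σ = τ := by
  have key : ∀ s : Fin (n + 1), (∃ i, s = leftSeg h i) ∨ ∃ i, s = rightSeg h i := by
    intro s
    by_cases hs : s.1 ≤ p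
    · exact Or.inl ⟨_, (left_leftRetr h hs).symm⟩
    · exact Or.inr ⟨_, (right_rightRetr h (not_le.1 hs).le).symm⟩
  refine Shape.ext_of (fun s => ?_) fun s hs hs' => ?_
  · rcases key s with ⟨i, rfl⟩ | ⟨i, rfl⟩
    · exact Set.ext_iff.1 (congrArg Shape.cut hl) i
    · exact Set.ext_iff.1 (congrArg Shape.cut hr) i
  · rcases key s with ⟨i, rfl⟩ | ⟨i, rfl⟩
    · exact Shape.vert_congr hl (s := i) hs hs'
    · exact Shape.vert_congr hr (s := i) hs hs'

lemma comulRetr_qincl (x : tmod A p a c) (y : tmod A q c b) :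
    comulRetr h σ hc (qincl (tmod A p) (tmod A q) a b c (x ⊗ₜ y)) = glue h σ hc hv x y := by
  classical
  rw [comulRetr, qlift_qincl, dif_pos hv]
  rfl

/-- The comultiplication at a vertex of `cut` has a left inverse on the summand of `σ`: gluing the
two halves of a word returns the word (`glue_pull`). Words of another shape are killed, because they
are not cut at `p`, or have another object there, or have another half. The explicit retraction
works over any commutative ring. -/
lemma component_eq (x : tmod A n a b) :
    component σ x = comulRetr h σ hc (tComul A h a b x) := by
  refine text (f := component σ) (g := comulRetr h σ hc ∘ₗ tComul A h a b) (fun τ α => ?_) x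
  rw [LinearMap.comp_apply]
  by_cases hp : leftSeg h (Fin.last p) ∈ τ.cut
  · by_cases hw : σ.vert ⟨leftSeg h (Fin.last p), hc⟩ = τ.vert ⟨leftSeg h (Fin.last p), hp⟩
    · refine Eq.trans ?_ (congrArg (comulRetr h σ hc) (tComul_word_of_mem h τ α hp _ rfl)).symm
      refine Eq.trans ?_ (comulRetr_qincl h σ hc hw _ _).symm
      by_cases hl : leftShape h τ hp rfl = leftShape h σ hc hw
      · by_cases hr : rightShape h τ hp rfl = rightShape h σ hc hw
        · obtain rfl := Shape.ext_parts h _ _ _ _ hl hr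
          refine (component_word τ α).trans ?_
          refine Eq.trans ?_ (LinearMap.congr_fun (glue_word h τ hc rfl _) _).symm
          refine Eq.trans ?_ (glueRight_word h τ hc rfl _ _).symm
          rw [glue_pull]
        · rw [component_word_of_ne σ α (fun e => hr (by subst e; rfl))]
          exact (glue_eq_zero h σ hc hw _ _ hl hr).symm
      · rw [component_word_of_ne σ α (fun e => hl (by subst e; rfl))]
        exact (LinearMap.congr_fun (glue_word_of_ne h σ hc hw _ hl) _).symm
    · rw [component_word_of_ne σ α (fun e => hw (by subst e; rfl))]
      classical
      refine Eq.trans ?_ (congrArg (comulRetr h σ hc) (tComul_word_of_mem h τ α hp _ rfl)).symm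
      rw [comulRetr, qlift_qincl, dif_neg hw]
      rfl
  · rw [tComul_word_of_notMem h τ α hp, map_zero]
    exact component_word_of_ne σ α fun e => hp (e ▸ hc)

end Gluing

/-! ### Recovering one-letter words, and detecting sums of words. -/

noncomputable section OneLetter

variable {k : Type u} [CommRing k] {A : AugCat.{u} k}

/-- The positions, relative to `s`, of the vertices between `s` and `t` that are not in `cut`. -/
def pos {n d : ℕ} (cut : Set (Fin (n + 1))) {s t : Fin (n + 1)} (hd : t.1 ≤ s.1 + d + 1) :
    Fin (inner cut s t).card →o Fin d where
  toFun i := ⟨(enum _ i).1.1 - s.1 - 1, by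
    have h₁ := Fin.lt_def.1 (mem_inner.1 (enum (inner cut s t) i).2).1
    have h₂ := Fin.lt_def.1 (mem_inner.1 (enum (inner cut s t) i).2).2.1
    omega⟩
  monotone' i j hij := Fin.mk_le_mk.2 (Nat.sub_le_sub_right (Nat.sub_le_sub_right
    (Fin.le_def.1 (Subtype.mk_le_mk.1 ((enum (inner cut s t)).monotone hij))) _) _)

lemma pos_val {n d : ℕ} (cut : Set (Fin (n + 1))) {s t : Fin (n + 1)} (hd : t.1 ≤ s.1 + d + 1)
    (i : Fin (inner cut s t).card) : s.1 + (pos cut hd i).1 + 1 = (enum _ i).1.1 := by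
  have h₁ := Fin.lt_def.1 (mem_inner.1 (enum (inner cut s t) i).2).1
  change s.1 + ((enum _ i).1.1 - s.1 - 1) + 1 = _
  omega

section

variable {m : ℕ} {a b : A.Obj} (σ : Shape A (m + 1) a b)

open Classical in
/-- The family of letters of a shape given by a single element. -/
def oneFam (g : A.hom a b m) : LetterFam σ := fun s t _ =>
  -- When `cut` has no inner vertex, the two endpoints are the only consecutive pair; the other
  -- values are defaults.
  if h : s = σ.first ∧ t = σ.final then
    A.hcast (by rw [h.1, σ.vert_zero]) (by rw [h.2, σ.vert_last])
      (A.map (pos σ.cut (by rw [h.1, h.2, Fin.val_last]; omega)) g)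
  else 0

lemma oneFam_eq (g : A.hom a b m) {s t : σ.cut} (hst : s < t) (h : s = σ.first ∧ t = σ.final) :
    oneFam σ g s t hst = A.hcast (by rw [h.1, σ.vert_zero]) (by rw [h.2, σ.vert_last])
      (A.map (pos σ.cut (by rw [h.1, h.2, Fin.val_last]; omega)) g) :=
  dif_pos h

lemma oneFam_eq_zero (g : A.hom a b m) {s t : σ.cut} (hst : s < t)
    (h : ¬ (s = σ.first ∧ t = σ.final)) : oneFam σ g s t hst = 0 :=
  dif_neg h

/-- The only possibly nonzero value of the family sits on the pair of endpoints, which spans every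
gap. Any gap would serve; gap `0` always exists. -/
lemma isLin_oneFam (r r' : k) (g g' : A.hom a b m) :
    IsLin (0 : Fin (m + 1)) r r' (build (oneFam σ (r • g + r' • g'))) (build (oneFam σ g))
      (build (oneFam σ g')) := by
  refine isLin_build fun s t hst => ?_
  by_cases h : s = σ.first ∧ t = σ.final
  · refine ⟨fun _ => ?_, fun hc => absurd ⟨?_, ?_⟩ hc⟩
    · rw [oneFam_eq σ _ hst h, oneFam_eq σ _ hst h, oneFam_eq σ _ hst h, map_add, map_smul,
        map_smul, map_add, map_smul, map_smul]
    · rw [h.1]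
      exact le_rfl
    · rw [h.2]
      exact Nat.succ_pos m
  · rw [oneFam_eq_zero σ _ hst h, oneFam_eq_zero σ _ hst h, oneFam_eq_zero σ _ hst h]
    exact ⟨fun _ => by rw [smul_zero, smul_zero, add_zero], fun _ => ⟨rfl, rfl⟩⟩

/-- The pure tensor of one letter. -/
def oneTensor : A.hom a b m →ₗ[k] Tens σ where
  toFun g := pureTensor (build (oneFam σ g))
  map_add' g g' := by
    have := pureTensor_lin (isLin_oneFam σ 1 1 g g')
    rwa [one_smul, one_smul, one_smul, one_smul] at this
  map_smul' r g := by
    -- Homogeneity is the linearity relation with second coefficient and second letter zero.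
    have := pureTensor_lin (isLin_oneFam σ r 0 g 0)
    rwa [zero_smul, zero_smul, add_zero, add_zero] at this

variable {σ}

lemma Shape.Avoids.eq_or_eq (h : σ.Avoids OrderHom.id) {v : Fin (m + 1 + 1)} (hv : v ∈ σ.cut) :
    v = 0 ∨ v = Fin.last _ := by
  by_contra! hc
  obtain ⟨i, rfl⟩ := exists_innerVertex hc.1 hc.2
  exact h i hv

/-- With no inner vertex in `cut`, the single letter already lives on all inner vertices. Reading it
there and restricting back along `pos` is the identity operator. -/
lemma build_oneFam (h : σ.Avoids OrderHom.id) (α : Arr σ) :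
    build (oneFam σ (evalAlong α OrderHom.id σ.id_first σ.id_final σ.vert_zero σ.vert_last)) =
      α := by
  refine build_eq _ α fun s v hsv _ => ?_
  have hsv' : s.1 < v.1 := hsv
  have e : s = σ.first ∧ v = σ.final := by
    rcases h.eq_or_eq s.2 with hs | hs
    · refine ⟨Subtype.ext hs, ?_⟩
      rcases h.eq_or_eq v.2 with hv | hv
      · rw [hs, hv] at hsv'
        exact absurd hsv' (lt_irrefl _)
      · exact Subtype.ext hv
    · rw [hs] at hsv'
      exact absurd hsv' (Fin.le_last _).not_gt
  obtain ⟨rfl, rfl⟩ := e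
  rw [oneFam_eq σ _ hsv ⟨rfl, rfl⟩, evalAlong_of _ _ _ _ _ _ h, ← A.hcast_map, A.hcast_hcast,
    ← A.map_comp]
  refine (α.hcast_arr rfl rfl _ hsv.le _ _ _ OrderHom.id fun i => ?_).trans (A.map_id _)
  refine (enum_idx _ _ _ _).trans (Fin.ext ?_)
  change (pos σ.cut _ i).1 + 1 = _
  have := pos_val (d := m) σ.cut (s := σ.first.1) (t := σ.final.1) (by
    change m + 1 ≤ 0 + m + 1
    omega) i
  change 0 + _ + 1 = _ at this
  rw [zero_add] at this
  exact this

/-- A shape whose `cut` is just the two endpoints is unique, so its summand is exactly the part seen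
by `proj`. On every other shape both sides vanish. -/
lemma component_eq_of_avoids (h : σ.Avoids OrderHom.id) (x : tmod A (m + 1) a b) :
    component σ x = oneTensor σ (proj A m a b x) := by
  refine text (f := component σ) (g := oneTensor σ ∘ₗ proj A m a b) (fun τ α => ?_) x
  rw [LinearMap.comp_apply, proj_word]
  by_cases e : τ = σ
  · subst e
    rw [component_word]
    exact (congrArg pureTensor (build_oneFam h α)).symm
  · rw [component_word_of_ne σ α e, evalAlong_of_not, map_zero]
    intro h'
    refine e (Shape.ext_of (fun s => ⟨fun hs => ?_, fun hs => ?_⟩) fun s hs hs' => ?_)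
    · rcases h'.eq_or_eq hs with rfl | rfl
      exacts [σ.zero_mem, σ.last_mem]
    · rcases h.eq_or_eq hs with rfl | rfl
      exacts [τ.zero_mem, τ.last_mem]
    · rcases h.eq_or_eq hs' with rfl | rfl
      exacts [τ.vert_zero.trans σ.vert_zero.symm, τ.vert_last.trans σ.vert_last.symm]

end

/-- A sum of words vanishes if its components with one letter and all its comultiplications
vanish. -/
lemma eq_zero_of_proj_of_tComul {m : ℕ} {a b : A.Obj} {x : tmod A (m + 1) a b}
    (hp : proj A m a b x = 0)
    (hc : ∀ p q (h : p + q = m + 1), 0 < p → 0 < q → tComul A h a b x = 0) : x = 0 := by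
  refine eq_zero_of_component fun σ => ?_
  -- Each component is detected in one of two ways: by `proj` if the shape has one letter, and
  -- otherwise by the comultiplication at an inner vertex of `cut`, here the vertex `i + 1`.
  by_cases hσ : σ.Avoids OrderHom.id
  · rw [component_eq_of_avoids hσ, hp, map_zero]
  · unfold Shape.Avoids at hσ
    push Not at hσ
    obtain ⟨i, hi⟩ := hσ
    have h : (i.1 + 1) + (m - i.1) = m + 1 := by omega
    rw [component_eq h σ hi, hc _ _ h (Nat.succ_pos _) (by omega), map_zero]

end OneLetter

/-! ### Words cut out of one family of letters. -/

noncomputable section LetterWords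

variable {k : Type u} [CommRing k] {A : AugCat.{u} k}

namespace AugCat

/-- The degree of a member is the cardinality of a set that depends on `cut`. For two cuts that
agree on an interval these degrees are equal only propositionally, hence the comparison by `HEq`. -/
lemma one'_heq (A : AugCat.{u} k) (x : A.Obj) {m n : ℕ} (hm : m = 0) (hn : n = 0) :
    HEq (A.one' x hm) (A.one' x hn) := by
  subst hm hn
  rfl

lemma comp_heq (A : AugCat.{u} k) {x y z : A.Obj} {p q n p' q' n' : ℕ} (h : p + q = n)
    (h' : p' + q' = n') (hp : p = p') (hq : q = q') {a : A.hom x y p} {b : A.hom y z q}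
    {a' : A.hom x y p'} {b' : A.hom y z q'} (ha : HEq a a') (hb : HEq b b') :
    HEq (A.comp h a b) (A.comp h' a' b') := by
  subst hp hq h h'
  rw [eq_of_heq ha, eq_of_heq hb]

lemma map_heq (A : AugCat.{u} k) {x y : A.Obj} {p p' d : ℕ} (hp : p = p') (φ : Fin p →o Fin d)
    (φ' : Fin p' →o Fin d) (h : ∀ i : Fin p, φ i = φ' (Fin.cast hp i)) (a : A.hom x y d) :
    HEq (A.map φ a) (A.map φ' a) := by
  subst hp
  obtain rfl : φ = φ' := OrderHom.ext _ _ (funext h)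
  rfl

end AugCat

lemma enum_congr {n : ℕ} {S S' : Finset (Fin n)} (e : S = S') (i : Fin S.card) :
    (enum S i).1 = (enum S' (Fin.cast (congrArg Finset.card e) i)).1 := by
  subst e
  rfl

lemma inner_congr {n : ℕ} {K K' : Set (Fin (n + 1))} {s t : Fin (n + 1)}
    (h : ∀ v, s ≤ v → v ≤ t → (v ∈ K ↔ v ∈ K')) : inner K s t = inner K' s t := by
  ext u
  rw [mem_inner, mem_inner]
  refine ⟨fun ⟨h₁, h₂, h₃⟩ => ⟨h₁, h₂, fun hu => h₃ ((h u h₁.le h₂.le).2 hu)⟩,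
    fun ⟨h₁, h₂, h₃⟩ => ⟨h₁, h₂, fun hu => h₃ ((h u h₁.le h₂.le).1 hu)⟩⟩

/-- Words with the same letters agree. -/
lemma word_congr {n : ℕ} {a b : A.Obj} {σ τ : Shape A n a b} {α : Arr σ} {β : Arr τ}
    (hc : ∀ s, s ∈ σ.cut ↔ s ∈ τ.cut)
    (hv : ∀ s (hs : s ∈ σ.cut) (hs' : s ∈ τ.cut), σ.vert ⟨s, hs⟩ = τ.vert ⟨s, hs'⟩)
    (h : ∀ s t (hst : s ≤ t) (hs : s ∈ σ.cut) (ht : t ∈ σ.cut) (hs' : s ∈ τ.cut)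
      (ht' : t ∈ τ.cut), HEq (α.arr ⟨s, hs⟩ ⟨t, ht⟩ hst) (β.arr ⟨s, hs'⟩ ⟨t, ht'⟩ hst)) :
    word σ α = word τ β := by
  obtain rfl : σ = τ := Shape.ext_of hc hv
  obtain rfl : α = β := Arr.ext' fun s t hst => eq_of_heq (h s.1 t.1 hst s.2 t.2 s.2 t.2)
  rfl

variable {n : ℕ} (x : Fin (n + 1) → A.Obj)

/-- The shape with given `cut` and with objects given by a family indexed by all vertices. -/
def famShape (K : Set (Fin (n + 1))) (h₀ : 0 ∈ K) (h₁ : Fin.last n ∈ K) :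
    Shape A n (x 0) (x (Fin.last n)) where
  cut := K
  zero_mem := h₀
  last_mem := h₁
  vert s := x s.1
  vert_zero := rfl
  vert_last := rfl

variable {x}

variable (ℓ : ∀ s t : Fin (n + 1), A.hom (x s) (x t) (t.1 - s.1 - 1)) {K K' : Set (Fin (n + 1))}
  (h₀ : 0 ∈ K) (h₁ : Fin.last n ∈ K) (h₀' : 0 ∈ K') (h₁' : Fin.last n ∈ K')

/-- The letters of a shape obtained by restriction from letters between all pairs of vertices. -/
def famLetters : LetterFam (famShape x K h₀ h₁) := fun s t _ =>
  -- For consecutive `s < t` in `K` all vertices in between are outside `K`, so `pos` is only a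
  -- relabelling of the `t - s - 1` inner vertices. Values of `ℓ` at pairs with `t ≤ s` never occur.
  A.map (pos K (by omega)) (ℓ s.1 t.1)

/-- The tuple with these letters. -/
def famArr : Arr (famShape x K h₀ h₁) := build (famLetters ℓ h₀ h₁)

/-- The member between `s` and `t` is the composite of the letters in that interval, so it sees only
the part of the cut lying there. The proof descends from `t` one letter at a time. -/
lemma famArr_heq (s t : Fin (n + 1)) (hst : s ≤ t) (hs : s ∈ K) (ht : t ∈ K) (hs' : s ∈ K')
    (ht' : t ∈ K') (h : ∀ v, s ≤ v → v ≤ t → (v ∈ K ↔ v ∈ K')) :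
    HEq ((famArr ℓ h₀ h₁).arr ⟨s, hs⟩ ⟨t, ht⟩ hst)
      ((famArr ℓ h₀' h₁').arr ⟨s, hs'⟩ ⟨t, ht'⟩ hst) := by
  -- The endpoints are bundled with their membership in `K`, the form needed for `Shape.induction`.
  have key : ∀ (s t : (famShape x K h₀ h₁).cut) (hst : s ≤ t) (hs' : s.1 ∈ K') (ht' : t.1 ∈ K'),
      (∀ v, s.1 ≤ v → v ≤ t.1 → (v ∈ K ↔ v ∈ K')) →
      HEq ((famArr ℓ h₀ h₁).arr s t hst) ((famArr ℓ h₀' h₁').arr ⟨s.1, hs'⟩ ⟨t.1, ht'⟩ hst) := by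
    intro s t hst
    induction s, hst using Shape.induction with
    | h₀ =>
      intro hs' ht' _
      rw [Arr.arr_self, Arr.arr_self]
      exact A.one'_heq _ _ _
    | h₁ s v hv hvt hmin ih =>
      intro hs' ht' h
      have hv' : v.1 ∈ K' := (h v.1 (le_of_lt hv) hvt).1 v.2
      rw [← Arr.arr_comp _ s v t hv.le hvt, ← Arr.arr_comp (famArr ℓ h₀' h₁') ⟨s.1, hs'⟩ ⟨v.1, hv'⟩
        ⟨t.1, ht'⟩ hv.le hvt]
      have e₁ : inner K s.1 v.1 = inner K' s.1 v.1 :=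
        inner_congr fun w hw hw' => h w hw (hw'.trans hvt)
      have e₂ : inner K v.1 t.1 = inner K' v.1 t.1 :=
        inner_congr fun w hw hw' =>
          h w (le_trans (le_of_lt (show s.1 < v.1 from hv)) hw) hw'
      refine A.comp_heq _ _ (congrArg Finset.card e₁) (congrArg Finset.card e₂) ?_
        (ih hv' ht' fun w hw hw' => h w (le_trans (le_of_lt (show s.1 < v.1 from hv)) hw) hw')
      rw [famArr, famArr, build_next _ hv hmin, build_next _ (show
        (⟨s.1, hs'⟩ : (famShape x K' h₀' h₁').cut) < ⟨v.1, hv'⟩ from hv) fun w hw => ?_]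
      · refine A.map_heq (congrArg Finset.card e₁) _ _ (fun i => Fin.ext ?_) _
        exact congrArg (fun u : Fin (n + 1) => u.1 - s.1.1 - 1) (enum_congr e₁ i)
      -- `v` is also the successor of `s` in `K'`: up to `t` the two cuts agree, and anything beyond
      -- `t` is above `v` anyway.
      · change v.1 ≤ w.1
        by_cases hw' : w.1 ≤ t.1
        · exact hmin ⟨w.1, (h w.1 (le_of_lt hw) hw').2 w.2⟩ hw
        · exact le_trans hvt (not_le.1 hw').le
  exact key ⟨s, hs⟩ ⟨t, ht⟩ hst hs' ht' h

variable {h₀ h₁ h₀' h₁'} {m : ℕ} (y : Fin (m + 1) →o Fin (n + 1)) {s t : Fin (n + 1)}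

variable (h₀ h₁) in
/-- The restriction along a simplex of the word with letters `ℓ`. -/
def famWord (hs : y 0 = s) (ht : y (Fin.last m) = t) (hs' : s ∈ K) (ht' : t ∈ K) :
    tmod A m (x s) (x t) :=
  pull y (famArr ℓ h₀ h₁) (by rwa [hs]) (by rwa [ht]) (congrArg x hs) (congrArg x ht)

/-- `y` takes values in the interval from `s` to `t`, so restriction along `y` forgets the cut
elsewhere. This allows a half of a word to be rewritten with a cut adapted to that half. -/
lemma famWord_congr (hs : y 0 = s) (ht : y (Fin.last m) = t) (hs' : s ∈ K) (ht' : t ∈ K)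
    (hs'' : s ∈ K') (ht'' : t ∈ K') (h : ∀ v, s ≤ v → v ≤ t → (v ∈ K ↔ v ∈ K')) :
    famWord ℓ h₀ h₁ y hs ht hs' ht' = famWord ℓ h₀' h₁' y hs ht hs'' ht'' := by
  have hy : ∀ v, y v ∈ K ↔ y v ∈ K' := fun v =>
    h _ (by rw [← hs]; exact y.monotone (Fin.zero_le v))
      (by rw [← ht]; exact y.monotone (Fin.le_last v))
  refine word_congr hy (fun _ _ _ => rfl) fun v w hvw hv hw hv' hw' => ?_
  have hK : ∀ u, y v ≤ u → u ≤ y w → (u ∈ K ↔ u ∈ K') := fun u hu hu' =>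
    h u ((by rw [← hs]; exact y.monotone (Fin.zero_le v) : s ≤ y v).trans hu)
      (hu'.trans (by rw [← ht]; exact y.monotone (Fin.le_last w)))
  have e : inner (y ⁻¹' K) v w = inner (y ⁻¹' K') v w := inner_congr fun u _ _ => hy u
  have e' : inner K (y v) (y w) = inner K' (y v) (y w) := inner_congr hK
  have key : ∀ {p q p' q' : ℕ} (hp : p = p') (hq : q = q') (φ : Fin p →o Fin q)
      (φ' : Fin p' →o Fin q') (g : A.hom (x (y v)) (x (y w)) q)
      (g' : A.hom (x (y v)) (x (y w)) q'), (∀ i, (φ i).1 = (φ' (Fin.cast hp i)).1) → HEq g g' →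
      HEq (A.map φ g) (A.map φ' g') := by
    intro p q p' q' hp hq φ φ' g g' hφ hg
    subst hp hq
    obtain rfl : φ = φ' := OrderHom.ext _ _ (funext fun i => Fin.ext (hφ i))
    rw [eq_of_heq hg]
  refine key (congrArg Finset.card e) (congrArg Finset.card e') _ _ _ _ (fun i => ?_)
    (famArr_heq ℓ h₀ h₁ h₀' h₁' _ _ (y.monotone hvw) hv hw hv' hw' hK)
  have e₁ : (finMap (inner (y ⁻¹' K) v w) (inner K (y v) (y w)) y
      (map_inner y K hv hw) i) = Fin.cast (congrArg Finset.card e').symm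
      (finMap (inner (y ⁻¹' K') v w) (inner K' (y v) (y w)) y
      (map_inner y K' hv' hw') (Fin.cast (congrArg Finset.card e) i)) := by
    apply enum_injective
    rw [enum_finMap, enum_congr e'.symm.symm]
    refine Eq.trans ?_ (enum_finMap (inner (y ⁻¹' K') v w) (inner K' (y v) (y w)) y
      (map_inner y K' hv' hw') (Fin.cast (congrArg Finset.card e) i)).symm
    exact congrArg y (enum_congr e i)
  exact congrArg Fin.val e₁

lemma tMap_famWord {l : ℕ} (f : FinInt l m) (hs : y 0 = s) (ht : y (Fin.last m) = t) (hs' : s ∈ K)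
    (ht' : t ∈ K) :
    tMap A f _ _ (famWord ℓ h₀ h₁ y hs ht hs' ht') =
      famWord ℓ h₀ h₁ (y.comp f.toHom) ((congrArg y f.map_zero).trans hs)
        ((congrArg y f.map_last).trans ht) hs' ht' :=
  (tMap_word f _ _).trans (pull_pull _ _ _ rfl _ _ _ _ _)

lemma tComul_famWord_of_mem {p q : ℕ} (h : p + q = m) (hs : y 0 = s) (ht : y (Fin.last m) = t)
    (hs' : s ∈ K) (ht' : t ∈ K) {c : Fin (n + 1)} (hc : y (leftSeg h (Fin.last p)) = c)
    (hc' : c ∈ K) :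
    tComul A h _ _ (famWord ℓ h₀ h₁ y hs ht hs' ht') = qincl (tmod A p) (tmod A q) _ _ (x c)
      (famWord ℓ h₀ h₁ (y.comp (leftSeg h)) hs hc hs' hc' ⊗ₜ
        famWord ℓ h₀ h₁ (y.comp (rightSeg h)) hc ((congrArg y (rightSeg_last h)).trans ht) hc' ht') := by
  refine (tComul_word_of_mem h _ _ (by subst hc; exact hc') (x c) (congrArg x hc)).trans ?_
  refine congrArg (qincl _ _ _ _ _) (congrArg₂ (fun x y => x ⊗ₜ y) ?_ ?_)
  · exact pull_pull _ _ _ rfl _ _ _ _ _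
  · exact pull_pull _ _ _ rfl _ _ _ _ _

lemma tComul_famWord_of_notMem {p q : ℕ} (h : p + q = m) (hs : y 0 = s)
    (ht : y (Fin.last m) = t) (hs' : s ∈ K) (ht' : t ∈ K)
    (hc : y (leftSeg h (Fin.last p)) ∉ K) :
    tComul A h _ _ (famWord ℓ h₀ h₁ y hs ht hs' ht') = 0 :=
  tComul_word_of_notMem h _ _ hc

end LetterWords

/-! ### The group-like sum of all words over an interval. -/

noncomputable section WordSum

variable {k : Type u} [CommRing k] {A : AugCat.{u} k}

/-- The vertices that are not in `D` or not strictly between `s` and `t`. -/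
def cutOf {n : ℕ} (s t : Fin (n + 1)) (D : Finset (Fin (n + 1))) : Set (Fin (n + 1)) :=
  -- Outside the open interval every vertex is kept. This places `0` and the last vertex in the cut,
  -- and it is harmless by `famWord_congr`.
  { v | s < v → v < t → v ∉ D }

section

variable {n : ℕ} {s t : Fin (n + 1)} {D : Finset (Fin (n + 1))}

lemma zero_mem_cutOf : 0 ∈ cutOf s t D := fun h => absurd h (Fin.not_lt_zero _)

lemma last_mem_cutOf : Fin.last n ∈ cutOf s t D := fun _ h => absurd h (Fin.le_last _).not_gt

lemma left_mem_cutOf : s ∈ cutOf s t D := fun h => absurd h (lt_irrefl _)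

lemma right_mem_cutOf : t ∈ cutOf s t D := fun _ h => absurd h (lt_irrefl _)

lemma mem_cutOf (h : D ⊆ Finset.Ioo s t) {v : Fin (n + 1)} : v ∈ cutOf s t D ↔ v ∉ D :=
  ⟨fun hv hD => hv (Finset.mem_Ioo.1 (h hD)).1 (Finset.mem_Ioo.1 (h hD)).2 hD, fun hv _ _ => hv⟩

end

variable {n : ℕ} {x : Fin (n + 1) → A.Obj}
  (ℓ : ∀ s t : Fin (n + 1), A.hom (x s) (x t) (t.1 - s.1 - 1)) {m : ℕ}
  (y : Fin (m + 1) →o Fin (n + 1)) {s t : Fin (n + 1)}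

/-- The word obtained by omitting the vertices in `D`. -/
def omitWord (hs : y 0 = s) (ht : y (Fin.last m) = t) (D : Finset (Fin (n + 1))) :
    tmod A m (x s) (x t) :=
  famWord ℓ (K := cutOf s t D) zero_mem_cutOf last_mem_cutOf y hs ht left_mem_cutOf right_mem_cutOf

/-- The sum over all the words with letters `ℓ` between `s` and `t`, restricted along a simplex. -/
def wordSum (hs : y 0 = s) (ht : y (Fin.last m) = t) : tmod A m (x s) (x t) :=
  ∑ D ∈ (Finset.Ioo s t).powerset, omitWord ℓ y hs ht D

lemma tMap_wordSum {l : ℕ} (f : FinInt l m) (hs : y 0 = s) (ht : y (Fin.last m) = t) :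
    tMap A f _ _ (wordSum ℓ y hs ht) =
      wordSum ℓ (y.comp f.toHom) ((congrArg y f.map_zero).trans hs)
        ((congrArg y f.map_last).trans ht) :=
  (map_sum _ _ _).trans (Finset.sum_congr rfl fun _ _ => tMap_famWord _ _ _ _ _ _ _)

/-- Since `c` is omitted by neither set, the word is cut at `c`. Near each half the omitted vertices
are those of `D₁` or of `D₂` alone, and the rest is irrelevant by `famWord_congr`. -/
lemma tComul_omitWord {p q : ℕ} (h : p + q = m) (hs : y 0 = s) (ht : y (Fin.last m) = t)
    {c : Fin (n + 1)} (hc : y (leftSeg h (Fin.last p)) = c) {D₁ D₂ : Finset (Fin (n + 1))}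
    (h₁ : D₁ ⊆ Finset.Ioo s c) (h₂ : D₂ ⊆ Finset.Ioo c t) :
    tComul A h _ _ (omitWord ℓ y hs ht (D₁ ∪ D₂)) = qincl (tmod A p) (tmod A q) _ _ (x c)
      (omitWord ℓ (y.comp (leftSeg h)) hs hc D₁ ⊗ₜ
        omitWord ℓ (y.comp (rightSeg h)) hc ((congrArg y (rightSeg_last h)).trans ht) D₂) := by
  have hsc : s ≤ c := by
    rw [← hs, ← hc]
    exact y.monotone (Fin.zero_le _)
  have hct : c ≤ t := by
    rw [← ht, ← hc]
    exact y.monotone (Fin.le_last _)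
  have hD : D₁ ∪ D₂ ⊆ Finset.Ioo s t := Finset.union_subset
    (h₁.trans (Finset.Ioo_subset_Ioo_right hct)) (h₂.trans (Finset.Ioo_subset_Ioo_left hsc))
  have l₁ : ∀ v ∈ D₁, v < c := fun v hv => (Finset.mem_Ioo.1 (h₁ hv)).2
  have l₂ : ∀ v ∈ D₂, c < v := fun v hv => (Finset.mem_Ioo.1 (h₂ hv)).1
  have hcK : c ∈ cutOf s t (D₁ ∪ D₂) := (mem_cutOf hD).2 fun hc => by
    rcases Finset.mem_union.1 hc with hc | hc
    · exact lt_irrefl _ (l₁ _ hc)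
    · exact lt_irrefl _ (l₂ _ hc)
  refine (tComul_famWord_of_mem ℓ y h hs ht _ _ hc hcK).trans ?_
  refine congrArg (qincl _ _ _ _ _) (congrArg₂ (fun x y => x ⊗ₜ y) ?_ ?_)
  · refine famWord_congr _ _ _ _ _ _ _ _ fun v _ hv => ?_
    rw [mem_cutOf hD, mem_cutOf h₁, Finset.mem_union, not_or]
    exact and_iff_left fun h => (l₂ v h).not_ge hv
  · refine famWord_congr _ _ _ _ _ _ _ _ fun v hv _ => ?_
    rw [mem_cutOf hD, mem_cutOf h₂, Finset.mem_union, not_or]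
    exact and_iff_right fun h => (l₁ v h).not_ge hv

/-- Words that omit `c` are killed. The remaining omitted sets are exactly the pairs of a subset
below `c` and a subset above `c`, chosen independently, so the sum factors as a tensor product. This
is the reason for summing over all omitted sets. -/
lemma tComul_wordSum {p q : ℕ} (h : p + q = m) (hs : y 0 = s) (ht : y (Fin.last m) = t)
    {c : Fin (n + 1)} (hc : y (leftSeg h (Fin.last p)) = c) :
    tComul A h _ _ (wordSum ℓ y hs ht) = qincl (tmod A p) (tmod A q) _ _ (x c)
      (wordSum ℓ (y.comp (leftSeg h)) hs hc ⊗ₜ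
        wordSum ℓ (y.comp (rightSeg h)) hc ((congrArg y (rightSeg_last h)).trans ht)) := by
  have hsc : s ≤ c := by
    rw [← hs, ← hc]
    exact y.monotone (Fin.zero_le _)
  have hct : c ≤ t := by
    rw [← ht, ← hc]
    exact y.monotone (Fin.le_last _)
  unfold wordSum
  rw [map_sum, TensorProduct.sum_tmul, map_sum]
  simp only [TensorProduct.tmul_sum, map_sum]
  rw [← Finset.sum_product', ← Finset.sum_filter_of_ne (p := fun D => c ∉ D)]
  · refine Finset.sum_bij' (fun D _ => (D ∩ Finset.Ioo s c, D ∩ Finset.Ioo c t))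
      (fun D _ => D.1 ∪ D.2) ?_ ?_ ?_ ?_ ?_
    · intro D _
      exact Finset.mem_product.2 ⟨Finset.mem_powerset.2 Finset.inter_subset_right,
        Finset.mem_powerset.2 Finset.inter_subset_right⟩
    · intro D hD
      obtain ⟨h₁, h₂⟩ := Finset.mem_product.1 hD
      rw [Finset.mem_powerset] at h₁ h₂
      refine Finset.mem_filter.2 ⟨Finset.mem_powerset.2 (Finset.union_subset
        (h₁.trans (Finset.Ioo_subset_Ioo_right hct)) (h₂.trans (Finset.Ioo_subset_Ioo_left hsc))),
        fun hc => ?_⟩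
      rcases Finset.mem_union.1 hc with hc | hc
      · exact lt_irrefl _ (Finset.mem_Ioo.1 (h₁ hc)).2
      · exact lt_irrefl _ (Finset.mem_Ioo.1 (h₂ hc)).1
    · intro D hD
      obtain ⟨h₁, h₂⟩ := Finset.mem_filter.1 hD
      rw [Finset.mem_powerset] at h₁
      ext v
      simp only [Finset.mem_union, Finset.mem_inter, Finset.mem_Ioo]
      constructor
      · rintro (⟨hv, _⟩ | ⟨hv, _⟩) <;> exact hv
      · intro hv
        have hv' := Finset.mem_Ioo.1 (h₁ hv)
        rcases lt_trichotomy v c with hlt | rfl | hlt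
        · exact Or.inl ⟨hv, hv'.1, hlt⟩
        · exact absurd hv h₂
        · exact Or.inr ⟨hv, hlt, hv'.2⟩
    · rintro ⟨D₁, D₂⟩ hD
      obtain ⟨h₁, h₂⟩ := Finset.mem_product.1 hD
      rw [Finset.mem_powerset] at h₁ h₂
      refine Prod.ext ?_ ?_
      · ext v
        simp only [Finset.mem_union, Finset.mem_inter]
        refine ⟨fun ⟨hv, hv'⟩ => hv.resolve_right fun hv₂ => ?_, fun hv => ⟨Or.inl hv, h₁ hv⟩⟩
        exact (Finset.mem_Ioo.1 hv').2.not_gt (Finset.mem_Ioo.1 (h₂ hv₂)).1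
      · ext v
        simp only [Finset.mem_union, Finset.mem_inter]
        refine ⟨fun ⟨hv, hv'⟩ => hv.resolve_left fun hv₁ => ?_, fun hv => ⟨Or.inr hv, h₂ hv⟩⟩
        exact (Finset.mem_Ioo.1 hv').1.not_gt (Finset.mem_Ioo.1 (h₁ hv₁)).2
    · intro D hD
      obtain ⟨h₁, h₂⟩ := Finset.mem_filter.1 hD
      rw [Finset.mem_powerset] at h₁
      refine Eq.trans ?_ (tComul_omitWord ℓ y h hs ht hc Finset.inter_subset_right
        Finset.inter_subset_right)
      congr 2
      ext v
      simp only [Finset.mem_union, Finset.mem_inter, Finset.mem_Ioo]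
      constructor
      · intro hv
        have hv' := Finset.mem_Ioo.1 (h₁ hv)
        rcases lt_trichotomy v c with hlt | rfl | hlt
        · exact Or.inl ⟨hv, hv'.1, hlt⟩
        · exact absurd hv h₂
        · exact Or.inr ⟨hv, hlt, hv'.2⟩
      · rintro (⟨hv, _⟩ | ⟨hv, _⟩) <;> exact hv
  · intro D hD hne hcD
    refine hne (tComul_famWord_of_notMem _ _ _ _ _ _ _ ?_)
    rw [hc, mem_cutOf (Finset.mem_powerset.1 hD), not_not]
    exact hcD

/-- A `0`-simplex has `s = t`, so the only omitted set is empty and the sum is one word. -/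
lemma tCounit_wordSum (y : Fin (0 + 1) →o Fin (n + 1)) (hs : y 0 = s) (ht : y (Fin.last 0) = t)
    (h : PLift (x s = x t)) : tCounit A _ _ (wordSum ℓ y hs ht) = Finsupp.single h 1 := by
  obtain rfl : s = t := hs.symm.trans ht
  rw [wordSum, Finset.Ioo_self, Finset.powerset_empty, Finset.sum_singleton]
  exact tCounit_pull y _ h

end WordSum

/-! ### Simplices of a standard simplex as monotone maps. -/

section StandardSimplex

variable {m n : ℕ}

/-- The monotone map corresponding to a simplex of a standard simplex. -/
def toOrd (y : (SSet.stdSimplex.{u}.obj ⦋n⦌).obj (op ⦋m⦌)) : Fin (m + 1) →o Fin (n + 1) :=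
  (SSet.stdSimplex.objEquiv y).toOrderHom

/-- The simplex of a standard simplex corresponding to a monotone map. -/
def ofOrd (f : Fin (m + 1) →o Fin (n + 1)) : (SSet.stdSimplex.{u}.obj ⦋n⦌).obj (op ⦋m⦌) :=
  SSet.stdSimplex.objEquiv.symm (SimplexCategory.mkHom f)

lemma ofOrd_toOrd (y : (SSet.stdSimplex.{u}.obj ⦋n⦌).obj (op ⦋m⦌)) : ofOrd (toOrd y) = y := rfl

/-- The vertex of a standard simplex corresponding to a `0`-simplex. -/
def toFin (a : (SSet.stdSimplex.{u}.obj ⦋n⦌).obj (op ⦋0⦌)) : Fin (n + 1) := toOrd a 0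

/-- The `0`-simplex of a standard simplex corresponding to a vertex. -/
def ofFin (i : Fin (n + 1)) : (SSet.stdSimplex.{u}.obj ⦋n⦌).obj (op ⦋0⦌) :=
  ofOrd (OrderHom.const _ i)

lemma ofFin_toFin (a : (SSet.stdSimplex.{u}.obj ⦋n⦌).obj (op ⦋0⦌)) : ofFin (toFin a) = a := by
  rw [← ofOrd_toOrd a, ofFin]
  refine congrArg ofOrd (OrderHom.ext _ _ (funext fun i => ?_))
  rw [Subsingleton.elim (α := Fin 1) i 0]
  rfl

lemma toFin_vertex (i : Fin (m + 1)) (y : (SSet.stdSimplex.{u}.obj ⦋n⦌).obj (op ⦋m⦌)) :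
    toFin (vertex _ i y) = toOrd y i := rfl

lemma vertex_ofOrd (i : Fin (m + 1)) (f : Fin (m + 1) →o Fin (n + 1)) :
    vertex _ i (ofOrd.{u} f) = ofFin (f i) := rfl

lemma Between.toOrd_zero {a b : (SSet.stdSimplex.{u}.obj ⦋n⦌).obj (op ⦋0⦌)}
    (y : Between (SSet.stdSimplex.{u}.obj ⦋n⦌) m a b) : toOrd y.1 0 = toFin a := by
  rw [← toFin_vertex, y.2.1]

lemma Between.toOrd_last {a b : (SSet.stdSimplex.{u}.obj ⦋n⦌).obj (op ⦋0⦌)}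
    (y : Between (SSet.stdSimplex.{u}.obj ⦋n⦌) m a b) : toOrd y.1 (Fin.last m) = toFin b := by
  rw [← toFin_vertex, y.2.2]

end StandardSimplex

/-! ### The morphism of templicial modules given by letters. -/

noncomputable section OfLetters

variable {k : Type u} [CommRing k] {A : AugCat.{u} k} {n : ℕ} {x : Fin (n + 1) → A.Obj}
  (ℓ : ∀ s t : Fin (n + 1), A.hom (x s) (x t) (t.1 - s.1 - 1))

/-- The linear maps on the free module on the simplices of a standard simplex given by letters. -/
def lettersApp (m : ℕ) (a b : (SSet.stdSimplex.{u}.obj ⦋n⦌).obj (op ⦋0⦌)) :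
    fmod k (SSet.stdSimplex.{u}.obj ⦋n⦌) m a b →ₗ[k] tmod A m (x (toFin a)) (x (toFin b)) :=
  flift fun y => wordSum ℓ (toOrd y.1) y.toOrd_zero y.toOrd_last

lemma lettersApp_fgen {m : ℕ} {a b : (SSet.stdSimplex.{u}.obj ⦋n⦌).obj (op ⦋0⦌)}
    (y : Between (SSet.stdSimplex.{u}.obj ⦋n⦌) m a b) :
    lettersApp ℓ m a b (fgen y) = wordSum ℓ (toOrd y.1) y.toOrd_zero y.toOrd_last :=
  flift_fgen _ _

/-- The restriction of a simplex along an endpoint-preserving map. -/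
def Between.restrict {Y : SSet.{u}} {l m : ℕ} (f : FinInt l m) {a b : Y.obj (op ⦋0⦌)}
    (y : Between Y m a b) : Between Y l a b :=
  ⟨act Y f.toHom y.1, by
    rw [vertex_act, vertex_act, f.map_zero, f.map_last]
    exact y.2⟩

lemma fMap_fgen {Y : SSet.{u}} {l m : ℕ} (f : FinInt l m) {a b : Y.obj (op ⦋0⦌)}
    (y : Between Y m a b) : fMap k Y f a b (fgen y) = fgen (y.restrict f) :=
  flift_fgen _ _

lemma lettersApp_map_fgen {l m : ℕ} (f : FinInt l m)
    {a b : (SSet.stdSimplex.{u}.obj ⦋n⦌).obj (op ⦋0⦌)}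
    (y : Between (SSet.stdSimplex.{u}.obj ⦋n⦌) m a b) :
    lettersApp ℓ l a b (fMap k _ f a b (fgen y)) = tMap A f _ _ (lettersApp ℓ m a b (fgen y)) := by
  rw [lettersApp_fgen, fMap_fgen, lettersApp_fgen]
  exact (tMap_wordSum ℓ (toOrd y.1) f _ _).symm

/-- The front face of a simplex. -/
def Between.front {Y : SSet.{u}} {p q m : ℕ} (h : p + q = m) {a b : Y.obj (op ⦋0⦌)}
    (y : Between Y m a b) : Between Y p a (vertex Y (leftSeg h (Fin.last p)) y.1) :=
  ⟨act Y (leftSeg h) y.1, by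
    rw [vertex_act, vertex_act, leftSeg_zero]
    exact ⟨y.2.1, rfl⟩⟩

/-- The back face of a simplex. -/
def Between.back {Y : SSet.{u}} {p q m : ℕ} (h : p + q = m) {a b : Y.obj (op ⦋0⦌)}
    (y : Between Y m a b) : Between Y q (vertex Y (leftSeg h (Fin.last p)) y.1) b :=
  ⟨act Y (rightSeg h) y.1, by
    rw [vertex_act, vertex_act, rightSeg_zero, rightSeg_last]
    exact ⟨rfl, y.2.2⟩⟩

lemma fComul_fgen {Y : SSet.{u}} {p q m : ℕ} (h : p + q = m) {a b : Y.obj (op ⦋0⦌)}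
    (y : Between Y m a b) :
    fComul k Y h a b (fgen y) = fpair _ (y.front h) (y.back h) :=
  flift_fgen _ _

lemma lettersApp_comul_fgen {p q m : ℕ} (h : p + q = m)
    {a b : (SSet.stdSimplex.{u}.obj ⦋n⦌).obj (op ⦋0⦌)}
    (y : Between (SSet.stdSimplex.{u}.obj ⦋n⦌) m a b) :
    tComul A h _ _ (lettersApp ℓ m a b (fgen y)) =
      qmap (fun a => x (toFin a)) (lettersApp ℓ p) (lettersApp ℓ q) a b
        (fComul k _ h a b (fgen y)) := by
  rw [lettersApp_fgen, fComul_fgen]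
  refine Eq.trans ?_ (qmap_fpair (fun a => x (toFin a)) _ _ (y.front h) (y.back h)).symm
  rw [lettersApp_fgen, lettersApp_fgen]
  exact tComul_wordSum ℓ (toOrd y.1) h _ _ rfl

lemma lettersApp_counit_fgen {a b : (SSet.stdSimplex.{u}.obj ⦋n⦌).obj (op ⦋0⦌)}
    (y : Between (SSet.stdSimplex.{u}.obj ⦋n⦌) 0 a b) :
    tCounit A _ _ (lettersApp ℓ 0 a b (fgen y)) =
      qunitMap (fun a => x (toFin a)) a b (fCounit k _ a b (fgen y)) := by
  rw [lettersApp_fgen, fCounit_fgen, qunitMap_single]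
  exact tCounit_wordSum ℓ _ _ _ _

lemma lettersApp_map {l m : ℕ} (f : FinInt l m)
    {a b : (SSet.stdSimplex.{u}.obj ⦋n⦌).obj (op ⦋0⦌)}
    (z : fmod k (SSet.stdSimplex.{u}.obj ⦋n⦌) m a b) :
    lettersApp ℓ l a b (fMap k _ f a b z) = tMap A f _ _ (lettersApp ℓ m a b z) :=
  fext (f := lettersApp ℓ l a b ∘ₗ fMap k _ f a b) (g := tMap A f _ _ ∘ₗ lettersApp ℓ m a b)
    (lettersApp_map_fgen ℓ f) z

lemma lettersApp_comul {p q m : ℕ} (h : p + q = m)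
    {a b : (SSet.stdSimplex.{u}.obj ⦋n⦌).obj (op ⦋0⦌)}
    (z : fmod k (SSet.stdSimplex.{u}.obj ⦋n⦌) m a b) :
    tComul A h _ _ (lettersApp ℓ m a b z) =
      qmap (fun a => x (toFin a)) (lettersApp ℓ p) (lettersApp ℓ q) a b
        (fComul k _ h a b z) :=
  fext (f := tComul A h _ _ ∘ₗ lettersApp ℓ m a b)
    (g := qmap (fun a => x (toFin a)) (lettersApp ℓ p) (lettersApp ℓ q) a b ∘ₗ fComul k _ h a b)
    (lettersApp_comul_fgen ℓ h) z

lemma lettersApp_counit {a b : (SSet.stdSimplex.{u}.obj ⦋n⦌).obj (op ⦋0⦌)}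
    (z : fmod k (SSet.stdSimplex.{u}.obj ⦋n⦌) 0 a b) :
    tCounit A _ _ (lettersApp ℓ 0 a b z) =
      qunitMap (fun a => x (toFin a)) a b (fCounit k _ a b z) :=
  fext (f := tCounit A _ _ ∘ₗ lettersApp ℓ 0 a b)
    (g := qunitMap (fun a => x (toFin a)) a b ∘ₗ fCounit k _ a b) (lettersApp_counit_fgen ℓ) z

/-- The morphism from the free templicial module on a standard simplex given by letters. -/
def lettersHom : (freeTemplicialObj k (SSet.stdSimplex.{u}.obj ⦋n⦌)).Hom (tObj A) where
  base a := x (toFin a)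
  app := lettersApp ℓ
  naturality f _ _ z := lettersApp_map ℓ f z
  comul h _ _ z := lettersApp_comul ℓ h z
  counit z := lettersApp_counit ℓ z

end OfLetters

/-! ### Coordinates of morphisms in the enriched category of `C`. -/

noncomputable section Values

variable {k : Type u} [CommRing k] {C : DGCat.{u} k}

/-- The member of index `τ` of a morphism of the enriched category associated to a dg-category. -/
def gval {a b : C.Obj} {m : ℕ} (g : (gammaCat C).hom a b m) (p : ℕ) (τ : Fin p →o Fin m) :
    (C.hom a b).X (p : ℤ) :=
  Subtype.val (p := (· ∈ gammaObj (C.hom a b) m)) g p τ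

lemma gval_ext {a b : C.Obj} {m : ℕ} {g g' : (gammaCat C).hom a b m}
    (h : ∀ p τ, gval g p τ = gval g' p τ) : g = g' :=
  gamma_ext h

lemma gval_map {a b : C.Obj} {m l : ℕ} (φ : Fin l →o Fin m) (g : (gammaCat C).hom a b m) (p : ℕ)
    (τ : Fin p →o Fin l) : gval ((gammaCat C).map φ g) p τ = gval g p (φ.comp τ) := rfl

lemma gval_of_not_injective {a b : C.Obj} {m : ℕ} (g : (gammaCat C).hom a b m) {p : ℕ}
    {τ : Fin p →o Fin m} (h : ¬ Function.Injective τ) : gval g p τ = 0 :=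
  g.2.1 p τ h

lemma d_gval_zero {a b : C.Obj} {m : ℕ} (g : (gammaCat C).hom a b m) (τ : Fin 0 →o Fin m) :
    ((C.hom a b).d ((0 : ℕ) : ℤ) (-1)).hom (gval g 0 τ) = 0 :=
  g.2.2.1 τ

lemma d_gval {a b : C.Obj} {m : ℕ} (g : (gammaCat C).hom a b m) {p : ℕ}
    (τ : Fin (p + 1) →o Fin m) :
    ((C.hom a b).d ((p + 1 : ℕ) : ℤ) (p : ℤ)).hom (gval g (p + 1) τ) =
      ∑ j : Fin (p + 1), (-1 : ℤ) ^ (j : ℕ) • gval g p (τ.comp (coface j)) :=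
  gamma_d _ τ

/-- The full index set meets each of the two blocks in its full index set, so the top value of a
composite is the product of the top values, with the sign built into `gammaComp`. -/
lemma gval_comp {a b c : C.Obj} {p q m : ℕ} (h : p + q = m) (g : (gammaCat C).hom a b p)
    (g' : (gammaCat C).hom b c q) (h' : (q : ℤ) + (p : ℤ) = m) :
    gval ((gammaCat C).comp h g g') m OrderHom.id =
      (-1 : ℤ) ^ (p * q) • C.comp h' (gval g' q OrderHom.id) (gval g p OrderHom.id) := by
  have e : (OrderHom.id : Fin m →o Fin m) = join h h OrderHom.id OrderHom.id :=
    eq_join _ _ _ _ _ (fun _ => rfl) fun _ => rfl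
  rw [e]
  exact gammaComp_join C h _ _ h _ _ h'

lemma gval_hcast_eq_zero {a b a' b' : C.Obj} {m : ℕ} (ha : a = a') (hb : b = b')
    {g : (gammaCat C).hom a b m} {p : ℕ} {τ : Fin p →o Fin m} (h : gval g p τ = 0) :
    gval ((gammaCat C).hcast ha hb g) p τ = 0 := by
  subst ha hb
  exact h

end Values

/-! ### Values of a morphism on simplices, and their letters. -/

noncomputable section Evaluation

variable {k : Type u} [CommRing k] {A : AugCat.{u} k} {n : ℕ}
  (G : (freeTemplicialObj k (SSet.stdSimplex.{u}.obj ⦋n⦌)).Hom (tObj A))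

/-- The object associated to a vertex. -/
def homObj (i : Fin (n + 1)) : A.Obj := G.base (ofFin i)

/-- The simplex of a standard simplex corresponding to a monotone map, with its endpoints. -/
def betweenOf {m : ℕ} (y : Fin (m + 1) →o Fin (n + 1)) {s t : Fin (n + 1)} (hs : y 0 = s)
    (ht : y (Fin.last m) = t) :
    Between (SSet.stdSimplex.{u}.obj ⦋n⦌) m (ofFin s) (ofFin t) :=
  ⟨ofOrd y, by rw [vertex_ofOrd, vertex_ofOrd, hs, ht]; exact ⟨rfl, rfl⟩⟩

/-- The sum of words associated to a simplex. -/
def homEval {m : ℕ} (y : Fin (m + 1) →o Fin (n + 1)) {s t : Fin (n + 1)} (hs : y 0 = s)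
    (ht : y (Fin.last m) = t) : tmod A m (homObj G s) (homObj G t) :=
  G.app m _ _ (fgen (betweenOf y hs ht))

lemma homEval_congr {m : ℕ} {y y' : Fin (m + 1) →o Fin (n + 1)} {s t : Fin (n + 1)} (e : y = y')
    (hs : y 0 = s) (ht : y (Fin.last m) = t) (hs' : y' 0 = s) (ht' : y' (Fin.last m) = t) :
    homEval G y hs ht = homEval G y' hs' ht' := by
  subst e
  rfl

lemma tMap_homEval {l m : ℕ} (f : FinInt l m) (y : Fin (m + 1) →o Fin (n + 1))
    {s t : Fin (n + 1)} (hs : y 0 = s) (ht : y (Fin.last m) = t) :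
    tMap A f _ _ (homEval G y hs ht) =
      homEval G (y.comp f.toHom) ((congrArg y f.map_zero).trans hs)
        ((congrArg y f.map_last).trans ht) :=
  (G.naturality f (fgen (betweenOf y hs ht))).symm.trans
    (congrArg (G.app l _ _) (fMap_fgen f (betweenOf y hs ht)))

/-- A basis simplex of the free templicial module is group-like, and a morphism preserves
comultiplications. -/
lemma tComul_homEval {p q m : ℕ} (h : p + q = m) (y : Fin (m + 1) →o Fin (n + 1))
    {s t c : Fin (n + 1)} (hs : y 0 = s) (ht : y (Fin.last m) = t)
    (hc : y (leftSeg h (Fin.last p)) = c) :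
    tComul A h _ _ (homEval G y hs ht) = qincl (tmod A p) (tmod A q) _ _ (homObj G c)
      (homEval G (y.comp (leftSeg h)) hs hc ⊗ₜ
        homEval G (y.comp (rightSeg h)) hc ((congrArg y (rightSeg_last h)).trans ht)) := by
  have e : fComul k _ h _ _ (fgen (betweenOf y hs ht)) =
      fpair (k := k) (ofFin c) (betweenOf (y.comp (leftSeg h)) hs hc)
        (betweenOf (y.comp (rightSeg h)) hc ((congrArg y (rightSeg_last h)).trans ht)) :=
    (fComul_fgen h (betweenOf y hs ht)).trans (fpair_congr rfl rfl)
  have e₁ := G.comul h (fgen (betweenOf y hs ht))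
  have e₂ : qmap G.base (G.app p) (G.app q) _ _ (fComul k _ h _ _ (fgen (betweenOf y hs ht))) =
    qmap G.base (G.app p) (G.app q) _ _ _ := congrArg _ e
  have e₃ := qmap_fpair G.base (G.app p) (G.app q) (betweenOf (y.comp (leftSeg h)) hs hc)
        (betweenOf (y.comp (rightSeg h)) hc ((congrArg y (rightSeg_last h)).trans ht))
  exact e₁.trans (e₂.trans e₃)

/-- The counit of the target is injective by strong unitality, so compatibility with counits leaves
one possible value at a vertex: the empty word. -/
lemma homEval_zero (i : Fin (n + 1)) (y : Fin (0 + 1) →o Fin (n + 1)) (hs : y 0 = i)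
    (ht : y (Fin.last 0) = i) :
    homEval G y hs ht = word (zeroShape A (homObj G i)) (zeroArr A (homObj G i)) := by
  apply (tCounit_bijective A _ _).1
  refine Eq.trans ?_ (tCounit_word (zeroShape A (homObj G i)) (zeroArr A _) ⟨rfl⟩).symm
  refine (G.counit (fgen (betweenOf y hs ht))).trans ?_
  refine (congrArg (qunitMap G.base _ _) (fCounit_fgen _)).trans ?_
  exact qunitMap_single _ _

/-- The component with one letter of the sum of words associated to a simplex. -/
def homProj {m : ℕ} (y : Fin (m + 1 + 1) →o Fin (n + 1)) {s t : Fin (n + 1)} (hs : y 0 = s)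
    (ht : y (Fin.last _) = t) : A.hom (homObj G s) (homObj G t) m :=
  proj A m _ _ (homEval G y hs ht)

/-- Naturality turns the restriction in `proj_innerFace` into the value at the face, and
group-likeness evaluates its comultiplication term. The relation expresses the face of a letter
through letters of shorter simplices; it yields both the dg-nerve equation and injectivity. -/
lemma homProj_innerFace {m p q : ℕ} (j : Fin (m + 1)) (hp : p = j.1) (h : p + q = m)
    (h' : p + 1 + (q + 1) = m + 1 + 1) (y : Fin (m + 1 + 1 + 1) →o Fin (n + 1))
    {s t c : Fin (n + 1)} (hs : y 0 = s) (ht : y (Fin.last _) = t)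
    (hc : y (leftSeg h' (Fin.last (p + 1))) = c) :
    homProj G (y.comp (innerFace j).toHom) ((congrArg y (innerFace j).map_zero).trans hs)
        ((congrArg y (innerFace j).map_last).trans ht) =
      A.map (coface j) (homProj G y hs ht) +
        A.comp h (homProj G (y.comp (leftSeg h')) hs hc)
          (homProj G (y.comp (rightSeg h')) hc ((congrArg y (rightSeg_last h')).trans ht)) := by
  refine (congrArg (proj A m _ _) (tMap_homEval G (innerFace j) y hs ht)).symm.trans ?_
  refine (proj_innerFace j hp h h' _).trans (congrArg₂ _ rfl ?_)
  refine (congrArg (projComp A h _ _) (tComul_homEval G h' y hs ht hc)).trans ?_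
  exact projComp_qincl h _ _

/-- The degeneracy `[1] → [0]`. -/
def finIntPoint : FinInt 1 0 where
  toHom := OrderHom.const _ 0
  map_zero := rfl
  map_last := rfl

lemma proj_point (a : A.Obj) :
    proj A 0 a a (tMap A finIntPoint a a (word (zeroShape A a) (zeroArr A a))) = A.one a := by
  refine (congrArg (proj A 0 a a) (tMap_word finIntPoint _ _)).trans ?_
  refine (proj_pull _ _ _ _ _ _ (s := (zeroShape A a).first) (t := (zeroShape A a).first) rfl rfl
    rfl rfl).trans ?_
  refine (evalAlong_of _ _ _ _ _ _ fun i => i.elim0).trans ?_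
  refine (congrArg (A.map _) ((zeroArr A a).arr_self _)).trans ?_
  exact A.map_one' a rfl _ _

/-- A constant edge is a degenerate vertex, and restricting the empty word along the degeneracy
inserts an identity as its only letter. -/
lemma homProj_point (y : Fin (0 + 1 + 1) →o Fin (n + 1)) {i : Fin (n + 1)} (hs : y 0 = i)
    (ht : y (Fin.last _) = i) : homProj G y hs ht = A.one (homObj G i) := by
  have e : homEval G y hs ht = tMap A finIntPoint _ _
      (homEval G (OrderHom.const (Fin (0 + 1)) i) (s := i) (t := i) rfl rfl) := by
    refine Eq.trans ?_ (tMap_homEval G finIntPoint (OrderHom.const (Fin (0 + 1)) i) (s := i)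
      (t := i) rfl rfl).symm
    refine homEval_congr G (OrderHom.ext _ _ (funext fun j => ?_)) _ _ _ _
    change y j = i
    fin_cases j
    exacts [hs, ht]
  refine (congrArg (proj A 0 _ _) (e.trans
    (congrArg (tMap A finIntPoint _ _) (homEval_zero G i _ rfl rfl)))).trans ?_
  exact proj_point _

/-- The degeneracy repeating the vertex `i`. -/
def finIntDegen {m : ℕ} (i : Fin (m + 1)) : FinInt (m + 1) m where
  toHom :=
    { toFun := fun j => ⟨if j.1 ≤ i.1 then j.1 else j.1 - 1, by split_ifs <;> omega⟩
      monotone' := fun j j' h => by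
        have h' : j.1 ≤ j'.1 := h
        refine Fin.mk_le_mk.2 ?_
        split_ifs <;> omega }
  map_zero := Fin.ext (show (if 0 ≤ i.1 then 0 else 0 - 1) = 0 from if_pos (Nat.zero_le _))
  map_last := Fin.ext (show (if m + 1 ≤ i.1 then m + 1 else m + 1 - 1) = m from
    if_neg (by omega))

lemma exists_finIntDegen {m : ℕ} (y : Fin (m + 1 + 1) →o Fin (n + 1))
    (h : ¬ Function.Injective y) :
    ∃ (i : Fin (m + 1)) (y' : Fin (m + 1) →o Fin (n + 1)), y = y'.comp (finIntDegen i).toHom := by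
  obtain ⟨i, hi⟩ := exists_eq_of_not_injective y h
  -- `y` agrees at `i` and `i + 1`. Dropping the vertex `i + 1` and then repeating `i` gives `y`
  -- back.
  refine ⟨i, y.comp (coface i.succ), OrderHom.ext _ _ (funext fun j => ?_)⟩
  by_cases hj : j = i.succ
  · subst hj
    rw [← hi]
    refine congrArg y (Fin.ext ?_)
    rw [coface_val]
    change i.1 = if (if i.1 + 1 ≤ i.1 then i.1 + 1 else i.1 + 1 - 1) < i.1 + 1 then
      (if i.1 + 1 ≤ i.1 then i.1 + 1 else i.1 + 1 - 1) else
      (if i.1 + 1 ≤ i.1 then i.1 + 1 else i.1 + 1 - 1) + 1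
    split_ifs <;> omega
  · refine congrArg y (Fin.ext ?_)
    rw [coface_val]
    have : j.1 ≠ i.1 + 1 := fun e => hj (Fin.ext e)
    change j.1 = if (if j.1 ≤ i.1 then j.1 else j.1 - 1) < i.1 + 1 then
      (if j.1 ≤ i.1 then j.1 else j.1 - 1) else (if j.1 ≤ i.1 then j.1 else j.1 - 1) + 1
    split_ifs <;> omega

end Evaluation

/-! ### Vanishing of top values on degenerate simplices. -/

noncomputable section Degenerate

variable {k : Type u} [CommRing k] {C : DGCat.{u} k}

/-- A word of length `m` has at most `m - 1` inner vertices outside `cut`. Its restriction to `m`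
inner positions therefore has as top value a value at a non-injective map, which is zero. For `m =
0` this fails: the degenerate edge carries the identity. -/
lemma gval_proj_tMap {m : ℕ} (hm : m ≠ 0) (f : FinInt (m + 1) m) {a b : C.Obj}
    (x : tmod (gammaCat C) m a b) :
    gval (proj (gammaCat C) m a b (tMap (gammaCat C) f a b x)) m OrderHom.id = 0 := by
  let L : (gammaCat C).hom a b m →ₗ[k] (C.hom a b).X (m : ℤ) :=
    { toFun := fun g => gval g m OrderHom.id
      map_add' := fun _ _ => rfl
      map_smul' := fun _ _ => rfl }
  refine text (f := L ∘ₗ proj (gammaCat C) m a b ∘ₗ tMap (gammaCat C) f a b) (g := 0)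
    (fun σ α => ?_) x
  change gval (proj (gammaCat C) m a b (tMap (gammaCat C) f a b (word σ α))) m OrderHom.id = 0
  have e : proj (gammaCat C) m a b (tMap (gammaCat C) f a b (word σ α)) =
      evalAlong α f.toHom (s := σ.first) (t := σ.final) f.map_zero f.map_last
        σ.vert_zero σ.vert_last :=
    (congrArg _ (tMap_word _ σ α)).trans (proj_pull _ α _ _ _ _ _ _ _ _)
  refine (congrArg (fun g => gval g m OrderHom.id) e).trans ?_
  by_cases h : σ.Avoids f.toHom
  · refine (congrArg (fun g => gval g m OrderHom.id) (evalAlong_of _ _ _ _ _ _ h)).trans ?_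
    refine gval_hcast_eq_zero _ _ ((gval_map _ _ _ _).trans (gval_of_not_injective _ fun hi => ?_))
    -- Injectivity would give `m ≤ m - 1`; the truncated subtraction makes `m ≠ 0` necessary for the
    -- contradiction.
    have h₁ := Fintype.card_le_of_injective _ hi
    rw [Fintype.card_fin, Fintype.card_fin] at h₁
    have h₂ : (inner σ.cut 0 (Fin.last m)).card ≤ (Finset.Ioo 0 (Fin.last m)).card :=
      Finset.card_le_card fun u hu =>
        Finset.mem_Ioo.2 ⟨(mem_inner.1 hu).1, (mem_inner.1 hu).2.1⟩
    have h₃ : (Finset.Ioo 0 (Fin.last m)).card = m - 0 - 1 := Fin.card_Ioo _ _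
    have h₄ : m ≤ (inner σ.cut 0 (Fin.last m)).card := h₁
    omega
  · exact congrArg (fun g => gval g m OrderHom.id) (evalAlong_of_not _ _ _ _ _ _ h)

end Degenerate

/-! ### Chains with `m` inner points as `(m + 1)`-simplices. -/

section Chains

namespace Chain

variable {m n : ℕ}

/-- The simplex with the same vertices as a chain. -/
def ord (σ : Chain n m) : Fin (m + 1 + 1) →o Fin (n + 1) where
  toFun i := if i.1 = 0 then σ.src else if h : i.1 - 1 < m then σ.mid ⟨i.1 - 1, h⟩ else σ.tgt
  monotone' i j h := by
    have h' : i.1 ≤ j.1 := h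
    dsimp only
    split_ifs
    exacts [le_rfl, σ.src_le _, σ.src_le_tgt, by omega, σ.mid.monotone (Fin.mk_le_mk.2 (by omega)),
      σ.le_tgt _, by omega, by omega, le_rfl]

lemma ord_zero (σ : Chain n m) : σ.ord 0 = σ.src := rfl

lemma ord_last (σ : Chain n m) : σ.ord (Fin.last _) = σ.tgt := by
  simp [ord]

lemma ord_innerVertex (σ : Chain n m) (i : Fin m) : σ.ord (innerVertex m i) = σ.mid i := by
  change (if i.1 + 1 = 0 then σ.src else if h : i.1 + 1 - 1 < m then σ.mid ⟨i.1 + 1 - 1, h⟩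
    else σ.tgt) = _
  simp

lemma eq_ord {σ : Chain n m} {y : Fin (m + 1 + 1) →o Fin (n + 1)} (h₀ : y 0 = σ.src)
    (h₁ : y (Fin.last _) = σ.tgt) (h : ∀ i, y (innerVertex m i) = σ.mid i) : y = σ.ord := by
  refine OrderHom.ext _ _ (funext fun v => ?_)
  by_cases hv : v = 0
  · rw [hv, h₀, ord_zero]
  · by_cases hv' : v = Fin.last _
    · rw [hv', h₁, ord_last]
    · obtain ⟨i, rfl⟩ := exists_innerVertex hv hv'
      rw [h, ord_innerVertex]

lemma ord_map {n' : ℕ} (f : Fin (n + 1) →o Fin (n' + 1)) (σ : Chain n m) :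
    f.comp σ.ord = (σ.map f).ord :=
  eq_ord rfl (congrArg f σ.ord_last) fun i => congrArg f (σ.ord_innerVertex i)

lemma ord_drop (σ : Chain n (m + 1)) (j : Fin (m + 1)) :
    σ.ord.comp (innerFace j).toHom = (σ.drop j).ord :=
  eq_ord ((congrArg σ.ord (innerFace j).map_zero).trans σ.ord_zero)
    ((congrArg σ.ord (innerFace j).map_last).trans σ.ord_last) fun i =>
      (congrArg σ.ord (DFunLike.congr_fun (innerFace_innerVertex j) i)).trans
        (σ.ord_innerVertex _)

lemma leftSeg_last_eq {p q : ℕ} (j : Fin (m + 1)) (hp : p = j.1)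
    (h' : p + 1 + (q + 1) = m + 1 + 1) :
    leftSeg h' (Fin.last (p + 1)) = innerVertex (m + 1) j := Fin.ext (by
  change p + 1 = j.1 + 1
  omega)

lemma ord_left (σ : Chain n (m + 1)) (j : Fin (m + 1)) {q : ℕ}
    (h' : j.1 + 1 + (q + 1) = m + 1 + 1) : σ.ord.comp (leftSeg h') = (σ.left j).ord :=
  eq_ord σ.ord_zero ((congrArg σ.ord (leftSeg_last_eq j rfl h')).trans (σ.ord_innerVertex j))
    fun i => σ.ord_innerVertex ⟨i.1, by omega⟩

lemma ord_right (σ : Chain n (m + 1)) (j : Fin (m + 1))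
    (h' : j.1 + 1 + (m - j.1 + 1) = m + 1 + 1) : σ.ord.comp (rightSeg h') = (σ.right j).ord :=
  eq_ord ((congrArg σ.ord (leftSeg_last_eq j rfl h')).trans (σ.ord_innerVertex j))
    ((congrArg σ.ord (rightSeg_last h')).trans σ.ord_last) fun i =>
      have e : rightSeg h' (innerVertex _ i) = innerVertex (m + 1) ⟨j.1 + 1 + i.1, by omega⟩ :=
        Fin.ext (Nat.add_assoc _ _ _).symm
      (congrArg σ.ord e).trans (σ.ord_innerVertex ⟨j.1 + 1 + i.1, by omega⟩)

lemma Strict.of_injective {σ : Chain n m} (h : Function.Injective σ.ord) : σ.Strict := by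
  have hs : StrictMono σ.ord := σ.ord.monotone.strictMono_of_injective h
  refine ⟨?_, fun i j hij => ?_, fun i => ?_, fun i => ?_⟩
  · rw [← ord_zero, ← ord_last]
    exact hs (Fin.lt_def.2 (Nat.succ_pos m))
  · rw [← ord_innerVertex, ← ord_innerVertex]
    exact hs (Fin.lt_def.2 (Nat.succ_lt_succ hij))
  · rw [← ord_zero, ← ord_innerVertex]
    exact hs (Fin.lt_def.2 (Nat.succ_pos _))
  · rw [← ord_last, ← ord_innerVertex]
    exact hs (Fin.lt_def.2 (Nat.succ_lt_succ i.2))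

end Chain

end Chains

/-- This converts the signs of the enriched category into those of the dg-nerve. On the left stand
the alternating sum of faces and the sign of composition; on the right the dg-nerve signs for
position `j + 1` in a set with `m + 3` elements, times `(-1)^m`. The parity used is that `j (j + 1)`
is even. -/
lemma neg_one_smul_sub {M : Type*} [AddCommGroup M] {j m : ℕ} (h : j ≤ m) (x y : M) :
    (-1 : ℤ) ^ (m + 1) • (-1 : ℤ) ^ j • (x - (-1 : ℤ) ^ (j * (m - j)) • y) =
      (-1 : ℤ) ^ (j + 1) • (-1 : ℤ) ^ m • x + (-1 : ℤ) ^ ((m + 2) * (j + 2)) • (-1 : ℤ) ^ m • y := by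
  obtain ⟨l, rfl⟩ := Nat.exists_eq_add_of_le h
  obtain ⟨c, hc⟩ := Nat.even_mul_succ_self j
  rw [Nat.add_sub_cancel_left, smul_sub, smul_sub, smul_smul, smul_smul, smul_smul, smul_smul,
    smul_smul, ← pow_add, ← pow_add, ← pow_add, ← pow_add, sub_eq_add_neg, ← neg_smul,
    ← mul_neg_one ((-1 : ℤ) ^ _), ← pow_succ]
  refine congrArg₂ _ (neg_one_smul_congr (by omega) _) (neg_one_smul_congr ?_ _)
  have : (j + l + 2) * (j + 2) = j * (j + 1) + j * l + 3 * j + 2 * l + 4 := by ring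
  omega

lemma DGCat.comp_neg_one_smul {k : Type u} [CommRing k] (C : DGCat.{u} k) {x y z : C.Obj}
    {p q n : ℤ} (h : p + q = n) (a b : ℕ) (g : (C.hom y z).X p) (f : (C.hom x y).X q) :
    C.comp h ((-1 : ℤ) ^ a • g) ((-1 : ℤ) ^ b • f) = (-1 : ℤ) ^ (a + b) • C.comp h g f := by
  rw [map_zsmul, map_zsmul, LinearMap.smul_apply, smul_smul, ← pow_add, add_comm b]

/-! ### From morphisms to simplices of the dg-nerve. -/

noncomputable section ToNerve

variable {k : Type u} [CommRing k] {C : DGCat.{u} k} {n : ℕ}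
  (G : (freeTemplicialObj k (SSet.stdSimplex.{u}.obj ⦋n⦌)).Hom (tObj (gammaCat C)))

/-- The top value of the component with one letter associated to a chain. -/
def homTop {m : ℕ} (σ : Chain n m) : (C.hom (homObj G σ.src) (homObj G σ.tgt)).X (m : ℤ) :=
  gval (homProj G σ.ord σ.ord_zero σ.ord_last) m OrderHom.id

lemma homTop_eq {m : ℕ} {σ : Chain n m} {y : Fin (m + 1 + 1) →o Fin (n + 1)} (e : y = σ.ord)
    (hs : y 0 = σ.src) (ht : y (Fin.last _) = σ.tgt) :
    gval (homProj G y hs ht) m OrderHom.id = homTop G σ := by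
  subst e
  rfl

lemma homTop_point (i : Fin (n + 1)) : homTop G (Chain.point i) = C.one (homObj G i) := by
  have e : homProj G (Chain.point i).ord (Chain.point i).ord_zero (Chain.point i).ord_last =
    (gammaCat C).one (homObj G i) := homProj_point G _ _ _
  exact congrArg (fun g => gval g 0 OrderHom.id) e

/-- A chain that is not strict is a degenerate simplex, so its value is restricted along a
degeneracy and `gval_proj_tMap` applies. -/
lemma homTop_eq_zero {m : ℕ} (hm : m ≠ 0) (σ : Chain n m) (h : ¬ σ.Strict) : homTop G σ = 0 := by
  obtain ⟨i, y', e⟩ := exists_finIntDegen σ.ord fun hi => h (Chain.Strict.of_injective hi)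
  have hs : y' 0 = σ.src := by
    rw [← σ.ord_zero, e]
    exact congrArg y' (finIntDegen i).map_zero.symm
  have ht : y' (Fin.last m) = σ.tgt := by
    rw [← σ.ord_last, e]
    exact congrArg y' (finIntDegen i).map_last.symm
  have e₁ : homEval G σ.ord σ.ord_zero σ.ord_last =
      tMap (gammaCat C) (finIntDegen i) _ _ (homEval G y' hs ht) :=
    (homEval_congr G e _ _ _ _).trans (tMap_homEval G (finIntDegen i) y' hs ht).symm
  refine Eq.trans ?_ (gval_proj_tMap hm (finIntDegen i) (homEval G y' hs ht))
  exact congrArg (fun x => gval (proj (gammaCat C) m _ _ x) m OrderHom.id) e₁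

/-- This is the top value of `homProj_innerFace`, solved for the face of the letter. The sign comes
from `gval_comp` with degrees `j` and `m - j`. -/
lemma gval_homProj_coface {m : ℕ} (σ : Chain n (m + 1)) (j : Fin (m + 1)) :
    gval (homProj G σ.ord σ.ord_zero σ.ord_last) m (coface j) =
      dropTerm C (homObj G) (fun _ σ => homTop G σ) σ j - (-1 : ℤ) ^ (j.1 * (m - j.1)) •
        compTerm C (homObj G) (fun _ σ => homTop G σ) σ j := by
  have hj : ((m - j.1 : ℕ) : ℤ) + (j.1 : ℤ) = m := by omega
  have h : j.1 + (m - j.1) = m := by omega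
  have h' : j.1 + 1 + (m - j.1 + 1) = m + 1 + 1 := by omega
  have hc : σ.ord (leftSeg h' (Fin.last (j.1 + 1))) = σ.mid j :=
    (congrArg σ.ord (Chain.leftSeg_last_eq j rfl h')).trans (σ.ord_innerVertex j)
  have e := congrArg (fun g => gval g m OrderHom.id)
    (homProj_innerFace G j rfl h h' σ.ord σ.ord_zero σ.ord_last hc)
  have e₁ : gval (homProj G (σ.ord.comp (innerFace j).toHom)
      ((congrArg σ.ord (innerFace j).map_zero).trans σ.ord_zero)
      ((congrArg σ.ord (innerFace j).map_last).trans σ.ord_last)) m OrderHom.id =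
      homTop G (σ.drop j) := homTop_eq G (σ.ord_drop j) _ _
  have e₂ : gval (homProj G (σ.ord.comp (leftSeg h')) σ.ord_zero hc) j.1 OrderHom.id =
      homTop G (σ.left j) := homTop_eq G (σ.ord_left j h') _ _
  have e₃ : gval (homProj G (σ.ord.comp (rightSeg h')) hc
      ((congrArg σ.ord (rightSeg_last h')).trans σ.ord_last)) (m - j.1) OrderHom.id =
      homTop G (σ.right j) := homTop_eq G (σ.ord_right j h') _ _
  have e₄ := gval_comp h (homProj G (σ.ord.comp (leftSeg h')) σ.ord_zero hc)
    (homProj G (σ.ord.comp (rightSeg h')) hc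
      ((congrArg σ.ord (rightSeg_last h')).trans σ.ord_last)) hj
  rw [e₂, e₃] at e₄
  refine eq_sub_of_add_eq ?_
  refine Eq.trans ?_ (e.symm.trans e₁)
  exact congrArg (gval (homProj G σ.ord σ.ord_zero σ.ord_last) m (coface j) + ·) e₄.symm

/-- The simplex of the dg-nerve given by a morphism from the free templicial module on a standard
simplex. -/
def toNerve : DGSimplex C n where
  obj := homObj G
  -- In the enriched category inner vertices are counted from `0`, in the dg-nerve equation from
  -- `1`. The resulting sign `-1` per differential is absorbed by `(-1)^m`, which is also
  -- multiplicative, since degrees add under composition.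
  arr m σ := (-1 : ℤ) ^ m • homTop G σ
  arr_point i := by
    rw [pow_zero, one_smul]
    exact homTop_point G i
  arr_zero m σ hm h := by
    rw [homTop_eq_zero G hm σ h, smul_zero]
  d_arr_zero σ _ := by
    rw [pow_zero, one_smul]
    exact d_gval_zero _ _
  d_arr m σ _ := by
    rw [map_zsmul]
    refine (congrArg ((-1 : ℤ) ^ (m + 1) • ·)
      (d_gval (homProj G σ.ord σ.ord_zero σ.ord_last) OrderHom.id)).trans ?_
    refine Finset.smul_sum.trans (Finset.sum_congr rfl fun j _ => ?_)
    have e : compTerm C (homObj G) (fun m σ => (-1 : ℤ) ^ m • homTop G σ) σ j =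
        (-1 : ℤ) ^ m • compTerm C (homObj G) (fun _ σ => homTop G σ) σ j := by
      refine (C.comp_neg_one_smul _ _ _ _ _).trans (neg_one_smul_congr ?_ _)
      omega
    rw [e]
    refine (congrArg (fun z => (-1 : ℤ) ^ (m + 1) • (-1 : ℤ) ^ j.1 • z)
      (gval_homProj_coface G σ j)).trans ?_
    exact neg_one_smul_sub (Nat.le_of_lt_succ j.2) _ _

end ToNerve

/-! ### Naturality in the simplex and in the dg-category. -/

noncomputable section Naturality

variable {k : Type u} [CommRing k]

/-- The restriction of a morphism along a map of standard simplices. -/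
def homRestrict {X : TemplicialModule.{u} k} {n n' : ℕ} (f : ⦋n'⦌ ⟶ ⦋n⦌)
    (G : (freeTemplicialObj k (SSet.stdSimplex.{u}.obj ⦋n⦌)).Hom X) :
    (freeTemplicialObj k (SSet.stdSimplex.{u}.obj ⦋n'⦌)).Hom X :=
  CategoryStruct.comp (obj := TemplicialModule.{u} k) (Z := X)
    ((freeTemplicial k).map (SSet.stdSimplex.{u}.map f)) G

lemma homEval_restrict {A : AugCat.{u} k} {n n' : ℕ} (f : ⦋n'⦌ ⟶ ⦋n⦌)
    (G : (freeTemplicialObj k (SSet.stdSimplex.{u}.obj ⦋n⦌)).Hom (tObj A)) {m : ℕ}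
    (y : Fin (m + 1) →o Fin (n' + 1)) {s t : Fin (n' + 1)} (hs : y 0 = s)
    (ht : y (Fin.last m) = t) :
    homEval (homRestrict f G) y hs ht =
      homEval G (f.toOrderHom.comp y) (congrArg f.toOrderHom hs) (congrArg f.toOrderHom ht) := by
  exact congrArg (G.app m _ _) (fApp_fgen (SSet.stdSimplex.{u}.map f) (betweenOf y hs ht))

lemma toNerve_restrict {C : DGCat.{u} k} {n n' : ℕ} (f : ⦋n'⦌ ⟶ ⦋n⦌)
    (G : (freeTemplicialObj k (SSet.stdSimplex.{u}.obj ⦋n⦌)).Hom (tObj (gammaCat C))) :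
    toNerve (homRestrict f G) = (toNerve G).map f.toOrderHom := by
  refine DGSimplex.ext rfl (heq_of_eq (funext fun m => funext fun σ => ?_))
  refine congrArg ((-1 : ℤ) ^ m • ·) ?_
  refine (congrArg (fun x => gval (proj (gammaCat C) m _ _ x) m OrderHom.id)
    (homEval_restrict f G σ.ord σ.ord_zero σ.ord_last)).trans ?_
  exact homTop_eq G (Chain.ord_map f.toOrderHom σ) _ _

/-- An enriched functor acts letter by letter and keeps `cut`, so it preserves the distinction
between one-letter words and the others. -/
lemma proj_tApp {A B : AugCat.{u} k} (H : A.Functor B) {m : ℕ} {a b : A.Obj}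
    (x : tmod A (m + 1) a b) :
    proj B m _ _ (tApp H (m + 1) a b x) = H.hom a b m (proj A m a b x) := by
  refine text (f := proj B m _ _ ∘ₗ tApp H (m + 1) a b) (g := H.hom a b m ∘ₗ proj A m a b)
    (fun σ α => ?_) x
  have key : ∀ {x y x' y' : A.Obj} (hx : x = x') (hy : y = y') {l : ℕ} (φ : Fin m →o Fin l)
      (g : A.hom x y l), B.hcast (congrArg H.obj hx) (congrArg H.obj hy)
        (B.map φ (H.hom x y l g)) = H.hom x' y' m (A.hcast hx hy (A.map φ g)) := by
    intro x y x' y' hx hy l φ g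
    subst hx hy
    exact (H.naturality φ g).symm
  refine ((congrArg (proj B m _ _) (tApp_word H σ α)).trans (proj_word _ _)).trans ?_
  refine Eq.trans ?_ (congrArg (H.hom a b m) (proj_word σ α)).symm
  by_cases h : σ.Avoids OrderHom.id
  · refine (evalAlong_of _ _ _ _ _ _ (show (mapShape H σ).Avoids OrderHom.id from h)).trans ?_
    refine Eq.trans ?_ (congrArg (H.hom a b m) (evalAlong_of _ _ _ _ _ _ h)).symm
    exact key _ _ _ _
  · refine (evalAlong_of_not _ _ _ _ _ _
      (show ¬ (mapShape H σ).Avoids OrderHom.id from h)).trans ?_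
    refine Eq.trans ?_ (congrArg (H.hom a b m) (evalAlong_of_not _ _ _ _ _ _ h)).symm
    exact (map_zero _).symm

lemma toNerve_comp {C D : DGCat.{u} k} (F : C ⟶ D) {n : ℕ}
    (G : (freeTemplicialObj k (SSet.stdSimplex.{u}.obj ⦋n⦌)).Hom (tObj (gammaCat C))) :
    toNerve (C := D) (CategoryStruct.comp (obj := TemplicialModule.{u} k)
      (X := freeTemplicialObj k (SSet.stdSimplex.{u}.obj ⦋n⦌)) (Y := tObj (gammaCat C)) G
        ((linearDGNerve k).map F)) = (toNerve G).mapFunctor F := by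
  refine DGSimplex.ext rfl (heq_of_eq (funext fun m => funext fun σ => ?_))
  refine Eq.trans ?_ (map_zsmul ((F.hom (homObj G σ.src) (homObj G σ.tgt)).f (m : ℤ)).hom
    ((-1 : ℤ) ^ m) (homTop G σ)).symm
  refine congrArg ((-1 : ℤ) ^ m • ·) ?_
  exact congrArg (fun g => gval g m OrderHom.id) (proj_tApp ((gammaFunctor k).map F)
    (homEval G σ.ord σ.ord_zero σ.ord_last))

end Naturality

/-! ### Factoring monotone maps through cofaces. -/

section Cofaces

lemma neg_one_smul_smul {M : Type*} [AddCommGroup M] (m : ℕ) (x : M) :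
    (-1 : ℤ) ^ m • (-1 : ℤ) ^ m • x = x := by
  rw [smul_smul, ← pow_add, Even.neg_one_pow ⟨m, rfl⟩, one_smul]

lemma exists_eq_coface_comp {p m : ℕ} {τ : Fin p →o Fin (m + 1)} {j : Fin (m + 1)}
    (h : ∀ i, τ i ≠ j) : ∃ τ' : Fin p →o Fin m, τ = (coface j).comp τ' := by
  choose f hf using fun i => Fin.exists_succAbove_eq (h i)
  refine ⟨⟨f, fun i i' hi => (Fin.succAboveOrderEmb j).le_iff_le.1 ?_⟩,
    OrderHom.ext _ _ (funext fun i => (hf i).symm)⟩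
  change j.succAbove (f i) ≤ j.succAbove (f i')
  rw [hf, hf]
  exact τ.monotone hi

lemma eq_id_of_bijective {m : ℕ} {τ : Fin m →o Fin m} (h : Function.Bijective τ) :
    τ = OrderHom.id := by
  have hs : StrictMono τ := τ.monotone.strictMono_of_injective h.1
  have e : hs.orderIsoOfSurjective τ h.2 = OrderIso.refl _ := Subsingleton.elim _ _
  exact OrderHom.ext _ _ (funext fun i => DFunLike.congr_fun e i)

/-- The chain with the same vertices as a simplex. -/
def chainOf {m n : ℕ} (y : Fin (m + 1 + 1) →o Fin (n + 1)) {s t : Fin (n + 1)} (hs : y 0 = s)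
    (ht : y (Fin.last _) = t) : Chain n m where
  src := s
  tgt := t
  mid := y.comp (innerVertex m)
  src_le_tgt := by
    rw [← hs, ← ht]
    exact y.monotone (Fin.zero_le _)
  src_le _ := by
    rw [← hs]
    exact y.monotone (Fin.zero_le _)
  le_tgt _ := by
    rw [← ht]
    exact y.monotone (Fin.le_last _)

lemma eq_ord_chainOf {m n : ℕ} (y : Fin (m + 1 + 1) →o Fin (n + 1)) {s t : Fin (n + 1)}
    (hs : y 0 = s) (ht : y (Fin.last _) = t) : y = (chainOf y hs ht).ord :=
  Chain.eq_ord hs ht fun _ => rfl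

end Cofaces

/-! ### A morphism is determined by its objects and top values. -/

section Injectivity

variable {k : Type u} [CommRing k]

lemma ofHom_ext {X : TemplicialModule.{u} k} {n : ℕ}
    {b : (SSet.stdSimplex.{u}.obj ⦋n⦌).obj (op ⦋0⦌) → X.Base}
    {f g : ∀ m a a', fmod k (SSet.stdSimplex.{u}.obj ⦋n⦌) m a a' →ₗ[k] X.obj m (b a) (b a')}
    (h : ∀ m (y : Fin (m + 1) →o Fin (n + 1)) (s t : Fin (n + 1)) (hs : y 0 = s)
      (ht : y (Fin.last m) = t), f m _ _ (fgen (betweenOf y hs ht)) =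
        g m _ _ (fgen (betweenOf y hs ht))) : f = g := by
  funext m a a'
  refine LinearMap.ext (fext fun y => ?_)
  obtain ⟨s, rfl⟩ : ∃ s, a = ofFin s := ⟨_, (ofFin_toFin a).symm⟩
  obtain ⟨t, rfl⟩ : ∃ t, a' = ofFin t := ⟨_, (ofFin_toFin a').symm⟩
  exact h m (toOrd y.1) s t y.toOrd_zero y.toOrd_last

variable {C : DGCat.{u} k} {n : ℕ}
  {b : (SSet.stdSimplex.{u}.obj ⦋n⦌).obj (op ⦋0⦌) → (tObj (gammaCat C)).Base}

/-- By induction on the dimension, the inner comultiplications involve only shorter simplices, so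
only the letter has to be compared. The morphisms are written with the same base map `b`, so that
their values lie in the same modules. -/
lemma homEval_eq {app app'} (h₁ h₂ h₃ h₁' h₂' h₃') :
    let G := TemplicialModule.Hom.mk (X := freeTemplicialObj k (SSet.stdSimplex.{u}.obj ⦋n⦌))
      (Y := tObj (gammaCat C)) b app h₁ h₂ h₃
    let G' := TemplicialModule.Hom.mk (X := freeTemplicialObj k (SSet.stdSimplex.{u}.obj ⦋n⦌))
      (Y := tObj (gammaCat C)) b app' h₁' h₂' h₃'
    (∀ m (σ : Chain n m), homTop G σ = homTop G' σ) →
    ∀ (m : ℕ) (y : Fin (m + 1) →o Fin (n + 1)) (s t : Fin (n + 1)) (hs : y 0 = s)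
      (ht : y (Fin.last m) = t), homEval G y hs ht = homEval G' y hs ht := by
  intro G G' h m y s t hs ht
  induction m using Nat.strong_induction_on generalizing s t with
  | _ m ih =>
  cases m with
  | zero =>
    obtain rfl : s = t := hs.symm.trans ht
    exact (homEval_zero G s y hs ht).trans (homEval_zero G' s y hs ht).symm
  | succ m =>
    -- Detection by the one-letter component and the inner comultiplications, applied to the
    -- difference of the two values.
    refine sub_eq_zero.1 (eq_zero_of_proj_of_tComul ?_ fun p q hpq hp hq => ?_)
    · refine (map_sub (proj (gammaCat C) m _ _) _ _).trans (sub_eq_zero.2 (gval_ext fun p τ => ?_))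
      by_cases hi : Function.Injective τ
      swap
      · exact (gval_of_not_injective _ hi).trans (gval_of_not_injective _ hi).symm
      by_cases hτ : Function.Surjective τ
      · obtain rfl : p = m := by
          simpa using Fintype.card_of_bijective (f := τ) ⟨hi, hτ⟩
        obtain rfl := eq_id_of_bijective ⟨hi, hτ⟩
        have e := eq_ord_chainOf y hs ht
        exact (homTop_eq G (σ := chainOf y hs ht) e hs ht).trans ((h p _).trans
          (homTop_eq G' (σ := chainOf y hs ht) e hs ht).symm)
      · unfold Function.Surjective at hτ
        push Not at hτ
        obtain ⟨j, hj⟩ := hτ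
        cases m with
        | zero => exact j.elim0
        | succ m =>
          obtain ⟨τ', rfl⟩ := exists_eq_coface_comp hj
          -- A value at an index map missing `j` is a value of the face `j` of the letter. By
          -- `homProj_innerFace` that face is the letter of a shorter simplex minus a composite of
          -- letters of shorter simplices, all covered by the induction.
          suffices e : (gammaCat C).map (coface j) (homProj G y hs ht) =
              (gammaCat C).map (coface j) (homProj G' y hs ht) from
            congrArg (fun g => gval g p τ') e
          have h : j.1 + (m - j.1) = m := by omega
          have h' : j.1 + 1 + (m - j.1 + 1) = m + 1 + 1 := by omega
          have e := homProj_innerFace G j rfl h h' y hs ht rfl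
          have e' := homProj_innerFace G' j rfl h h' y hs ht rfl
          refine add_right_cancel (e.symm.trans (Eq.trans ?_ (e'.trans (congrArg₂ _ rfl ?_))))
          · exact congrArg (proj (gammaCat C) m _ _) (ih _ (by omega) _ _ _ _ _)
          · exact congrArg₂ (fun g g' => (gammaCat C).comp h g g')
              (congrArg (proj (gammaCat C) _ _ _) (ih _ (by omega) _ _ _ _ _).symm)
              (congrArg (proj (gammaCat C) _ _ _) (ih _ (by omega) _ _ _ _ _).symm)
    · refine (map_sub (tComul (gammaCat C) hpq _ _) _ _).trans (sub_eq_zero.2 ?_)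
      refine (tComul_homEval G hpq y hs ht rfl).trans
        (Eq.trans ?_ (tComul_homEval G' hpq y hs ht rfl).symm)
      exact congrArg (qincl _ _ _ _ _) (congrArg₂ (fun x y => x ⊗ₜ y)
        (ih p (by omega) _ _ _ _ _) (ih q (by omega) _ _ _ _ _))

lemma toNerve_injective : Function.Injective (toNerve (C := C) (n := n)) := by
  rintro ⟨b, app, h₁, h₂, h₃⟩ ⟨b', app', h₁', h₂', h₃'⟩ h
  -- The objects must be identified first, since the modules containing the values depend on them.
  obtain rfl : b = b' := funext fun a => by
    rw [← ofFin_toFin a]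
    exact congrFun (congrArg DGSimplex.obj h) (toFin a)
  refine TemplicialModule.Hom.ext rfl (heq_of_eq (ofHom_ext
    (homEval_eq h₁ h₂ h₃ h₁' h₂' h₃' fun m σ => ?_)))
  have e := congrFun (congrFun (eq_of_heq (DGSimplex.mk.inj h).2) m) σ
  have e' := congrArg ((-1 : ℤ) ^ m • ·) e
  exact (neg_one_smul_smul m _).symm.trans (e'.trans (neg_one_smul_smul m _))

end Injectivity

/-! ### Dependence of the word sum on its longest letter. -/

noncomputable section ChangeLetters

variable {k : Type u} [CommRing k] {A : AugCat.{u} k} {n : ℕ}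

/-- The inner vertices of a strict chain, counted from the first vertex on. -/
def Chain.rel {m : ℕ} {σ : Chain n m} (h : σ.Strict) :
    Fin m →o Fin (σ.tgt.1 - σ.src.1 - 1) where
  toFun i := ⟨(σ.mid i).1 - σ.src.1 - 1, by
    have h₁ := Fin.lt_def.1 (h.2.2.1 i)
    have h₂ := Fin.lt_def.1 (h.2.2.2 i)
    omega⟩
  monotone' _ _ hij := Fin.mk_le_mk.2 (Nat.sub_le_sub_right (Nat.sub_le_sub_right
    (Fin.le_def.1 (σ.mid.monotone hij)) _) _)

variable {x : Fin (n + 1) → A.Obj}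
  {ℓ ℓ' : ∀ s t : Fin (n + 1), A.hom (x s) (x t) (t.1 - s.1 - 1)}

/-- If `c` lies in the cut, every letter between `s` and `t` stops at `c`, so it spans less than the
full interval and is not affected by a change of the longest letter. -/
lemma famArr_arr_congr {K : Set (Fin (n + 1))} (h₀ : 0 ∈ K) (h₁ : Fin.last n ∈ K)
    {s t c : Fin (n + 1)} (hs : s < c) (ht : c < t) (hc : c ∈ K)
    (h : ∀ i j : Fin (n + 1), j.1 - i.1 < t.1 - s.1 → ℓ i j = ℓ' i j)
    (v w : (famShape x K h₀ h₁).cut) (hv : s ≤ v.1) (hw : w.1 ≤ t) (hvw : v ≤ w) :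
    (famArr ℓ h₀ h₁).arr v w hvw = (famArr ℓ' h₀ h₁).arr v w hvw := by
  refine Arr.ext_letters (fun s' v' hv' hs' hv'' hmin => ?_) hvw
  rw [famArr, famArr, build_next _ hv' hmin, build_next _ hv' hmin, famLetters, famLetters,
    h s'.1 v'.1]
  have l₁ : s.1 ≤ s'.1.1 := hv.trans hs'
  have l₂ : v'.1.1 ≤ t.1 := le_trans hv'' hw
  have l₃ : s.1 < c.1 := hs
  have l₄ : c.1 < t.1 := ht
  have l₅ : s'.1.1 < v'.1.1 := hv'
  -- A letter as long as the whole interval would start at `s`, and then minimality ends it at `c`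
  -- or before.
  by_contra hlt
  have l₆ : v'.1.1 ≤ c.1 := hmin ⟨c, hc⟩ (show s'.1.1 < c.1 by omega)
  omega

variable {m : ℕ}

lemma omitWord_congr (y : Fin (m + 1) →o Fin (n + 1)) {s t c : Fin (n + 1)} (hs : y 0 = s)
    (ht : y (Fin.last m) = t) (hsc : s < c) (hct : c < t)
    (h : ∀ i j : Fin (n + 1), j.1 - i.1 < t.1 - s.1 → ℓ i j = ℓ' i j)
    {D : Finset (Fin (n + 1))} (hc : c ∉ D) :
    omitWord ℓ y hs ht D = omitWord ℓ' y hs ht D := by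
  refine congrArg (word _) (Arr.ext' fun v w hvw => ?_)
  refine congrArg (A.map _) (famArr_arr_congr (K := cutOf s t D) zero_mem_cutOf last_mem_cutOf
    hsc hct (fun _ _ => hc) h _ _ (le_of_eq_of_le hs.symm (y.monotone (Fin.zero_le _)))
    (le_of_le_of_eq (y.monotone (Fin.le_last _)) ht) _)

variable {σ : Chain n m} (hσ : σ.Strict)

/-- Omitting all inner vertices leaves the single letter `ℓ src tgt`; the inner vertices of the
strict chain pick out the index map `Chain.rel`. -/
lemma proj_omitWord_Ioo :
    proj A m _ _ (omitWord ℓ σ.ord σ.ord_zero σ.ord_last (Finset.Ioo σ.src σ.tgt)) =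
      A.map (Chain.rel hσ) (ℓ σ.src σ.tgt) := by
  have hK : ∀ v ∈ cutOf σ.src σ.tgt (Finset.Ioo σ.src σ.tgt), σ.src < v → σ.tgt ≤ v :=
    fun v hv hs => not_lt.1 fun ht => hv hs ht (Finset.mem_Ioo.2 ⟨hs, ht⟩)
  have ha : (famShape x (cutOf σ.src σ.tgt (Finset.Ioo σ.src σ.tgt)) zero_mem_cutOf
      last_mem_cutOf).Avoids σ.ord := by
    intro i hi
    rw [σ.ord_innerVertex] at hi
    exact (hK _ hi (hσ.2.2.1 i)).not_gt (hσ.2.2.2 i)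
  refine (proj_pull _ _ _ _ _ _ (s := ⟨σ.src, left_mem_cutOf⟩) (t := ⟨σ.tgt, right_mem_cutOf⟩)
    σ.ord_zero σ.ord_last rfl rfl).trans ?_
  refine (evalAlong_of _ _ _ _ _ _ ha).trans ?_
  have e : (famArr ℓ (K := cutOf σ.src σ.tgt (Finset.Ioo σ.src σ.tgt)) zero_mem_cutOf
      last_mem_cutOf).arr ⟨σ.src, left_mem_cutOf⟩ ⟨σ.tgt, right_mem_cutOf⟩ σ.src_le_tgt = _ :=
    build_next (famLetters ℓ zero_mem_cutOf last_mem_cutOf) hσ.1 fun w hw => hK w.1 w.2 hw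
  refine (congrArg (A.map _) e).trans ((A.map_comp _ _ _).symm.trans ?_)
  refine congrArg (fun φ => A.map φ (ℓ σ.src σ.tgt)) (OrderHom.ext _ _ (funext fun i =>
    Fin.ext ?_))
  refine congrArg (fun v : Fin (n + 1) => v.1 - σ.src.1 - 1) ((enum_idx _ _ _ i).trans ?_)
  exact σ.ord_innerVertex i

/-- Among the words over the interval only the one omitting all inner vertices contains the longest
letter, and it depends on it linearly. Every other word has a cut vertex inside and is unchanged by
`omitWord_congr`. -/
lemma proj_wordSum
    (h : ∀ i j : Fin (n + 1), j.1 - i.1 < σ.tgt.1 - σ.src.1 → ℓ i j = ℓ' i j) :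
    proj A m _ _ (wordSum ℓ' σ.ord σ.ord_zero σ.ord_last) =
      proj A m _ _ (wordSum ℓ σ.ord σ.ord_zero σ.ord_last) +
        A.map (Chain.rel hσ) (ℓ' σ.src σ.tgt - ℓ σ.src σ.tgt) := by
  have key : ∀ ℓ : ∀ s t : Fin (n + 1), A.hom (x s) (x t) (t.1 - s.1 - 1),
      proj A m _ _ (wordSum ℓ σ.ord σ.ord_zero σ.ord_last) =
      A.map (Chain.rel hσ) (ℓ σ.src σ.tgt) +
        proj A m _ _ (∑ D ∈ (Finset.Ioo σ.src σ.tgt).powerset.erase (Finset.Ioo σ.src σ.tgt),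
          omitWord ℓ σ.ord σ.ord_zero σ.ord_last D) := fun ℓ => by
    rw [wordSum, ← Finset.add_sum_erase _ _ (Finset.mem_powerset_self _), map_add,
      proj_omitWord_Ioo hσ]
  rw [key, key ℓ, Finset.sum_congr rfl fun D hD => ?_, map_sub]
  · abel
  · obtain ⟨hD, hD'⟩ := Finset.mem_erase.1 hD
    obtain ⟨c, hc, hc'⟩ := Finset.exists_of_ssubset
      ((Finset.mem_powerset.1 hD').ssubset_of_ne hD)
    obtain ⟨h₁, h₂⟩ := Finset.mem_Ioo.1 hc
    exact omitWord_congr _ _ _ h₁ h₂ (fun i j hij => (h i j hij).symm) hc'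

end ChangeLetters

/-! ### Fitting letters to a simplex of the dg-nerve, and the isomorphism. -/

noncomputable section Surjectivity

variable {k : Type u} [CommRing k] {C : DGCat.{u} k} {n : ℕ}

lemma homEval_lettersHom {A : AugCat.{u} k} {x : Fin (n + 1) → A.Obj}
    (ℓ : ∀ s t : Fin (n + 1), A.hom (x s) (x t) (t.1 - s.1 - 1)) {m : ℕ}
    (y : Fin (m + 1) →o Fin (n + 1)) {s t : Fin (n + 1)} (hs : y 0 = s)
    (ht : y (Fin.last m) = t) : homEval (lettersHom ℓ) y hs ht = wordSum ℓ y hs ht :=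
  lettersApp_fgen ℓ (betweenOf y hs ht)

/-- The chain with given endpoints and with inner vertices counted from the first vertex on. -/
def relChain {s t : Fin (n + 1)} (h : s < t) {p : ℕ} (τ : Fin p →o Fin (t.1 - s.1 - 1)) :
    Chain n p where
  src := s
  tgt := t
  mid := ⟨fun i => ⟨s.1 + 1 + (τ i).1, by omega⟩, fun i j hij =>
    Fin.mk_le_mk.2 (Nat.add_le_add_left (Fin.le_def.1 (τ.monotone hij)) _)⟩
  src_le_tgt := h.le
  src_le i := Fin.le_def.2 (show s.1 ≤ s.1 + 1 + (τ i).1 by omega)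
  le_tgt i := Fin.le_def.2 (show s.1 + 1 + (τ i).1 ≤ t.1 by omega)

lemma relChain_rel {m : ℕ} {σ : Chain n m} (h : σ.Strict) :
    relChain h.1 (Chain.rel h) = σ :=
  Chain.ext rfl rfl (OrderHom.ext _ _ (funext fun i => Fin.ext (by
    have h₁ := Fin.lt_def.1 (h.2.2.1 i)
    change σ.src.1 + 1 + ((σ.mid i).1 - σ.src.1 - 1) = _
    omega)))

lemma injective_of_strict_relChain {s t : Fin (n + 1)} (h : s < t) {p : ℕ}
    {τ : Fin p →o Fin (t.1 - s.1 - 1)} (hτ : (relChain h τ).Strict) : Function.Injective τ :=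
  fun _ _ hij => hτ.2.1.injective (Fin.ext (congrArg (fun z : Fin _ => s.1 + 1 + z.1) hij))

variable (s : DGSimplex C n)

/-- Letters between the objects of a simplex of the dg-nerve. -/
abbrev NerveLetters :=
  ∀ i j : Fin (n + 1), (gammaCat C).hom (s.obj i) (s.obj j) (j.1 - i.1 - 1)

variable {s} (ℓ : NerveLetters s)

/-- The elements of the simplex of the dg-nerve given by letters. -/
def lettersArr (m : ℕ) (σ : Chain n m) : (C.hom (s.obj σ.src) (s.obj σ.tgt)).X (m : ℤ) :=
  (toNerve (lettersHom ℓ)).arr m σ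

/-- The top value of the component with one letter of the sum of words along a chain. -/
def lettersTop (m : ℕ) (σ : Chain n m) : (C.hom (s.obj σ.src) (s.obj σ.tgt)).X (m : ℤ) :=
  gval (proj (gammaCat C) m _ _ (wordSum ℓ σ.ord σ.ord_zero σ.ord_last)) m OrderHom.id

lemma lettersArr_eq (m : ℕ) (σ : Chain n m) : lettersArr ℓ m σ = (-1 : ℤ) ^ m • lettersTop ℓ m σ :=
  congrArg (fun z => (-1 : ℤ) ^ m • gval (proj (gammaCat C) m _ _ z) m OrderHom.id)
    (homEval_lettersHom ℓ σ.ord σ.ord_zero σ.ord_last)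

/-- The defect of letters along a chain. -/
def defect (m : ℕ) (σ : Chain n m) : (C.hom (s.obj σ.src) (s.obj σ.tgt)).X (m : ℤ) :=
  s.arr m σ - lettersArr ℓ m σ

/-- Both sides are normalized on degenerate chains: identities in degree `0`, and zero in positive
degree. -/
lemma defect_of_not_strict {m : ℕ} {σ : Chain n m} (h : ¬ σ.Strict) : defect ℓ m σ = 0 := by
  refine sub_eq_zero.2 ?_
  by_cases hm : m = 0
  · subst hm
    have e : σ.src = σ.tgt := by
      by_contra hne
      exact h ⟨lt_of_le_of_ne σ.src_le_tgt hne, fun i => i.elim0, fun i => i.elim0,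
        fun i => i.elim0⟩
    obtain ⟨y, z, μ, h₁, h₂, h₃⟩ := σ
    obtain rfl : y = z := e
    exact s.arr_point'.trans (toNerve (lettersHom ℓ)).arr_point'.symm
  · exact (s.arr_zero m σ hm h).trans ((toNerve (lettersHom ℓ)).arr_zero m σ hm h).symm

lemma d_defect_zero (σ : Chain n 0) :
    ((C.hom (s.obj σ.src) (s.obj σ.tgt)).d ((0 : ℕ) : ℤ) (-1)).hom (defect ℓ 0 σ) = 0 :=
  (map_sub _ _ _).trans (sub_eq_zero.2
    ((s.d_arr_zero' σ).trans ((toNerve (lettersHom ℓ)).d_arr_zero' σ).symm))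

lemma d_lettersArr {m : ℕ} (σ : Chain n (m + 1)) :
    ((C.hom (s.obj σ.src) (s.obj σ.tgt)).d ((m + 1 : ℕ) : ℤ) (m : ℤ)).hom
        (lettersArr ℓ (m + 1) σ) =
      ∑ j : Fin (m + 1), ((-1 : ℤ) ^ (j.1 + 1) • dropTerm C s.obj (lettersArr ℓ) σ j +
        (-1 : ℤ) ^ ((m + 2) * (j.1 + 2)) • compTerm C s.obj (lettersArr ℓ) σ j) :=
  (toNerve (lettersHom ℓ)).d_arr' m σ

/-- The equation of the dg-nerve is nonlinear only through its composition terms. These involve the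
left and right subchains, where the two families agree by hypothesis, so they cancel and a linear
equation in the defect remains. -/
lemma d_defect {m : ℕ} (σ : Chain n (m + 1))
    (hl : ∀ j, defect ℓ j.1 (σ.left j) = 0)
    (hr : ∀ j : Fin (m + 1), defect ℓ (m - j.1) (σ.right j) = 0) :
    ((C.hom (s.obj σ.src) (s.obj σ.tgt)).d ((m + 1 : ℕ) : ℤ) (m : ℤ)).hom (defect ℓ (m + 1) σ) =
      ∑ j : Fin (m + 1), (-1 : ℤ) ^ (j.1 + 1) • dropTerm C s.obj (defect ℓ) σ j := by
  refine (map_sub _ _ _).trans ((congrArg₂ (· - ·) (s.d_arr' m σ)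
    (d_lettersArr ℓ σ)).trans ?_)
  refine Finset.sum_sub_distrib _ _ |>.symm.trans (Finset.sum_congr rfl fun j _ => ?_)
  have e : compTerm C s.obj s.arr σ j = compTerm C s.obj (lettersArr ℓ) σ j :=
    congrArg₂ (fun g f => C.comp _ g f) (sub_eq_zero.1 (hr j)) (sub_eq_zero.1 (hl j))
  rw [e]
  refine (add_sub_add_right_eq_sub _ _ _).trans ?_
  exact (smul_sub _ _ _).symm

/-- The defect of letters along a chain with given endpoints. -/
def relDefect {i j : Fin (n + 1)} (hij : i < j) (p : ℕ) (τ : Fin p →o Fin (j.1 - i.1 - 1)) :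
    (C.hom (s.obj i) (s.obj j)).X (p : ℤ) :=
  defect ℓ p (relChain hij τ)

variable {ℓ}

/-- With shorter intervals already correct, `d_defect` leaves only the terms dropping a vertex. Up
to `(-1)^p` this is the equation defining `gammaObj`, so the defect over the whole interval is one
morphism of the enriched category, available as a correction of the letter. -/
lemma defect_mem {i j : Fin (n + 1)} (hij : i < j)
    (h : ∀ m (σ : Chain n m), σ.tgt.1 - σ.src.1 < j.1 - i.1 → defect ℓ m σ = 0) :
    (fun p τ => (-1 : ℤ) ^ p • relDefect ℓ hij p τ) ∈
      gammaObj (C.hom (s.obj i) (s.obj j)) (j.1 - i.1 - 1) := by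
  refine ⟨fun p τ hτ => ?_, fun τ => ?_, fun p τ hτ => ?_⟩
  · have e : relDefect ℓ hij p τ = 0 :=
      defect_of_not_strict ℓ fun hs => hτ (injective_of_strict_relChain hij hs)
    exact (congrArg ((-1 : ℤ) ^ p • ·) e).trans (smul_zero _)
  · have e : ((C.hom (s.obj i) (s.obj j)).d ((0 : ℕ) : ℤ) (-1)).hom (relDefect ℓ hij 0 τ) = 0 :=
      d_defect_zero ℓ (relChain hij τ)
    rw [map_zsmul, e, smul_zero]
  · have e : ((C.hom (s.obj i) (s.obj j)).d ((p + 1 : ℕ) : ℤ) (p : ℤ)).hom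
        (relDefect ℓ hij (p + 1) τ) =
        ∑ l : Fin (p + 1), (-1 : ℤ) ^ (l.1 + 1) • relDefect ℓ hij p (τ.comp (coface l)) := by
      refine d_defect ℓ (relChain hij τ) (fun l => h _ _ ?_) fun l => h _ _ ?_
      · change i.1 + 1 + (τ l).1 - i.1 < _
        omega
      · change j.1 - (i.1 + 1 + (τ l).1) < _
        omega
    rw [map_zsmul, e, Finset.smul_sum]
    refine Finset.sum_congr rfl fun l _ => ?_
    rw [smul_smul, smul_smul, ← pow_add, ← pow_add]
    apply neg_one_smul_congr
    omega

/-- By `proj_wordSum`, changing the longest letter moves the elements along a strict chain with the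
same endpoints by exactly the corresponding value of the change, up to sign. -/
lemma defect_change {ℓ' : NerveLetters s} {m : ℕ} {σ : Chain n m} (hσ : σ.Strict)
    (h : ∀ i j : Fin (n + 1), j.1 - i.1 < σ.tgt.1 - σ.src.1 → ℓ i j = ℓ' i j) :
    defect ℓ' m σ = defect ℓ m σ -
      (-1 : ℤ) ^ m • gval (ℓ' σ.src σ.tgt - ℓ σ.src σ.tgt) m (Chain.rel hσ) := by
  have e : lettersTop ℓ' m σ = lettersTop ℓ m σ +
      gval (ℓ' σ.src σ.tgt - ℓ σ.src σ.tgt) m (Chain.rel hσ) :=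
    congrArg (fun g => gval g m OrderHom.id) (proj_wordSum hσ h)
  have e' : lettersArr ℓ' m σ = lettersArr ℓ m σ +
      (-1 : ℤ) ^ m • gval (ℓ' σ.src σ.tgt - ℓ σ.src σ.tgt) m (Chain.rel hσ) :=
    (lettersArr_eq ℓ' m σ).trans ((congrArg ((-1 : ℤ) ^ m • ·) e).trans ((smul_add _ _ _).trans
      (congrArg (· + _) (lettersArr_eq ℓ m σ).symm)))
  exact (congrArg (s.arr m σ - ·) e').trans (sub_add_eq_sub_sub _ _ _)

/-- Induction on the length of intervals: letters of length `N` are corrected by the defect on their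
interval. Defects on shorter chains do not involve these letters and remain zero. -/
lemma exists_letters (s : DGSimplex C n) (N : ℕ) : ∃ ℓ : NerveLetters s,
    ∀ m (σ : Chain n m), σ.tgt.1 - σ.src.1 < N → defect ℓ m σ = 0 := by
  induction N with
  | zero => exact ⟨fun _ _ => 0, fun _ _ h => absurd h (Nat.not_lt_zero _)⟩
  | succ N ih =>
    obtain ⟨ℓ, hℓ⟩ := ih
    have h : ∀ i j : Fin (n + 1), j.1 - i.1 = N →
        ∀ m (σ : Chain n m), σ.tgt.1 - σ.src.1 < j.1 - i.1 → defect ℓ m σ = 0 :=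
      fun i j e m σ hσ => hℓ m σ (e ▸ hσ)
    let ℓ' : NerveLetters s := fun i j =>
      if e : i < j ∧ j.1 - i.1 = N then ℓ i j + ⟨_, defect_mem e.1 (h i j e.2)⟩ else ℓ i j
    have hℓ' : ∀ i j, ¬ (i < j ∧ j.1 - i.1 = N) → ℓ' i j = ℓ i j := fun i j hij => dif_neg hij
    refine ⟨ℓ', fun m σ hN => ?_⟩
    by_cases hσ : σ.Strict
    swap
    · exact defect_of_not_strict ℓ' hσ
    -- The chain has length at most `N`, so no pair of strictly smaller length has been modified.
    refine (defect_change (ℓ := ℓ) hσ fun i j hij => (hℓ' i j fun e => by omega).symm).trans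
      (sub_eq_zero.2 ?_)
    by_cases e : σ.tgt.1 - σ.src.1 = N
    · have e₁ : ℓ' σ.src σ.tgt - ℓ σ.src σ.tgt = ⟨_, defect_mem hσ.1 (h _ _ e)⟩ :=
        (congrArg (· - ℓ σ.src σ.tgt) (dif_pos ⟨hσ.1, e⟩)).trans (add_sub_cancel_left _ _)
      refine Eq.trans ?_ (congrArg (fun g => (-1 : ℤ) ^ m • gval g m (Chain.rel hσ)) e₁.symm)
      -- The correction is indexed by `relChain` of `Chain.rel`, which equals `σ` only
      -- propositionally; `HEq` carries the defect across.
      have key : ∀ {σ' : Chain n m} (e : σ' = σ), HEq (defect ℓ m σ') (defect ℓ m σ) := by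
        rintro _ rfl
        rfl
      have e₂ : defect ℓ m (relChain hσ.1 (Chain.rel hσ)) = defect ℓ m σ :=
        eq_of_heq (key (relChain_rel hσ))
      exact ((congrArg (fun z => (-1 : ℤ) ^ m • (-1 : ℤ) ^ m • z) e₂).trans
        (neg_one_smul_smul m _)).symm
    · have e₁ : ℓ' σ.src σ.tgt - ℓ σ.src σ.tgt = 0 :=
        (congrArg (· - ℓ σ.src σ.tgt) (hℓ' _ _ fun e' => e e'.2)).trans (sub_self _)
      refine (hℓ m σ (by omega)).trans ?_
      refine Eq.trans ?_ (congrArg (fun g => (-1 : ℤ) ^ m • gval g m (Chain.rel hσ)) e₁.symm)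
      exact (smul_zero _).symm

/-- Every chain in `[n]` has length below `n + 1`, so letters fitted up to that length have no
defect at all. -/
lemma toNerve_surjective : Function.Surjective (toNerve (C := C) (n := n)) := by
  intro s
  obtain ⟨ℓ, hℓ⟩ := exists_letters s (n + 1)
  refine ⟨lettersHom ℓ, DGSimplex.ext rfl (heq_of_eq (funext fun m => funext fun σ => ?_))⟩
  exact (sub_eq_zero.1 (hℓ m σ (by omega))).symm

/-- The underlying simplicial set of the linear dg-nerve of a dg-category is its dg-nerve. -/
def nerveIsoObj (C : DGCat.{u} k) :
    (linearDGNerve k ⋙ underlyingSSet k).obj C ≅ (dgNerve k).obj C :=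
  -- Bijectivity in each dimension suffices for the isomorphism, because compatibility with the
  -- simplicial operators is known in the direction of `toNerve`.
  NatIso.ofComponents (fun Δ =>
    (Equiv.ofBijective (toNerve (C := C) (n := Δ.unop.len))
      ⟨toNerve_injective, toNerve_surjective⟩).toIso) fun {Δ Δ'} f =>
    ConcreteCategory.hom_ext _ _ fun G =>
      toNerve_restrict (n := Δ.unop.len) (n' := Δ'.unop.len) f.unop G

/-- The natural isomorphism between the underlying simplicial set of the linear dg-nerve and the
dg-nerve. -/
def mainIso (k : Type u) [CommRing k] :
    linearDGNerve k ⋙ underlyingSSet k ≅ dgNerve k :=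
  NatIso.ofComponents nerveIsoObj fun {C D} F => by
    refine NatTrans.ext (funext fun Δ => ConcreteCategory.hom_ext _ _ fun G => ?_)
    exact toNerve_comp (n := Δ.unop.len) F G

end Surjectivity

end LinDG

theorem mainTheorem4 (k : Type u) [CommRing k] :
    Nonempty (LinDG.linearDGNerve k ⋙ LinDG.underlyingSSet k ≅ LinDG.dgNerve k) :=
  ⟨LinDG.mainIso k⟩
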